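/- **Setting and notation.** Let $\kappa$ be a regular uncountable cardinal and $X\supseteq\kappa$ a set of ordinals. For a cardinal $\mu$ and a set $Y$ let $P_\mu Y=\{y\subseteq Y: |y|<\mu\}$. For $x\in P_\kappa X$ put $\kappa_x=|x\cap\kappa|$, and write $x\prec y$ if $x\subseteq y$ and $|x|<\kappa_y$. **Iterated stationarity.** Let $x\in P_\kappa X$ and $A\subseteq P_\kappa X$. The set $A$ is *$0$-s-strongly stationary in $P_{\kappa_x}x$* if $x\cap\kappa\neq\emptyset$ and for every $y\in P_{\kappa_x}x$ there is $z\in A\cap P_{\kappa_x}x$ with $y\prec z$. For an ordinal $\xi>0$, $A$ is *$\xi$-s-strongly stationary in $P_{\kappa_x}x$* if $\kappa_x$ is a (nonzero) limit cardinal and whenever $\zeta<\xi$ and $S,T\subseteq P_\kappa X$ are both $\zeta$-s-strongly stationary in $P_{\kappa_x}x$, there is $y\in A\cap P_{\kappa_x}x$ such that $S$ and $T$ are both $\zeta$-s-strongly stationary in $P_{\kappa_y}y$. Let $$\mathrm{NS}^{\xi}_{\kappa_x,x}=\{A\subseteq P_\kappa X: A\text{ is not }\xi\text{-s-strongly stationary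 in }P_{\kappa_x}x\}.$$ **Strong normality.** An ideal $I$ of subsets of $P_\mu Y$ is *strongly normal* if for every $S\subseteq P_\mu Y$ with $S\notin I$ and every $f:S\to P_\mu Y$ with $f(y)\prec y$ for all $y\in S$, there is $T\subseteq S$ with $T\notin I$ on which $f$ is constant. The filter dual to $I$ is $I^*=\{B\subseteq P_\mu Y: P_\mu Y\setminus B\in I\}$; it is closed under $\prec$-diagonal intersections if $\{y\in P_\mu Y: y\in C_z\text{ for all }z\in P_\mu Y\text{ with }z\prec y\}\in I^*$ whenever $C_z\in I^*$ for all $z\in P_\mu Y$. **Indescribability.** A $\Pi^1_0=\Sigma^1_0$ formula is a finitary formula of second-order logic in the language of set theory (with equality, and with set variables used as unary predicates) without second-order quantifiers. A $\Pi^1_{\xi+1}$ formula is $\forall X_0\cdots\forall X_k\,\varphi$ with $\varphi$ a $\Sigma^1_\xi$ formula, and a $\Sigma^1_{\xi+1}$ formula is $\exists X_0\cdots\exists X_k\,\varphi$ with $\varphi$ a $\Pi^1_\xi$ formula; for a limit ordinal $\xi$, a $\Pi^1_\xi$ formula is $\bigwedge_{\zeta<\xi}\varphi_\zeta$ with each $\varphi_\zeta$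 a $\Pi^1_\zeta$ formula, and a $\Sigma^1_\xi$ formula is $\bigvee_{\zeta<\xi}\varphi_\zeta$ with each $\varphi_\zeta$ a $\Sigma^1_\zeta$ formula, in both cases with only finitely many free second-order variables in all. For a cardinal $\mu$ and a set of ordinals $Y$ let $V_0(\mu,Y)=Y$, $V_{\alpha+1}(\mu,Y)=P_\mu(V_\alpha(\mu,Y))\cup V_\alpha(\mu,Y)$, and $V_\alpha(\mu,Y)=\bigcup_{\eta<\alpha}V_\eta(\mu,Y)$ for limit $\alpha$. A set $S\subseteq P_\mu Y$ is *$\Pi^1_\xi$-indescribable in $P_\mu Y$* if for all $R_0,\dots,R_{n-1}\subseteq V_\mu(\mu,Y)$ and every $\Pi^1_\xi$ sentence $\varphi$ with $(V_\mu(\mu,Y),\in,R_0,\dots,R_{n-1})\models\varphi$ there is $y\in S$ such that, with $\mu_y=|y\cap\mu|$, we have $y\cap\mu=\mu_y$ and $(V_{\mu_y}(\mu_y,y),\in,R_0\cap V_{\mu_y}(\mu_y,y),\dots,R_{n-1}\cap V_{\mu_y}(\mu_y,y))\models\varphi$. **Proposition.** Let $x\in P_\kappa X$ with $x\cap\kappa=\kappa_x$,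 let $\xi<\kappa_x$, and suppose that $P_{\kappa_x}x$ is $\Pi^1_\xi$-indescribable in $P_{\kappa_x}x$. Then $\mathrm{NS}^{\xi+1}_{\kappa_x,x}$ is a proper strongly normal ideal on $P_\kappa X$, and its dual filter is closed under $\prec$-diagonal intersections. The same holds for its restriction $\{A\in\mathrm{NS}^{\xi+1}_{\kappa_x,x}: A\subseteq P_{\kappa_x}x\}$ as an ideal on $P_{\kappa_x}x$ (with $\prec$ and $\kappa_y$ computed from $\kappa_x$ in place of $\kappa$). -/

import Mathlib

universe u v

namespace TwoCardinal

open Cardinal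

noncomputable section

/-! ### The set `P_κ X` and its strong subset ordering

Everything takes place in the universe `ZFSet` of sets. A cardinal `κ` is identified with the
corresponding initial von Neumann ordinal `κ.ord.toZFSet`. Collections of sets such as `P_κ X` and
its subsets are given as `Set ZFSet`. -/

/-- The cardinal `κ` as a von Neumann ordinal. -/
def cardSet (κ : Cardinal.{u}) : ZFSet.{u} := κ.ord.toZFSet

/-- `P_κ X`: the subsets of `X` of cardinality less than `κ`. -/
def Pk (κ : Cardinal.{u}) (X : ZFSet.{u}) : Set ZFSet.{u} :=
  {y | y ⊆ X ∧ y.card < κ}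

/-- `κ_x = |x ∩ κ|`. -/
def kap (κ : Cardinal.{u}) (x : ZFSet.{u}) : Cardinal.{u} := (x ∩ cardSet κ).card

/-- The strong subset ordering: `x ≺ y` iff `x ⊆ y` and `|x| < κ_y`. -/
def StrongSub (κ : Cardinal.{u}) (x y : ZFSet.{u}) : Prop :=
  x ⊆ y ∧ x.card < kap κ y

/-! ### Iterated s-strong stationarity -/

/-- `A` is `≺`-cofinal in `P_{κ_x} x`. -/
def IsCofinalAt (κ : Cardinal.{u}) (A : Set ZFSet.{u}) (x : ZFSet.{u}) : Prop :=
  ∀ y ∈ Pk (kap κ x) x, ∃ z ∈ A, z ∈ Pk (kap κ x) x ∧ StrongSub κ y z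

/-- `A` is `ξ`-s-strongly stationary in `P_{κ_x} x`. At `ξ = 0` the clause `kap κ x ≠ 0`, that is
`x ∩ κ ≠ ∅`, excludes the points `x` at which `P_{κ_x} x` is empty and every set is vacuously
cofinal. At `ξ > 0` the cardinal `κ_x` has to be a limit cardinal (a nonzero cardinal which is not
the successor of a cardinal). -/
def IsSStat (κ : Cardinal.{u}) (X : ZFSet.{u}) (ξ : Ordinal.{u}) (A : Set ZFSet.{u})
    (x : ZFSet.{u}) : Prop :=
  (ξ = 0 → kap κ x ≠ 0 ∧ IsCofinalAt κ A x) ∧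
  (ξ ≠ 0 → Order.IsSuccLimit (kap κ x) ∧
    ∀ ζ, ζ < ξ → ∀ S T : Set ZFSet.{u}, S ⊆ Pk κ X → T ⊆ Pk κ X →
      IsSStat κ X ζ S x → IsSStat κ X ζ T x →
      ∃ y ∈ A, y ∈ Pk (kap κ x) x ∧ IsSStat κ X ζ S y ∧ IsSStat κ X ζ T y)
termination_by ξ
decreasing_by all_goals assumption

/-- `NS^ξ_{κ_x,x}`: the sets `A ⊆ P_κ X` that are not `ξ`-s-strongly stationary in `P_{κ_x} x`. -/
def NS (κ : Cardinal.{u}) (X x : ZFSet.{u}) (ξ : Ordinal.{u}) : Set (Set ZFSet.{u}) :=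
  {A | A ⊆ Pk κ X ∧ ¬ IsSStat κ X ξ A x}

/-! ### Ideals on `P_κ X` and strong normality -/

/-- `I` is a proper ideal of subsets of `P`. -/
structure IsIdealOn (P : Set ZFSet.{u}) (I : Set (Set ZFSet.{u})) : Prop where
  subset : ∀ A ∈ I, A ⊆ P
  empty : ∅ ∈ I
  mono : ∀ A ∈ I, ∀ B, B ⊆ A → B ∈ I
  union : ∀ A ∈ I, ∀ B ∈ I, A ∪ B ∈ I
  proper : P ∉ I

/-- `I` is strongly normal on `P_κ X`: every `≺`-regressive function on an `I`-positive set is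
constant on an `I`-positive subset. -/
def IsStronglyNormal (κ : Cardinal.{u}) (X : ZFSet.{u}) (I : Set (Set ZFSet.{u})) : Prop :=
  ∀ S, S ⊆ Pk κ X → S ∉ I → ∀ f : ZFSet.{u} → ZFSet.{u},
    (∀ y ∈ S, f y ∈ Pk κ X ∧ StrongSub κ (f y) y) →
    ∃ T, T ⊆ S ∧ T ∉ I ∧ ∃ z, ∀ y ∈ T, f y = z

/-- The filter on `P` dual to `I`. -/
def dualFilter (P : Set ZFSet.{u}) (I : Set (Set ZFSet.{u})) : Set (Set ZFSet.{u}) :=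
  {B | B ⊆ P ∧ P \ B ∈ I}

/-- The `≺`-diagonal intersection of `C z`, `z ∈ P_κ X`. -/
def diagInter (κ : Cardinal.{u}) (X : ZFSet.{u}) (C : ZFSet.{u} → Set ZFSet.{u}) :
    Set ZFSet.{u} :=
  {y | y ∈ Pk κ X ∧ ∀ z ∈ Pk κ X, StrongSub κ z y → y ∈ C z}

/-- The filter dual to `I` is closed under `≺`-diagonal intersections. -/
def IsDiagClosed (κ : Cardinal.{u}) (X : ZFSet.{u}) (I : Set (Set ZFSet.{u})) : Prop :=
  ∀ C : ZFSet.{u} → Set ZFSet.{u},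
    (∀ z ∈ Pk κ X, C z ∈ dualFilter (Pk κ X) I) → diagInter κ X C ∈ dualFilter (Pk κ X) I

/-! ### Second-order infinitary formulas of the language of set theory -/

/-- Relation symbols: membership and `n` unary predicates (the free second-order variables). -/
inductive SetRel (n : ℕ) : ℕ → Type
  | mem : SetRel n 2
  | pred (i : Fin n) : SetRel n 1

/-- The language of set theory with `n` unary predicates. -/
abbrev setLang (n : ℕ) : FirstOrder.Language := ⟨fun _ => Empty, SetRel n⟩

/-- The structure `(M, E, R_0, …, R_{n-1})`. -/
@[reducible] def setStructure {M : Type v} (E : M → M → Prop) {n : ℕ} (R : Fin n → Set M) :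
    (setLang n).Structure M where
  funMap f := Empty.elim f
  RelMap r w := match r, w with
    | SetRel.mem, w => E (w 0) (w 1)
    | SetRel.pred i, w => w 0 ∈ R i

/-- The two sides of the hierarchy of formulas. -/
inductive Side
  | pi
  | sigma

/-- `SOFormula Side.pi ξ n` are the `Π¹_ξ` formulas and `SOFormula Side.sigma ξ n` the `Σ¹_ξ`
formulas with free second-order variables among `n` given ones and no free first-order variable.
At level `0` these are the finitary formulas without second-order quantifiers; a `Π¹_{ξ+1}` formula
is a nonempty finite block of universal second-order quantifiers in front of a `Σ¹_ξ` formula; for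
a limit ordinal `ξ`, a `Π¹_ξ` formula is a conjunction of `Π¹_ζ` formulas, one for each `ζ < ξ`;
dually for `Σ¹_ξ`. -/
inductive SOFormula : Side → Ordinal.{u} → ℕ → Type (u + 1)
  | fo (s : Side) {n : ℕ} (φ : (setLang n).Sentence) : SOFormula s 0 n
  | all {ξ : Ordinal.{u}} {n : ℕ} (k : ℕ) (φ : SOFormula Side.sigma ξ (n + (k + 1))) :
      SOFormula Side.pi (ξ + 1) n
  | ex {ξ : Ordinal.{u}} {n : ℕ} (k : ℕ) (φ : SOFormula Side.pi ξ (n + (k + 1))) :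
      SOFormula Side.sigma (ξ + 1) n
  | conj {ξ : Ordinal.{u}} {n : ℕ} (hξ : Order.IsSuccLimit ξ)
      (φ : ∀ ζ, ζ < ξ → SOFormula Side.pi ζ n) : SOFormula Side.pi ξ n
  | disj {ξ : Ordinal.{u}} {n : ℕ} (hξ : Order.IsSuccLimit ξ)
      (φ : ∀ ζ, ζ < ξ → SOFormula Side.sigma ζ n) : SOFormula Side.sigma ξ n

/-- `φ.Sat E R`: the formula `φ` holds in `(M, E, R_0, …, R_{n-1})`, second-order quantifiers
ranging over all subsets of `M`. -/
def SOFormula.Sat {M : Type v} (E : M → M → Prop) :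
    ∀ {s : Side} {ξ : Ordinal.{u}} {n : ℕ}, SOFormula s ξ n → (Fin n → Set M) → Prop
  | _, _, n, .fo _ φ, R => @FirstOrder.Language.Sentence.Realize (setLang n) M (setStructure E R) φ
  | _, _, _, .all k φ, R => ∀ Y : Fin (k + 1) → Set M, φ.Sat E (Fin.append R Y)
  | _, _, _, .ex k φ, R => ∃ Y : Fin (k + 1) → Set M, φ.Sat E (Fin.append R Y)
  | _, _, _, .conj _ φ, R => ∀ ζ hζ, (φ ζ hζ).Sat E R
  | _, _, _, .disj _ φ, R => ∃ ζ hζ, (φ ζ hζ).Sat E R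

/-! ### Two-cardinal indescribability -/

/-- The hierarchy `V_α(κ, X)`: `V_0 = X`, `V_{α+1} = P_κ(V_α) ∪ V_α`, unions at limits. -/
def VHier (κ : Cardinal.{u}) (X : ZFSet.{u}) (α : Ordinal.{u}) : Set ZFSet.{u} :=
  Ordinal.limitRecOn α {a | a ∈ X}
    (fun _ U => {a | (∀ b ∈ a, b ∈ U) ∧ a.card < κ} ∪ U)
    (fun α _ U => {a | ∃ η, ∃ hη : η < α, a ∈ U η hη})

/-- The universe `V_κ(κ, X)` of the structure used in indescribability. -/
def VK (κ : Cardinal.{u}) (X : ZFSet.{u}) : Set ZFSet.{u} := VHier κ X κ.ord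

/-- `(V_κ(κ, X), ∈, R_0 ∩ V_κ(κ, X), …, R_{n-1} ∩ V_κ(κ, X)) ⊨ φ`. -/
def Models (κ : Cardinal.{u}) (X : ZFSet.{u}) {s : Side} {ξ : Ordinal.{u}} {n : ℕ}
    (R : Fin n → Set ZFSet.{u}) (φ : SOFormula s ξ n) : Prop :=
  φ.Sat (M := {a : ZFSet.{u} // a ∈ VK κ X}) (fun a b => a.1 ∈ b.1) (fun i => {a | a.1 ∈ R i})

/-- `S ⊆ P_κ X` is `Π¹_ξ`-indescribable in `P_κ X`. -/
def IsIndescribable (κ : Cardinal.{u}) (X : ZFSet.{u}) (ξ : Ordinal.{u}) (S : Set ZFSet.{u}) :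
    Prop :=
  ∀ (n : ℕ) (R : Fin n → Set ZFSet.{u}), (∀ i, R i ⊆ VK κ X) →
    ∀ φ : SOFormula.{u} Side.pi ξ n, Models κ X R φ →
      ∃ y ∈ S, y ∩ cardSet κ = cardSet (kap κ y) ∧ Models (kap κ y) y R φ

end

end TwoCardinal

namespace TwoCardinal

open Cardinal

/-! ### Closure properties of the second-order hierarchy -/

open FirstOrder FirstOrder.Language

/-! The heart of the matter is a reflection property, `ReflectsFamilies`: if sets F_z and G_z, for z
≺ x, are stationary in P_{κ_x}x of degrees ζ₁, ζ₂ ≤ ξ, then above every v ≺ x there is y ≺ x such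
that for all z ≺ y the sets F_z and G_z are stationary of these degrees in P_{κ_y}y.

The ideal properties follow by diagonalisation. The diagonal trace of a family of sets of degree ≤ ξ
is itself ξ-stationary (`isSStat_diagTrace`), and where the trace is ξ-stationary, so are the
members of the family in their degree (`IsSStat.of_diagTrace`). Hence a set B that is not
(ξ+1)-stationary has a single ξ-stationary witness E that is ξ-stationary at no point of B
(`exists_disjoint`). If A is (ξ+1)-stationary and no B_z is, the diagonal trace of the witnesses E_z
is ξ-stationary at some a ∈ A, and this a lies in no B_z with z ≺ a (`exists_notMem`). Closure under
unions, strong normality and diagonal intersections are instances of this.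

Reflection comes from definability: over suitable structures on V_{κ_y}(κ_y, y), "all sections of a
coded relation are stationary in the degrees listed in a coded set of ordinals ≤ ξ" is Π¹_ξ
(`exists_isSSDef`). Stationarity at points w ≺ y is first-order, because a predicate lists which
subsets of P(w) are stationary at w in which degree; this needs indices for all subsets of P(w)
inside y, hence that κ_x is a strong limit (`two_power_lt_kap`) and that y is closed under a
suitable function. Stationarity at y itself costs one block of universal set quantifiers per
successor degree.

At limit degrees a formula has only finitely many predicates and no names for ordinals, so the
conjunct of index ζ must recognise for itself that a set of ordinals is bounded below ξ. That is the
purpose of `expr_ordLE`. -/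

/-- Renaming of the predicates of the language of set theory. -/
def setLangMap {n n' : ℕ} (ρ : Fin n → Fin n') : setLang n →ᴸ setLang n' where
  onFunction := fun _ f => Empty.elim f
  onRelation := fun _ r => match r with
    | SetRel.mem => SetRel.mem
    | SetRel.pred i => SetRel.pred (ρ i)

theorem setLangMap_isExpansionOn {M : Type v} (E : M → M → Prop) {n n' : ℕ} (ρ : Fin n → Fin n')
    (R : Fin n' → Set M) :
    @LHom.IsExpansionOn (setLang n) (setLang n') (setLangMap ρ) M
      (setStructure E (R ∘ ρ)) (setStructure E R) := by
  let _ := setStructure E (R ∘ ρ)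
  let _ := setStructure E R
  exact ⟨fun f => Empty.elim f, fun r x => by cases r <;> rfl⟩

/-- Truth of a first-order sentence in `(M, E, R)`. -/
def FOSat {M : Type v} (E : M → M → Prop) {n : ℕ} (R : Fin n → Set M)
    (χ : (setLang n).Sentence) : Prop :=
  @Sentence.Realize (setLang n) M (setStructure E R) χ

theorem exists_rename_sentence {n n' : ℕ} (χ : (setLang n).Sentence) (ρ : Fin n → Fin n') :
    ∃ χ' : (setLang n').Sentence, ∀ {M : Type v} (E : M → M → Prop) (R : Fin n' → Set M),
      FOSat E R χ' ↔ FOSat E (R ∘ ρ) χ := by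
  refine ⟨(setLangMap ρ).onSentence χ, fun {M} E R => ?_⟩
  exact @LHom.realize_onSentence (setLang n) (setLang n') M (setStructure E (R ∘ ρ))
    (setStructure E R) (setLangMap ρ) (setLangMap_isExpansionOn E ρ R) χ

@[simp]
theorem FOSat_not {M : Type v} {E : M → M → Prop} {n : ℕ} {R : Fin n → Set M}
    {χ : (setLang n).Sentence} : FOSat E R (Formula.not χ) ↔ ¬ FOSat E R χ := Iff.rfl

@[simp]
theorem FOSat_inf {M : Type v} {E : M → M → Prop} {n : ℕ} {R : Fin n → Set M}
    {χ χ' : (setLang n).Sentence} : FOSat E R (χ ⊓ χ') ↔ FOSat E R χ ∧ FOSat E R χ' :=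
  @BoundedFormula.realize_inf (setLang n) M (setStructure E R) _ _ _ _ _ _

@[simp]
theorem FOSat_imp {M : Type v} {E : M → M → Prop} {n : ℕ} {R : Fin n → Set M}
    {χ χ' : (setLang n).Sentence} : FOSat E R (χ.imp χ') ↔ (FOSat E R χ → FOSat E R χ') :=
  Iff.rfl

namespace SOFormula

variable {n : ℕ} {ξ : Ordinal.{u}}

@[simp] theorem sat_fo {M : Type v} (E : M → M → Prop) (R : Fin n → Set M) (s : Side)
    (χ : (setLang n).Sentence) : (fo.{u} s χ).Sat E R ↔ FOSat E R χ := Iff.rfl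

@[simp] theorem sat_all {M : Type v} (E : M → M → Prop) (R : Fin n → Set M) (k : ℕ)
    (φ : SOFormula Side.sigma ξ (n + (k + 1))) :
    (all k φ).Sat E R ↔ ∀ Y : Fin (k + 1) → Set M, φ.Sat E (Fin.append R Y) := Iff.rfl

@[simp] theorem sat_ex {M : Type v} (E : M → M → Prop) (R : Fin n → Set M) (k : ℕ)
    (φ : SOFormula Side.pi ξ (n + (k + 1))) :
    (ex k φ).Sat E R ↔ ∃ Y : Fin (k + 1) → Set M, φ.Sat E (Fin.append R Y) := Iff.rfl

@[simp] theorem sat_conj {M : Type v} (E : M → M → Prop) (R : Fin n → Set M)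
    (hξ : Order.IsSuccLimit ξ) (φ : ∀ ζ, ζ < ξ → SOFormula Side.pi ζ n) :
    (conj hξ φ).Sat E R ↔ ∀ ζ hζ, (φ ζ hζ).Sat E R := Iff.rfl

@[simp] theorem sat_disj {M : Type v} (E : M → M → Prop) (R : Fin n → Set M)
    (hξ : Order.IsSuccLimit ξ) (φ : ∀ ζ, ζ < ξ → SOFormula Side.sigma ζ n) :
    (disj hξ φ).Sat E R ↔ ∃ ζ hζ, (φ ζ hζ).Sat E R := Iff.rfl

theorem append_comp_addCases {M : Type v} {n n' k k' : ℕ} (R : Fin n' → Set M)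
    (Y : Fin k' → Set M) (ρ : Fin n → Fin n') (τ : Fin k → Fin k') :
    Fin.append R Y ∘ Fin.addCases (fun i => Fin.castAdd k' (ρ i)) (fun j => Fin.natAdd n' (τ j)) =
      Fin.append (R ∘ ρ) (Y ∘ τ) := by
  funext i
  refine Fin.addCases (fun i => ?_) (fun j => ?_) i <;> simp

theorem exists_rename {s : Side} (φ : SOFormula s ξ n) : ∀ {n' : ℕ} (ρ : Fin n → Fin n'),
    ∃ ψ : SOFormula s ξ n', ∀ {M : Type v} (E : M → M → Prop) (R : Fin n' → Set M),
      ψ.Sat E R ↔ φ.Sat E (R ∘ ρ) := by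
  induction φ with
  | fo s χ =>
    intro n' ρ
    obtain ⟨χ', h⟩ := exists_rename_sentence.{v} χ ρ
    exact ⟨fo s χ', fun E R => h E R⟩
  | all k φ ih =>
    intro n' ρ
    obtain ⟨ψ, h⟩ := ih (Fin.addCases (fun i => Fin.castAdd (k + 1) (ρ i))
      (fun j => Fin.natAdd n' (id j)))
    exact ⟨all k ψ, fun E R => by simp only [sat_all, h, append_comp_addCases]; rfl⟩
  | ex k φ ih =>
    intro n' ρ
    obtain ⟨ψ, h⟩ := ih (Fin.addCases (fun i => Fin.castAdd (k + 1) (ρ i))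
      (fun j => Fin.natAdd n' (id j)))
    exact ⟨ex k ψ, fun E R => by simp only [sat_ex, h, append_comp_addCases]; rfl⟩
  | conj hξ φ ih =>
    intro n' ρ
    choose ψ h using fun ζ hζ => ih ζ hζ ρ
    exact ⟨conj hξ ψ, fun E R => by simp only [sat_conj, h]⟩
  | disj hξ φ ih =>
    intro n' ρ
    choose ψ h using fun ζ hζ => ih ζ hζ ρ
    exact ⟨disj hξ ψ, fun E R => by simp only [sat_disj, h]⟩

end SOFormula

/-- The dual side of the hierarchy. -/
@[reducible]
def Side.swap : Side → Side
  | .pi => .sigma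
  | .sigma => .pi

namespace SOFormula

variable {n : ℕ} {ξ : Ordinal.{u}}

theorem exists_neg {s : Side} (φ : SOFormula s ξ n) :
    ∃ ψ : SOFormula s.swap ξ n, ∀ {M : Type v} (E : M → M → Prop) (R : Fin n → Set M),
      ψ.Sat E R ↔ ¬ φ.Sat E R := by
  induction φ with
  | fo s χ => exact ⟨fo _ (Formula.not χ), fun E R => Iff.rfl⟩
  | all k φ ih =>
    obtain ⟨ψ, h⟩ := ih
    exact ⟨ex k ψ, fun E R => by simp only [sat_all, sat_ex, h, not_forall]⟩
  | ex k φ ih =>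
    obtain ⟨ψ, h⟩ := ih
    exact ⟨all k ψ, fun E R => by simp only [sat_all, sat_ex, h, not_exists]⟩
  | conj hξ φ ih =>
    choose ψ h using ih
    exact ⟨disj hξ ψ, fun E R => by simp only [sat_conj, sat_disj, h, not_forall]⟩
  | disj hξ φ ih =>
    choose ψ h using ih
    exact ⟨conj hξ ψ, fun E R => by simp only [sat_conj, sat_disj, h, not_exists]⟩

/-- Dummy quantifiers: `Σ¹_ξ ⊆ Π¹_{ξ+1}` and `Π¹_ξ ⊆ Σ¹_{ξ+1}`. -/
theorem exists_pad_swap {s : Side} (φ : SOFormula s ξ n) :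
    ∃ ψ : SOFormula s.swap (ξ + 1) n, ∀ {M : Type v} (E : M → M → Prop) (R : Fin n → Set M),
      ψ.Sat E R ↔ φ.Sat E R := by
  obtain ⟨ψ, h⟩ := exists_rename.{u, v} φ (Fin.castAdd (0 + 1))
  have h' : ∀ {M : Type v} (E : M → M → Prop) (R : Fin n → Set M) (Y : Fin (0 + 1) → Set M),
      ψ.Sat E (Fin.append R Y) ↔ φ.Sat E R := by
    intro M E R Y
    rw [h, show Fin.append R Y ∘ Fin.castAdd (0 + 1) = R by funext i; simp]
  cases s
  · exact ⟨ex 0 ψ, fun E R => by simp only [sat_ex, h', exists_const]⟩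
  · exact ⟨all 0 ψ, fun E R => by simp only [sat_all, h', forall_const]⟩

theorem exists_top (s : Side) (ξ : Ordinal.{u}) (n : ℕ) :
    ∃ ψ : SOFormula s ξ n, ∀ {M : Type v} (E : M → M → Prop) (R : Fin n → Set M),
      ψ.Sat E R := by
  induction ξ using Ordinal.limitRecOn generalizing s n with
  | zero => exact ⟨fo s ⊤, fun E R => (@Formula.realize_top _ _ (setStructure E R) _ _).2 trivial⟩
  | add_one ξ ih =>
    obtain ⟨ψ, h⟩ := ih s.swap n
    obtain ⟨ψ', h'⟩ := exists_pad_swap.{u, v} ψ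
    cases s <;> exact ⟨ψ', fun E R => (h' E R).2 (h E R)⟩
  | limit ξ hξ ih =>
    choose ψ h using fun ζ hζ => ih ζ hζ s n
    cases s
    · exact ⟨conj hξ ψ, fun E R ζ hζ => h ζ hζ E R⟩
    · exact ⟨disj hξ ψ, fun E R => ⟨0, hξ.bot_lt, h 0 _ E R⟩⟩

theorem exists_bot (s : Side) (ξ : Ordinal.{u}) (n : ℕ) :
    ∃ ψ : SOFormula s ξ n, ∀ {M : Type v} (E : M → M → Prop) (R : Fin n → Set M),
      ¬ ψ.Sat E R := by
  obtain ⟨ψ, h⟩ := exists_top.{u, v} s.swap ξ n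
  obtain ⟨ψ', h'⟩ := exists_neg.{u, v} ψ
  cases s <;> exact ⟨ψ', fun E R H => (h' E R).1 H (h E R)⟩

theorem exists_fo_of_eq_zero {s : Side} (φ : SOFormula s ξ n) (h : ξ = 0) :
    ∃ χ : (setLang n).Sentence, ∀ {M : Type v} (E : M → M → Prop) (R : Fin n → Set M),
      φ.Sat E R ↔ FOSat E R χ := by
  cases φ with
  | fo s χ => exact ⟨χ, fun E R => Iff.rfl⟩
  | all | ex => exact absurd h (by simp)
  | conj hξ | disj hξ => exact absurd h hξ.bot_lt.ne'

theorem exists_all_of_eq {ζ : Ordinal.{u}} {s : Side} (φ : SOFormula s ζ n) (h : ζ = ξ + 1)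
    (hs : s = Side.pi) :
    ∃ (k : ℕ) (ψ : SOFormula Side.sigma ξ (n + (k + 1))),
      ∀ {M : Type v} (E : M → M → Prop) (R : Fin n → Set M),
        φ.Sat E R ↔ ∀ Y, ψ.Sat E (Fin.append R Y) := by
  cases φ with
  | fo s χ => exact absurd h.symm (by simp)
  | all k ψ =>
    obtain rfl := Order.succ_injective h
    exact ⟨k, ψ, fun E R => Iff.rfl⟩
  | ex => cases hs
  | conj hξ => subst h; exact absurd rfl (hξ.succ_ne ξ)
  | disj => cases hs

theorem exists_conj_of_isSuccLimit {s : Side} (φ : SOFormula s ξ n) (h : Order.IsSuccLimit ξ)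
    (hs : s = Side.pi) :
    ∃ ψ : ∀ ζ, ζ < ξ → SOFormula Side.pi ζ n,
      ∀ {M : Type v} (E : M → M → Prop) (R : Fin n → Set M),
        φ.Sat E R ↔ ∀ ζ hζ, (ψ ζ hζ).Sat E R := by
  cases φ with
  | fo s χ => exact absurd rfl h.bot_lt.ne'
  | all k ψ => exact absurd rfl (h.succ_ne _)
  | ex => cases hs
  | conj hξ ψ => exact ⟨ψ, fun E R => Iff.rfl⟩
  | disj => cases hs

/-- The size of the leading block of quantifiers can be increased. -/
theorem exists_all_block {k K : ℕ} (hk : k ≤ K) (ψ : SOFormula Side.sigma ξ (n + (k + 1))) :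
    ∃ ψ' : SOFormula Side.sigma ξ (n + (K + 1)),
      ∀ {M : Type v} (E : M → M → Prop) (R : Fin n → Set M) (Y : Fin (K + 1) → Set M),
        ψ'.Sat E (Fin.append R Y) ↔
          ψ.Sat E (Fin.append R (Y ∘ Fin.castLE (Nat.succ_le_succ hk))) := by
  obtain ⟨ψ', h⟩ := exists_rename.{u, v} ψ (Fin.addCases (fun i => Fin.castAdd (K + 1) (id i))
    (fun j => Fin.natAdd n (Fin.castLE (Nat.succ_le_succ hk) j)))
  exact ⟨ψ', fun E R Y => by rw [h, append_comp_addCases]; rfl⟩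

theorem forall_comp_castLE {M : Type v} {k K : ℕ} (hk : k ≤ K) {P : (Fin k → Set M) → Prop} :
    (∀ Y : Fin K → Set M, P (Y ∘ Fin.castLE hk)) ↔ ∀ Y, P Y := by
  refine ⟨fun h Y => ?_, fun h Y => h _⟩
  have := h fun i => if hi : i.1 < k then Y ⟨i, hi⟩ else ∅
  convert this using 1
  funext i
  simp

/-- Definition by cases along a first-order sentence. -/
theorem exists_ite {s : Side} (χ : (setLang n).Sentence) (φ ψ : SOFormula s ξ n) :
    ∃ θ : SOFormula s ξ n, ∀ {M : Type v} (E : M → M → Prop) (R : Fin n → Set M),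
      θ.Sat E R ↔ (FOSat E R χ → φ.Sat E R) ∧ (¬ FOSat E R χ → ψ.Sat E R) := by
  -- The Σ side follows by negating both branches, so only the Π side needs the induction.
  suffices H : ∀ {n : ℕ} (χ : (setLang n).Sentence) (φ ψ : SOFormula Side.pi ξ n),
      ∃ θ : SOFormula Side.pi ξ n, ∀ {M : Type v} (E : M → M → Prop) (R : Fin n → Set M),
        θ.Sat E R ↔ (FOSat E R χ → φ.Sat E R) ∧ (¬ FOSat E R χ → ψ.Sat E R) by
    cases s
    · exact H χ φ ψ
    · obtain ⟨φ', hφ⟩ := exists_neg.{u, v} φ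
      obtain ⟨ψ', hψ⟩ := exists_neg.{u, v} ψ
      obtain ⟨θ, hθ⟩ := H χ φ' ψ'
      obtain ⟨θ', hθ'⟩ := exists_neg.{u, v} θ
      refine ⟨θ', fun E R => ?_⟩
      rw [hθ', hθ, hφ, hψ]
      tauto
  clear! n
  induction ξ using Ordinal.limitRecOn with
  | zero =>
    intro n χ φ ψ
    obtain ⟨a, ha⟩ := exists_fo_of_eq_zero.{u, v} φ rfl
    obtain ⟨b, hb⟩ := exists_fo_of_eq_zero.{u, v} ψ rfl
    refine ⟨fo _ ((χ.imp a) ⊓ ((Formula.not χ).imp b)), fun E R => ?_⟩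
    simp [ha, hb]
  | add_one ξ ih =>
    intro n χ φ ψ
    obtain ⟨k, a, ha⟩ := exists_all_of_eq.{u, v} φ rfl rfl
    obtain ⟨l, b, hb⟩ := exists_all_of_eq.{u, v} ψ rfl rfl
    obtain ⟨a', ha'⟩ := exists_all_block.{u, v} (le_max_left k l) a
    obtain ⟨b', hb'⟩ := exists_all_block.{u, v} (le_max_right k l) b
    obtain ⟨χ', hχ'⟩ := exists_rename_sentence.{v} χ (Fin.castAdd (max k l + 1))
    obtain ⟨a₀, ha₀⟩ := exists_neg.{u, v} a'
    obtain ⟨b₀, hb₀⟩ := exists_neg.{u, v} b'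
    obtain ⟨θ, hθ⟩ := ih χ' a₀ b₀
    obtain ⟨θ', hθ'⟩ := exists_neg.{u, v} θ
    -- χ ignores the quantified predicates, so only one branch is alive throughout and the case
    -- distinction moves inside the quantifier block.
    refine ⟨all _ θ', fun {M} E R => ?_⟩
    have h0 : ∀ Y : Fin (max k l + 1) → Set M, FOSat E (Fin.append R Y) χ' ↔ FOSat E R χ := by
      intro Y
      rw [hχ', show Fin.append R Y ∘ Fin.castAdd (max k l + 1) = R by funext i; simp]
    rw [ha, hb, ← forall_comp_castLE (Nat.succ_le_succ (le_max_left k l)),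
      ← forall_comp_castLE (Nat.succ_le_succ (le_max_right k l))]
    simp only [sat_all, hθ', hθ, h0, ha₀, hb₀, ha', hb']
    by_cases h : FOSat E R χ <;> simp [h]
  | limit ξ hξ ih =>
    intro n χ φ ψ
    obtain ⟨a, ha⟩ := exists_conj_of_isSuccLimit.{u, v} φ hξ rfl
    obtain ⟨b, hb⟩ := exists_conj_of_isSuccLimit.{u, v} ψ hξ rfl
    choose θ hθ using fun ζ hζ => ih ζ hζ χ (a ζ hζ) (b ζ hζ)
    refine ⟨conj hξ θ, fun E R => ?_⟩
    simp only [sat_conj, ha, hb, hθ]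
    by_cases h : FOSat E R χ <;> simp [h]

/-- `Π¹_ξ` is closed under conjunctions. -/
theorem exists_and (φ ψ : SOFormula Side.pi ξ n) :
    ∃ θ : SOFormula Side.pi ξ n, ∀ {M : Type v} [Nonempty M] (E : M → M → Prop)
      (R : Fin n → Set M), θ.Sat E R ↔ φ.Sat E R ∧ ψ.Sat E R := by
  induction ξ using Ordinal.limitRecOn with
  | zero =>
    obtain ⟨a, ha⟩ := exists_fo_of_eq_zero.{u, v} φ rfl
    obtain ⟨b, hb⟩ := exists_fo_of_eq_zero.{u, v} ψ rfl
    exact ⟨fo _ (a ⊓ b), fun E R => by simp [ha, hb]⟩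
  | add_one ξ _ =>
    obtain ⟨k, a, ha⟩ := exists_all_of_eq.{u, v} φ rfl rfl
    obtain ⟨l, b, hb⟩ := exists_all_of_eq.{u, v} ψ rfl rfl
    obtain ⟨a', ha'⟩ := exists_all_block.{u, v} (k := k) (K := max k l + 1) (by omega) a
    obtain ⟨b', hb'⟩ := exists_all_block.{u, v} (k := l) (K := max k l + 1) (by omega) b
    -- The extra last set variable is a switch: a nonempty value selects φ, the empty set selects ψ.
    -- The conjunction becomes a case distinction under the universal block. Selecting φ is possible
    -- because M is nonempty.
    let i : Fin (n + (max k l + 1 + 1)) := Fin.natAdd n (Fin.last _)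
    let χ : (setLang (n + (max k l + 1 + 1))).Sentence :=
      BoundedFormula.ex (Relations.boundedFormula₁ (SetRel.pred i) (Term.var (Sum.inr 0)))
    have hχ : ∀ {M : Type v} (E : M → M → Prop) (R : Fin n → Set M)
        (Y : Fin (max k l + 1 + 1) → Set M),
        FOSat E (Fin.append R Y) χ ↔ (Y (Fin.last _)).Nonempty := by
      intro M E R Y
      rw [show Y (Fin.last _) = Fin.append R Y i from (Fin.append_right R Y _).symm]
      let _ := setStructure E (Fin.append R Y)
      change BoundedFormula.Realize (M := M) _ _ _ ↔ _
      rw [BoundedFormula.realize_ex]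
      rfl
    obtain ⟨θ, hθ⟩ := exists_ite.{u, v} χ a' b'
    refine ⟨all _ θ, fun {M} _ E R => ?_⟩
    rw [ha, hb]
    simp only [sat_all, hθ, hχ, ha', hb']
    constructor
    · intro H
      constructor
      · intro Y
        have := (H (fun j => if hj : j.1 < k + 1 then Y ⟨j, hj⟩ else Set.univ)).1
          (by simp [Fin.last])
        convert this using 2
        funext j
        simpa using fun h => absurd j.2 (by omega)
      · intro Y
        have := (H (fun j => if hj : j.1 < l + 1 then Y ⟨j, hj⟩ else ∅)).2
          (by simp [Fin.last])
        convert this using 2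
        funext j
        simpa using fun h => absurd j.2 (by omega)
    · exact fun H Y => ⟨fun _ => H.1 _, fun _ => H.2 _⟩
  | limit ξ hξ ih =>
    obtain ⟨a, ha⟩ := exists_conj_of_isSuccLimit.{u, v} φ hξ rfl
    obtain ⟨b, hb⟩ := exists_conj_of_isSuccLimit.{u, v} ψ hξ rfl
    choose θ hθ using fun ζ hζ => ih ζ hζ (a ζ hζ) (b ζ hζ)
    refine ⟨conj hξ θ, fun E R => ?_⟩
    simp only [sat_conj, ha, hb, hθ]
    exact ⟨fun H => ⟨fun ζ hζ => (H ζ hζ).1, fun ζ hζ => (H ζ hζ).2⟩,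
      fun H ζ hζ => ⟨H.1 ζ hζ, H.2 ζ hζ⟩⟩

end SOFormula

/-! ### Iterated stationarity -/

variable {κ : Cardinal.{u}} {X x y z v w : ZFSet.{u}} {ξ ζ : Ordinal.{u}}
  {A B S T : Set ZFSet.{u}}

theorem kap_le_card : kap κ y ≤ y.card := ZFSet.card_mono fun _ h => (ZFSet.mem_inter.1 h).1

theorem kap_mono (h : y ⊆ z) : kap κ y ≤ kap κ z :=
  ZFSet.card_mono fun _ ha => ZFSet.mem_inter.2
    ⟨h (ZFSet.mem_inter.1 ha).1, (ZFSet.mem_inter.1 ha).2⟩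

theorem StrongSub.trans (h : StrongSub κ v w) (h' : StrongSub κ w y) : StrongSub κ v y :=
  ⟨fun _ ha => h'.1 (h.1 ha), (h.2.trans_le kap_le_card).trans h'.2⟩

theorem StrongSub.mono (hvw : v ⊆ w) (h : StrongSub κ w y) : StrongSub κ v y :=
  ⟨fun _ ha => h.1 (hvw ha), (ZFSet.card_mono hvw).trans_lt h.2⟩

theorem StrongSub.mem_Pk (h : StrongSub κ v y) (hy : y ∈ Pk κ X) : v ∈ Pk κ X :=
  ⟨fun _ ha => hy.1 (h.1 ha), (h.2.trans_le kap_le_card).trans hy.2⟩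

theorem strongSub_empty (h : kap κ y ≠ 0) : StrongSub κ ∅ y :=
  ⟨fun _ ha => absurd ha (ZFSet.notMem_empty _), by
    rw [ZFSet.card_empty]; exact pos_iff_ne_zero.2 h⟩

theorem exists_subset_card_eq {c : Cardinal.{u}} (h : c ≤ y.card) :
    ∃ s : ZFSet.{u}, s ⊆ y ∧ s.card = c := by
  have h' : lift.{u + 1} c ≤ #(y : Set ZFSet.{u}) := by
    rw [show #(y : Set ZFSet.{u}) = lift.{u + 1} y.card from ZFSet.cardinalMk_coe_sort]
    exact lift_le.2 h
  obtain ⟨p, hp, hc⟩ := le_mk_iff_exists_subset.1 h'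
  refine ⟨ZFSet.sep (· ∈ p) y, fun a ha => (ZFSet.mem_sep.1 ha).1, ?_⟩
  have : ((ZFSet.sep (· ∈ p) y : ZFSet.{u}) : Set ZFSet.{u}) = p := by
    ext a
    simp only [SetLike.mem_coe, ZFSet.mem_sep]
    exact ⟨fun h => h.2, fun h => ⟨hp h, h⟩⟩
  have e : #((ZFSet.sep (· ∈ p) y : ZFSet.{u}) : Set ZFSet.{u}) =
      lift.{u + 1} (ZFSet.sep (· ∈ p) y).card := ZFSet.cardinalMk_coe_sort
  rw [← lift_inj.{u, u + 1}, ← hc, ← e, this]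

/-- The union v ∪ w is padded by a subset of y ∩ κ whose size is the successor of max(|v|, |w|),
which is still below the limit κ_y. -/
theorem exists_strongSub_of_isSuccLimit (h : Order.IsSuccLimit (kap κ y))
    (hv : StrongSub κ v y) (hw : StrongSub κ w y) :
    ∃ z, StrongSub κ z y ∧ StrongSub κ v z ∧ StrongSub κ w z := by
  have hinf : ℵ₀ ≤ kap κ y := aleph0_le_of_isSuccLimit h
  have hc : Order.succ (max v.card w.card) < kap κ y := h.succ_lt (max_lt hv.2 hw.2)
  obtain ⟨s, hs, hsc⟩ := exists_subset_card_eq (y := y ∩ cardSet κ) hc.le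
  have hsub : ∀ a ∈ s, a ∈ (v ∪ w ∪ s) ∩ cardSet κ := fun a ha =>
    ZFSet.mem_inter.2 ⟨ZFSet.mem_union.2 (Or.inr ha), (ZFSet.mem_inter.1 (hs ha)).2⟩
  have hlt : max v.card w.card < kap κ (v ∪ w ∪ s) :=
    (Order.lt_succ _).trans_le (hsc ▸ ZFSet.card_mono hsub)
  refine ⟨v ∪ w ∪ s, ⟨?_, ?_⟩, ⟨?_, (le_max_left _ _).trans_lt hlt⟩,
    ⟨?_, (le_max_right _ _).trans_lt hlt⟩⟩
  · intro a ha
    simp only [ZFSet.mem_union] at ha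
    rcases ha with (ha | ha) | ha
    exacts [hv.1 ha, hw.1 ha, (ZFSet.mem_inter.1 (hs ha)).1]
  · refine (ZFSet.card_union_le).trans_lt (add_lt_of_lt hinf ?_ (hsc ▸ hc))
    exact (ZFSet.card_union_le).trans_lt (add_lt_of_lt hinf hv.2 hw.2)
  · exact fun a ha => ZFSet.mem_union.2 (Or.inl (ZFSet.mem_union.2 (Or.inl ha)))
  · exact fun a ha => ZFSet.mem_union.2 (Or.inl (ZFSet.mem_union.2 (Or.inr ha)))

theorem exists_nonempty_strongSub (h : Order.IsSuccLimit (kap κ y)) :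
    ∃ z, z ≠ ∅ ∧ StrongSub κ z y := by
  have h0 := strongSub_empty h.bot_lt.ne'
  obtain ⟨z, hz, h0z, -⟩ := exists_strongSub_of_isSuccLimit h h0 h0
  refine ⟨z, ?_, hz⟩
  rintro rfl
  exact absurd ((h0z.2).trans_le kap_le_card) (lt_irrefl _)

theorem isSStat_zero : IsSStat κ X 0 A y ↔ kap κ y ≠ 0 ∧ IsCofinalAt κ A y := by
  rw [IsSStat]
  simp

theorem isSStat_of_ne (h : ξ ≠ 0) : IsSStat κ X ξ A y ↔ Order.IsSuccLimit (kap κ y) ∧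
    ∀ ζ, ζ < ξ → ∀ S T : Set ZFSet.{u}, S ⊆ Pk κ X → T ⊆ Pk κ X →
      IsSStat κ X ζ S y → IsSStat κ X ζ T y →
      ∃ a ∈ A, StrongSub κ a y ∧ IsSStat κ X ζ S a ∧ IsSStat κ X ζ T a := by
  rw [IsSStat]
  simp only [h, false_implies, true_and, ne_eq, not_false_eq_true, true_implies]
  rfl

/-- In degree 0 this comes from cofinality: if |s| = c and s ≺ a ≺ y, then c < κ_a ≤ |a| < κ_y. -/
theorem IsSStat.isSuccLimit (h : IsSStat κ X ξ A y) : Order.IsSuccLimit (kap κ y) := by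
  rcases eq_or_ne ξ 0 with rfl | hξ
  · obtain ⟨h0, hc⟩ := isSStat_zero.1 h
    rw [Cardinal.isSuccLimit_iff]
    refine ⟨h0, Order.isSuccPrelimit_of_succ_lt fun c hcy => ?_⟩
    obtain ⟨s, hs, rfl⟩ := exists_subset_card_eq (hcy.le.trans kap_le_card)
    obtain ⟨a, -, ha, hsa⟩ := hc s ⟨hs, hcy⟩
    exact (Order.succ_le_of_lt (hsa.2.trans_le kap_le_card)).trans_lt ha.2
  · exact ((isSStat_of_ne hξ).1 h).1

theorem IsSStat.mono_set (hAB : ∀ a ∈ A, StrongSub κ a y → a ∈ B) (h : IsSStat κ X ξ A y) :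
    IsSStat κ X ξ B y := by
  rcases eq_or_ne ξ 0 with rfl | hξ
  · rw [isSStat_zero] at h ⊢
    refine ⟨h.1, fun v hv => ?_⟩
    obtain ⟨a, ha, hay, hva⟩ := h.2 v hv
    exact ⟨a, hAB a ha hay, hay, hva⟩
  · rw [isSStat_of_ne hξ] at h ⊢
    refine ⟨h.1, fun ζ hζ S T hS hT hSy hTy => ?_⟩
    obtain ⟨a, ha, hay, h'⟩ := h.2 ζ hζ S T hS hT hSy hTy
    exact ⟨a, hAB a ha hay, hay, h'⟩

/-- The cone above `v` is cofinal. -/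
theorem isSStat_zero_cone (hy : y ∈ Pk κ X) (h : Order.IsSuccLimit (kap κ y))
    (hv : StrongSub κ v y) : IsSStat κ X 0 {a ∈ Pk κ X | StrongSub κ v a} y := by
  refine isSStat_zero.2 ⟨h.bot_lt.ne', fun w hw => ?_⟩
  obtain ⟨z, hz, hvz, hwz⟩ := exists_strongSub_of_isSuccLimit h hv hw
  exact ⟨z, ⟨hz.mem_Pk hy, hvz⟩, hz, hwz⟩

/-- In positive degree, the cone above v is cofinal and so reflects to a point a of A. A cone that
is cofinal below a has a member below a, which puts a above v. -/
theorem IsSStat.zero (hy : y ∈ Pk κ X) (h : IsSStat κ X ξ A y) : IsSStat κ X 0 A y := by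
  rcases eq_or_ne ξ 0 with rfl | hξ
  · exact h
  refine isSStat_zero.2 ⟨h.isSuccLimit.bot_lt.ne', fun v hv => ?_⟩
  have hc := isSStat_zero_cone hy h.isSuccLimit hv
  have hs : {a ∈ Pk κ X | StrongSub κ v a} ⊆ Pk κ X := fun a ha => ha.1
  obtain ⟨a, ha, hay, hca, -⟩ :=
    ((isSStat_of_ne hξ).1 h).2 0 (pos_iff_ne_zero.2 hξ) _ _ hs hs hc hc
  obtain ⟨ha0, hca⟩ := isSStat_zero.1 hca
  obtain ⟨b, hb, hba, -⟩ := hca ∅ (strongSub_empty ha0)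
  exact ⟨a, ha, hay, hb.2.trans hba⟩

theorem IsSStat.exists_mem (hy : y ∈ Pk κ X) (h : IsSStat κ X ξ A y) (hv : StrongSub κ v y) :
    ∃ a ∈ A, StrongSub κ a y ∧ StrongSub κ v a :=
  (isSStat_zero.1 (h.zero hy)).2 v hv

theorem IsSStat.mono (hy : y ∈ Pk κ X) (hζ : ζ ≤ ξ) (h : IsSStat κ X ξ A y) :
    IsSStat κ X ζ A y := by
  rcases eq_or_ne ζ 0 with rfl | hζ0
  · exact h.zero hy
  · have hξ : ξ ≠ 0 := fun h => hζ0 (le_antisymm (h ▸ hζ) (zero_le))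
    rw [isSStat_of_ne hζ0]
    rw [isSStat_of_ne hξ] at h
    exact ⟨h.1, fun η hη => h.2 η (hη.trans_le hζ)⟩

/-- By induction, S may be replaced by its part above z before reflecting; a point where this part
is stationary must itself lie above z. -/
theorem IsSStat.inter_cone (hy : y ∈ Pk κ X) (h : IsSStat κ X ξ A y) (hz : StrongSub κ z y) :
    IsSStat κ X ξ {a ∈ A | StrongSub κ z a} y := by
  induction ξ using WellFoundedLT.induction generalizing A with
  | ind ξ ih =>
  rcases eq_or_ne ξ 0 with rfl | hξ
  · refine isSStat_zero.2 ⟨h.isSuccLimit.bot_lt.ne', fun v hv => ?_⟩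
    obtain ⟨w, hw, hvw, hzw⟩ := exists_strongSub_of_isSuccLimit h.isSuccLimit hv hz
    obtain ⟨a, ha, hay, hwa⟩ := h.exists_mem hy hw
    exact ⟨a, ⟨ha, hzw.trans hwa⟩, hay, hvw.trans hwa⟩
  · refine (isSStat_of_ne hξ).2 ⟨h.isSuccLimit, fun ζ hζ S T hS hT hSy hTy => ?_⟩
    obtain ⟨a, ha, hay, hSa, hTa⟩ := ((isSStat_of_ne hξ).1 h).2 ζ hζ _ T
      (fun b hb => hS hb.1) hT (ih ζ hζ hSy) hTy
    obtain ⟨b, hb, hba, -⟩ := hSa.exists_mem (hay.mem_Pk hy)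
      (strongSub_empty hSa.isSuccLimit.bot_lt.ne')
    exact ⟨a, ⟨ha, hb.2.trans hba⟩, hay, hSa.mono_set fun c hc _ => hc.1, hTa⟩

/-- Two reflections compose: first down to a point of A, then inside that point down to a point of
S. -/
theorem IsSStat.of_forall (hy : y ∈ Pk κ X) (hζ : ζ ≤ ξ) (h : IsSStat κ X ξ A y)
    (hA : ∀ a ∈ A, StrongSub κ a y → IsSStat κ X ζ S a) : IsSStat κ X ζ S y := by
  rcases eq_or_ne ζ 0 with rfl | hζ0
  · refine isSStat_zero.2 ⟨h.isSuccLimit.bot_lt.ne', fun v hv => ?_⟩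
    obtain ⟨a, ha, hay, hva⟩ := h.exists_mem hy hv
    obtain ⟨s, hs, hsa, hvs⟩ := (hA a ha hay).exists_mem (hay.mem_Pk hy) hva
    exact ⟨s, hs, hsa.trans hay, hvs⟩
  · have hξ : ξ ≠ 0 := fun h => hζ0 (le_antisymm (h ▸ hζ) (zero_le))
    refine (isSStat_of_ne hζ0).2 ⟨h.isSuccLimit, fun η hη U V hU hV hUy hVy => ?_⟩
    obtain ⟨a, ha, hay, hUa, hVa⟩ :=
      ((isSStat_of_ne hξ).1 h).2 η (hη.trans_le hζ) U V hU hV hUy hVy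
    obtain ⟨s, hs, hsa, h'⟩ :=
      ((isSStat_of_ne hζ0).1 (hA a ha hay)).2 η hη U V hU hV hUa hVa
    exact ⟨s, hs, hsa.trans hay, h'⟩

theorem isSStat_of_isSuccLimit (hξ : Order.IsSuccLimit ξ) (h : ∀ ζ < ξ, IsSStat κ X ζ A y) :
    IsSStat κ X ξ A y := by
  refine (isSStat_of_ne hξ.bot_lt.ne').2 ⟨(h 0 hξ.bot_lt).isSuccLimit, fun ζ hζ => ?_⟩
  exact ((isSStat_of_ne (by simp)).1 (h (ζ + 1) (hξ.succ_lt hζ))).2 ζ (Order.lt_succ ζ)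

/-! ### The ideal of non-stationary sets -/

/-- Simultaneous reflection of two families of stationary sets, of degrees at most `ξ`. -/
def ReflectsFamilies (κ : Cardinal.{u}) (X x : ZFSet.{u}) (ξ : Ordinal.{u}) : Prop :=
  ∀ ζ₁ ≤ ξ, ∀ ζ₂ ≤ ξ, ∀ F G : ZFSet.{u} → Set ZFSet.{u},
    (∀ z, StrongSub κ z x → IsSStat κ X ζ₁ (F z) x ∧ IsSStat κ X ζ₂ (G z) x) →
    ∀ v, StrongSub κ v x → ∃ y, StrongSub κ y x ∧ StrongSub κ v y ∧
      ∀ z, StrongSub κ z y → IsSStat κ X ζ₁ (F z) y ∧ IsSStat κ X ζ₂ (G z) y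

/-- The points at which all members `F z`, `z ≺ y`, of a family are `ζ`-stationary. -/
def diagTrace (κ : Cardinal.{u}) (X x : ZFSet.{u}) (ζ : Ordinal.{u})
    (F : ZFSet.{u} → Set ZFSet.{u}) : Set ZFSet.{u} :=
  {y | StrongSub κ y x ∧ ∀ z, StrongSub κ z y → IsSStat κ X ζ (F z) y}

/-- This is where reflecting two families of different degrees is needed: F is reflected together
with the test sets S and T of degree η < ξ. -/
theorem ReflectsFamilies.isSStat_diagTrace (H : ReflectsFamilies κ X x ξ)
    (hlim : Order.IsSuccLimit (kap κ x)) (hζ : ζ ≤ ξ) {F : ZFSet.{u} → Set ZFSet.{u}}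
    (hF : ∀ z, StrongSub κ z x → IsSStat κ X ζ (F z) x) :
    IsSStat κ X ξ (diagTrace κ X x ζ F) x := by
  rcases eq_or_ne ξ 0 with rfl | hξ
  · refine isSStat_zero.2 ⟨hlim.bot_lt.ne', fun v hv => ?_⟩
    obtain ⟨y, hy, hvy, h⟩ := H ζ hζ ζ hζ F F (fun z hz => ⟨hF z hz, hF z hz⟩) v hv
    exact ⟨y, ⟨hy, fun z hz => (h z hz).1⟩, hy, hvy⟩
  · refine (isSStat_of_ne hξ).2 ⟨hlim, fun η hη S T _ _ hSx hTx => ?_⟩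
    -- One family carries both test sets: S has index ∅ and T every nonempty index. Asking for y
    -- above a nonempty v makes both kinds of index occur below y. The same device is used for every
    -- pair of sets below.
    obtain ⟨v, hv0, hv⟩ := exists_nonempty_strongSub hlim
    classical
    obtain ⟨y, hy, hvy, h⟩ := H ζ hζ η hη.le F (fun z => if z = ∅ then S else T)
      (fun z hz => ⟨hF z hz, by split_ifs <;> assumption⟩) v hv
    have h0 : StrongSub κ ∅ y := hvy.mono (fun a ha => absurd ha (ZFSet.notMem_empty a))
    refine ⟨y, ⟨hy, fun z hz => (h z hz).1⟩, hy, ?_, ?_⟩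
    · simpa using (h ∅ h0).2
    · simpa [hv0] using (h v hvy).2

/-- The trace stays ξ-stationary on the cone above z, and at every point of that cone belonging to
the trace F z is ζ-stationary; `IsSStat.of_forall` transfers this up to y. -/
theorem IsSStat.of_diagTrace (hx : x ∈ Pk κ X) (hy : StrongSub κ y x) (hζ : ζ ≤ ξ)
    {F : ZFSet.{u} → Set ZFSet.{u}} (h : IsSStat κ X ξ (diagTrace κ X x ζ F) y)
    (hz : StrongSub κ z y) : IsSStat κ X ζ (F z) y :=
  (h.inter_cone (hy.mem_Pk hx) hz).of_forall (hy.mem_Pk hx) hζ fun _ ha _ => ha.1.2 z ha.2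

/-- A non-`(ξ+1)`-stationary set is disjoint from the trace of a `ξ`-stationary set. -/
theorem ReflectsFamilies.exists_disjoint (H : ReflectsFamilies κ X x ξ)
    (hlim : Order.IsSuccLimit (kap κ x)) (hx : x ∈ Pk κ X) (hA : ¬ IsSStat κ X (ξ + 1) A x) :
    ∃ E : Set ZFSet.{u}, IsSStat κ X ξ E x ∧
      ∀ a ∈ A, StrongSub κ a x → ¬ IsSStat κ X ξ E a := by
  rw [isSStat_of_ne (by simp)] at hA
  simp only [not_and, not_forall] at hA
  obtain ⟨ζ, hζ, S, T, -, -, hSx, hTx, hno⟩ := hA hlim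
  have hζ : ζ ≤ ξ := Order.lt_succ_iff.1 hζ
  classical
  refine ⟨diagTrace κ X x ζ (fun z => if z = ∅ then S else T),
    H.isSStat_diagTrace hlim hζ (fun z _ => by split_ifs <;> assumption), fun a ha hax h => hno ?_⟩
  obtain ⟨v, hv0, hv⟩ := exists_nonempty_strongSub h.isSuccLimit
  refine ⟨a, ha, hax, ?_, ?_⟩
  · simpa using h.of_diagTrace hx hax hζ (strongSub_empty h.isSuccLimit.bot_lt.ne')
  · simpa [hv0] using h.of_diagTrace hx hax hζ hv

/-- The diagonal trace packs the whole family into one set of degree ξ, against which A can be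
tested. -/
theorem ReflectsFamilies.exists_of_isSStat_succ (H : ReflectsFamilies κ X x ξ)
    (hx : x ∈ Pk κ X) {F : ZFSet.{u} → Set ZFSet.{u}}
    (hlim : Order.IsSuccLimit (kap κ x))
    (hF : ∀ z, StrongSub κ z x → IsSStat κ X ξ (F z) x) (hA : IsSStat κ X (ξ + 1) A x) :
    ∃ a ∈ A, StrongSub κ a x ∧ Order.IsSuccLimit (kap κ a) ∧
      ∀ z, StrongSub κ z a → IsSStat κ X ξ (F z) a := by
  have h := H.isSStat_diagTrace hlim le_rfl hF
  have hs : diagTrace κ X x ξ F ⊆ Pk κ X := fun a ha => ha.1.mem_Pk hx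
  obtain ⟨a, ha, hax, hEa, -⟩ :=
    ((isSStat_of_ne (by simp)).1 hA).2 ξ (Order.lt_succ ξ) _ _ hs hs h h
  exact ⟨a, ha, hax, hEa.isSuccLimit, fun z hz => hEa.of_diagTrace hx hax le_rfl hz⟩

variable {κ' : Cardinal.{u}} {X' : ZFSet.{u}}

/-- The key to strong normality: a positive set is not covered by the non-stationary sets `B z`,
`z ≺ y`. -/
theorem ReflectsFamilies.exists_notMem (H : ReflectsFamilies κ X x ξ)
    (hlim : Order.IsSuccLimit (kap κ x)) (hx : x ∈ Pk κ X) (hA : IsSStat κ X (ξ + 1) A x)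
    {B : ZFSet.{u} → Set ZFSet.{u}} (hB : ∀ z, StrongSub κ z x → ¬ IsSStat κ X (ξ + 1) (B z) x) :
    ∃ a ∈ A, StrongSub κ a x ∧ Order.IsSuccLimit (kap κ a) ∧ ∀ z, StrongSub κ z a → a ∉ B z := by
  have h (z : ZFSet.{u}) : ∃ E : Set ZFSet.{u}, StrongSub κ z x → IsSStat κ X ξ E x ∧
      ∀ a ∈ B z, StrongSub κ a x → ¬ IsSStat κ X ξ E a := by
    by_cases hz : StrongSub κ z x
    · obtain ⟨E, hE⟩ := H.exists_disjoint hlim hx (hB z hz)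
      exact ⟨E, fun _ => hE⟩
    · exact ⟨∅, fun h => absurd h hz⟩
  -- Every E z has degree exactly ξ, whatever the degree at which B z failed, so the E z form a
  -- family of one degree.
  choose E hE using h
  obtain ⟨a, ha, hax, hal, h⟩ :=
    H.exists_of_isSStat_succ hx hlim (fun z hz => (hE z hz).1) hA
  exact ⟨a, ha, hax, hal, fun z hz hB =>
    (hE z (hz.trans hax)).2 a hB hax (h z hz)⟩

/-- The conclusion of the main theorem, for `(κ', X') = (κ, X)` and `(κ', X') = (κ_x, x)` at
once. -/
theorem ReflectsFamilies.isIdealOn (H : ReflectsFamilies κ X x ξ)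
    (hlim : Order.IsSuccLimit (kap κ x)) (hx : x ∈ Pk κ X)
    (h₁ : Pk (kap κ x) x ⊆ Pk κ' X') (h₂ : Pk κ' X' ⊆ Pk κ X)
    (h₃ : ∀ y, StrongSub κ y x → ∀ z, StrongSub κ' z y ↔ StrongSub κ z y) :
    IsIdealOn (Pk κ' X') {A ∈ NS κ X x (ξ + 1) | A ⊆ Pk κ' X'} ∧
    IsStronglyNormal κ' X' {A ∈ NS κ X x (ξ + 1) | A ⊆ Pk κ' X'} ∧
    IsDiagClosed κ' X' {A ∈ NS κ X x (ξ + 1) | A ⊆ Pk κ' X'} := by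
  have hI : ∀ A : Set ZFSet.{u}, A ∈ {A ∈ NS κ X x (ξ + 1) | A ⊆ Pk κ' X'} ↔
      A ⊆ Pk κ' X' ∧ ¬ IsSStat κ X (ξ + 1) A x :=
    fun A => ⟨fun h => ⟨h.2, h.1.2⟩, fun h => ⟨⟨h.1.trans h₂, h.2⟩, h.1⟩⟩
  generalize {A ∈ NS κ X x (ξ + 1) | A ⊆ Pk κ' X'} = I at hI
  refine ⟨⟨fun A hA => ((hI A).1 hA).1, ?_, ?_, ?_, ?_⟩, ?_, ?_⟩
  · refine (hI ∅).2 ⟨Set.empty_subset _, fun h => ?_⟩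
    obtain ⟨a, ha, -⟩ := h.exists_mem hx (strongSub_empty hlim.bot_lt.ne')
    exact ha
  · intro A hA B hBA
    rw [hI] at hA ⊢
    exact ⟨hBA.trans hA.1, fun h => hA.2 (h.mono_set fun a ha _ => hBA ha)⟩
  · intro A hA B hB
    rw [hI] at hA hB ⊢
    refine ⟨Set.union_subset hA.1 hB.1, fun h => ?_⟩
    classical
    -- The sets to be avoided are A at index ∅ and B at the other indices; both indices occur below
    -- a.
    obtain ⟨a, ha, -, hal, h⟩ := H.exists_notMem hlim hx h (B := fun z => if z = ∅ then A else B)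
      (fun z _ => by split_ifs; exacts [hA.2, hB.2])
    obtain ⟨v, hv0, hv⟩ := exists_nonempty_strongSub hal
    rcases ha with ha | ha
    · exact h ∅ (strongSub_empty hal.bot_lt.ne') (by simpa using ha)
    · exact h v hv (by simpa [hv0] using ha)
  · rw [hI]
    refine fun h => h.2 ((isSStat_of_ne (by simp)).2 ⟨hlim, fun ζ hζ S T _ _ hSx hTx => ?_⟩)
    have hζ : ζ ≤ ξ := Order.lt_succ_iff.1 hζ
    obtain ⟨y, hy, hvy, h⟩ := H ζ hζ ζ hζ (fun _ => S) (fun _ => T) (fun _ _ => ⟨hSx, hTx⟩) ∅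
      (strongSub_empty hlim.bot_lt.ne')
    exact ⟨y, h₁ hy, hy, h ∅ hvy⟩
  · intro S hS hSI f hf
    by_contra hcon
    push Not at hcon
    have hS' : IsSStat κ X (ξ + 1) S x := by
      by_contra h
      exact hSI ((hI S).2 ⟨hS, h⟩)
    -- If every fibre of f were non-stationary, some a would avoid all fibres of index z ≺ a,
    -- although f a ≺ a.
    obtain ⟨a, ha, hax, -, h⟩ := H.exists_notMem hlim hx hS' (B := fun z => {a ∈ S | f a = z})
      (fun z _ hz => by
        obtain ⟨a, ha, h⟩ := hcon {a ∈ S | f a = z} (fun a ha => ha.1)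
          (fun h => ((hI _).1 h).2 hz) z
        exact h ha.2)
    exact h (f a) ((h₃ a hax _).1 (hf a ha).2) ⟨ha, rfl⟩
  · intro C hC
    refine ⟨fun a ha => ha.1, (hI _).2 ⟨Set.sdiff_subset, fun h => ?_⟩⟩
    obtain ⟨a, ha, hax, -, h⟩ := H.exists_notMem hlim hx h (B := fun z => Pk κ' X' \ C z)
      (fun z hz => ((hI _).1 (hC z (h₁ hz)).2).2)
    refine ha.2 ⟨ha.1, fun z _ hza => ?_⟩
    by_contra hzC
    exact h z ((h₃ a hax z).1 hza) ⟨ha.1, hzC⟩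

/-! ### The hierarchy `V_α(κ, X)` -/

section VHier

variable {μ μ' : Cardinal.{u}} {x y a b c : ZFSet.{u}} {α β : Ordinal.{u}}

theorem VHier_zero : VHier μ y 0 = {a | a ∈ y} := by
  rw [VHier, Ordinal.limitRecOn_zero]

theorem VHier_add_one :
    VHier μ y (α + 1) = {a | (∀ b ∈ a, b ∈ VHier μ y α) ∧ a.card < μ} ∪ VHier μ y α := by
  rw [VHier, Ordinal.limitRecOn_add_one]
  rfl

theorem VHier_limit (hα : Order.IsSuccLimit α) :
    VHier μ y α = {a | ∃ β, ∃ _ : β < α, a ∈ VHier μ y β} := by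
  rw [VHier, Ordinal.limitRecOn_limit _ _ _ _ hα]
  rfl

theorem VHier_mono (h : α ≤ β) : VHier μ y α ⊆ VHier μ y β := by
  induction β using Ordinal.limitRecOn with
  | zero =>
    obtain rfl : α = 0 := le_antisymm h (zero_le)
    exact subset_rfl
  | add_one β ih =>
    rcases h.eq_or_lt with rfl | h
    · exact subset_rfl
    · rw [VHier_add_one]
      exact (ih (Order.lt_succ_iff.1 h)).trans Set.subset_union_right
  | limit β hβ ih =>
    rcases h.eq_or_lt with rfl | h
    · exact subset_rfl
    · rw [VHier_limit hβ]
      exact fun a ha => ⟨α, h, ha⟩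

theorem VHier_subset_VHier (hyx : y ⊆ x) (hμ : μ ≤ μ') : VHier μ y α ⊆ VHier μ' x α := by
  induction α using Ordinal.limitRecOn with
  | zero => rw [VHier_zero, VHier_zero]; exact fun a ha => hyx ha
  | add_one α ih =>
    rw [VHier_add_one, VHier_add_one]
    rintro a (⟨h, hc⟩ | h)
    · exact Or.inl ⟨fun b hb => ih (h b hb), hc.trans_le hμ⟩
    · exact Or.inr (ih h)
  | limit α hα ih =>
    rw [VHier_limit hα, VHier_limit hα]
    rintro a ⟨β, hβ, h⟩
    exact ⟨β, hβ, ih β hβ h⟩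

theorem VK_subset_VK (hyx : y ⊆ x) (hμ : μ ≤ μ') : VK μ y ⊆ VK μ' x :=
  (VHier_mono (Cardinal.ord_le_ord.2 hμ)).trans (VHier_subset_VHier hyx hμ)

theorem mem_VK_of_mem (h : a ∈ y) : a ∈ VK μ y :=
  VHier_mono (zero_le) (by rw [VHier_zero]; exact h)

/-- The elements of y behave like urelements: y need not be transitive, so closure under elements
and the size bound are available only outside y. -/
theorem forall_mem_VHier (h : a ∈ VHier μ y α) (ha : a ∉ y) :
    (∀ b ∈ a, b ∈ VHier μ y α) ∧ a.card < μ := by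
  induction α using Ordinal.limitRecOn with
  | zero => rw [VHier_zero] at h; exact absurd h ha
  | add_one α ih =>
    have hm : VHier μ y α ⊆ VHier μ y (α + 1) := VHier_mono (Order.le_succ α)
    have h' := h
    rw [VHier_add_one] at h'
    rcases h' with ⟨h, hc⟩ | h
    · exact ⟨fun b hb => hm (h b hb), hc⟩
    · exact ⟨fun b hb => hm ((ih h).1 b hb), (ih h).2⟩
  | limit α hα ih =>
    rw [VHier_limit hα] at h
    obtain ⟨β, hβ, h⟩ := h
    exact ⟨fun b hb => VHier_mono hβ.le ((ih β hβ h).1 b hb), (ih β hβ h).2⟩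

theorem mem_VK_of_mem_VK (h : a ∈ VK μ y) (ha : a ∉ y) (hb : b ∈ a) : b ∈ VK μ y :=
  (forall_mem_VHier h ha).1 b hb

theorem card_lt_of_mem_VK (h : a ∈ VK μ y) (ha : a ∉ y) : a.card < μ :=
  (forall_mem_VHier h ha).2

theorem mem_VK_of_forall (hμ : ℵ₀ ≤ μ) (hα : α < μ.ord) (h : ∀ b ∈ a, b ∈ VHier μ y α)
    (hc : a.card < μ) : a ∈ VK μ y := by
  refine VHier_mono (α := α + 1) ((isSuccLimit_ord hμ).succ_lt hα).le ?_
  rw [VHier_add_one]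
  exact Or.inl ⟨h, hc⟩

theorem exists_lt_of_mem_VK (hμ : ℵ₀ ≤ μ) (h : a ∈ VK μ y) :
    ∃ α < μ.ord, a ∈ VHier μ y α := by
  rw [VK, VHier_limit (isSuccLimit_ord hμ)] at h
  obtain ⟨α, hα, h⟩ := h
  exact ⟨α, hα, h⟩

/-- Since μ may be singular, a set of size below μ could have elements at unbounded levels; the
condition on b puts its elements into one level below μ. -/
theorem insert_mem_VK (hμ : ℵ₀ ≤ μ) (ha : a ∈ VK μ y) (hb : b ⊆ y ∨ b ∈ VK μ y ∧ b ∉ y)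
    (hc : b.card < μ) : insert a b ∈ VK μ y := by
  obtain ⟨α, hα, h⟩ := exists_lt_of_mem_VK hμ ha
  have : ∃ β < μ.ord, ∀ c ∈ b, c ∈ VHier μ y β := by
    rcases hb with hb | ⟨hb, hby⟩
    · refine ⟨0, (isSuccLimit_ord hμ).bot_lt, fun c hc => ?_⟩
      rw [VHier_zero]
      exact hb hc
    · obtain ⟨β, hβ, h⟩ := exists_lt_of_mem_VK hμ hb
      exact ⟨β, hβ, (forall_mem_VHier h hby).1⟩
  obtain ⟨β, hβ, h'⟩ := this
  refine mem_VK_of_forall hμ (max_lt hα hβ) (fun c hc => ?_)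
    (ZFSet.card_insert_le.trans_lt (add_lt_of_lt hμ hc (one_lt_aleph0.trans_le hμ)))
  rcases ZFSet.mem_insert_iff.1 hc with rfl | hc
  · exact VHier_mono (le_max_left _ _) h
  · exact VHier_mono (le_max_right _ _) (h' c hc)

theorem finite_mem_VK (hμ : ℵ₀ ≤ μ) (s : Finset ZFSet.{u}) (hs : ∀ b ∈ s, b ∈ VK μ y)
    (ha : ∀ b, b ∈ a ↔ b ∈ s) : a ∈ VK μ y := by
  have h1 : ∃ α < μ.ord, ∀ b ∈ s, b ∈ VHier μ y α := by
    clear ha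
    induction s using Finset.cons_induction with
    | empty => exact ⟨0, (isSuccLimit_ord hμ).bot_lt, by simp⟩
    | cons c s hc ih =>
      obtain ⟨α, hα, h⟩ := ih fun b hb => hs b (Finset.mem_cons.2 (Or.inr hb))
      obtain ⟨β, hβ, h'⟩ := exists_lt_of_mem_VK hμ (hs c (Finset.mem_cons_self c s))
      refine ⟨max α β, max_lt hα hβ, fun b hb => ?_⟩
      rcases Finset.mem_cons.1 hb with rfl | hb
      · exact VHier_mono (le_max_right _ _) h'
      · exact VHier_mono (le_max_left _ _) (h b hb)
  obtain ⟨α, hα, h⟩ := h1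
  refine mem_VK_of_forall hμ hα (fun b hb => h b ((ha b).1 hb)) (lt_of_lt_of_le ?_ hμ)
  have : (a : Set ZFSet.{u}) = (s : Set ZFSet.{u}) := by ext b; simpa using ha b
  have e : #(a : Set ZFSet.{u}) = lift.{u + 1} a.card := ZFSet.cardinalMk_coe_sort
  rw [← lift_lt_aleph0.{u, u + 1}, ← e, this]
  exact lt_aleph0_of_finite _

end VHier

/-! ### Coding of tuples -/

section Codes

variable {κ : Cardinal.{u}} {y a b c v w p : ZFSet.{u}}

/-- A set which is not an ordinal. -/
def mark : ZFSet.{u} := {{∅}}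

/-- The code of a set of ordinals; codes are never ordinals. -/
def code (v : ZFSet.{u}) : ZFSet.{u} := insert mark v

/-- Three ordinals used as tags. -/
noncomputable def tag (i : Fin 3) : ZFSet.{u} := Ordinal.toZFSet (i.1 : Ordinal.{u})

/-- A coded set with a tag. -/
noncomputable def tagged (i : Fin 3) (v : ZFSet.{u}) : ZFSet.{u} := {tag i, code v}

/-- The code of the triple `(t 0, t 1, t 2)`. -/
noncomputable def triple (t : Fin 3 → ZFSet.{u}) : ZFSet.{u} :=
  {tagged 0 (t 0), tagged 1 (t 1), tagged 2 (t 2)}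

theorem not_isOrdinal_mark : ¬ mark.{u}.IsOrdinal := fun h => by
  have h0 := h.mem_trans (x := ∅) (y := {∅}) (by simp) (by simp [mark])
  simp only [mark, ZFSet.mem_singleton] at h0
  have h1 : (∅ : ZFSet.{u}) ∈ ({∅} : ZFSet.{u}) := ZFSet.mem_singleton.2 rfl
  rw [← h0] at h1
  exact ZFSet.notMem_empty ∅ h1

theorem not_isOrdinal_of_mem (h : a ∈ b) (ha : ¬ a.IsOrdinal) : ¬ b.IsOrdinal :=
  fun hb => ha (hb.mem h)

theorem mark_mem_code : mark ∈ code v := ZFSet.mem_insert _ _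

theorem not_isOrdinal_code : ¬ (code v).IsOrdinal :=
  not_isOrdinal_of_mem mark_mem_code not_isOrdinal_mark

theorem isOrdinal_tag (i : Fin 3) : (tag.{u} i).IsOrdinal := ZFSet.isOrdinal_toZFSet _

theorem code_ne_tag (i : Fin 3) : code v ≠ tag i :=
  fun h => not_isOrdinal_code (h ▸ isOrdinal_tag i)

theorem tag_injective : Function.Injective tag.{u} := fun _ _ h =>
  Fin.ext (Nat.cast_injective (Ordinal.toZFSet_injective h))

theorem code_injOn (hv : ∀ a ∈ v, a.IsOrdinal) (hw : ∀ a ∈ w, a.IsOrdinal)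
    (h : code v = code w) : v = w := by
  have key : ∀ {v w : ZFSet.{u}}, (∀ a ∈ v, a.IsOrdinal) → code v = code w → v ⊆ w := by
    intro v w hv h a ha
    have : a ∈ code w := h ▸ ZFSet.mem_insert_of_mem _ ha
    rcases ZFSet.mem_insert_iff.1 this with rfl | h
    · exact absurd (hv _ ha) not_isOrdinal_mark
    · exact h
  exact ZFSet.ext fun a => ⟨fun h' => key hv h h', fun h' => key hw h.symm h'⟩

theorem not_isOrdinal_tagged (i : Fin 3) : ¬ (tagged i v).IsOrdinal :=
  not_isOrdinal_of_mem (a := code v) (by simp [tagged]) not_isOrdinal_code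

theorem not_isOrdinal_triple (t : Fin 3 → ZFSet.{u}) : ¬ (triple t).IsOrdinal :=
  not_isOrdinal_of_mem (a := tagged 0 (t 0)) (by simp [triple]) (not_isOrdinal_tagged 0)

theorem mem_triple (t : Fin 3 → ZFSet.{u}) : a ∈ triple t ↔ ∃ i, a = tagged i (t i) := by
  simp only [triple, ZFSet.mem_insert_iff, ZFSet.mem_singleton]
  constructor
  · rintro (h | h | h)
    exacts [⟨0, h⟩, ⟨1, h⟩, ⟨2, h⟩]
  · rintro ⟨i, h⟩
    fin_cases i
    exacts [Or.inl h, Or.inr (Or.inl h), Or.inr (Or.inr h)]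

/-- `y` is a set of ordinals with `y ∩ κ = κ_y`. -/
structure IsStd (κ : Cardinal.{u}) (y : ZFSet.{u}) : Prop where
  ord : ∀ a ∈ y, a.IsOrdinal
  inter : y ∩ cardSet κ = cardSet (kap κ y)

/-- The hierarchy adds no ordinals to y: a new one would have size below κ_y, hence belong to κ_y =
y ∩ κ. -/
theorem IsStd.mem_of_isOrdinal (hy : IsStd κ y) (ha : a.IsOrdinal) (h : a ∈ VK (kap κ y) y) :
    a ∈ y := by
  by_contra hay
  have hc := card_lt_of_mem_VK h hay
  refine hay (ZFSet.mem_inter.1 (?_ : _ ∈ y ∩ cardSet κ)).1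
  rw [hy.inter, cardSet, ← ha.toZFSet_rank_eq, Ordinal.toZFSet_mem_toZFSet_iff, lt_ord,
    ← Ordinal.card_toZFSet, ha.toZFSet_rank_eq]
  exact hc

/-- A code is not an ordinal, so it lies outside y and the size bound of the hierarchy applies to
it. Together with `IsGood.code_mem` this makes a predicate of codes at x restrict at y to the codes
of the v ≺ y. -/
theorem IsStd.strongSub_of_code_mem (hy : IsStd κ y) (hv : ∀ a ∈ v, a.IsOrdinal)
    (h : code v ∈ VK (kap κ y) y) : StrongSub κ v y := by
  have hcy : code v ∉ y := fun h => not_isOrdinal_code (hy.ord _ h)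
  refine ⟨fun a ha => hy.mem_of_isOrdinal (hv a ha)
    (mem_VK_of_mem_VK h hcy (ZFSet.mem_insert_of_mem _ ha)), ?_⟩
  exact (ZFSet.card_mono fun a ha => ZFSet.mem_insert_of_mem _ ha).trans_lt
    (card_lt_of_mem_VK h hcy)

theorem toZFSet_mem_of_lt (hy : IsStd κ y) {α : Ordinal.{u}} (h : α < (kap κ y).ord) :
    α.toZFSet ∈ y := by
  refine (ZFSet.mem_inter.1 (?_ : _ ∈ y ∩ cardSet κ)).1
  rw [hy.inter, cardSet]
  exact Ordinal.toZFSet_mem_toZFSet_iff.2 h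

theorem strongSub_toZFSet_iff (hy : IsStd κ y) {α : Ordinal.{u}} :
    StrongSub κ α.toZFSet y ↔ α < (kap κ y).ord := by
  rw [StrongSub, Ordinal.card_toZFSet, ← lt_ord]
  refine ⟨fun h => h.2, fun h => ⟨fun a ha => ?_, h⟩⟩
  obtain ⟨β, hβ, rfl⟩ := Ordinal.mem_toZFSet_iff.1 ha
  exact toZFSet_mem_of_lt hy (hβ.trans h)

/-- `y` is standard and `κ_y` is infinite. -/
structure IsGood (κ : Cardinal.{u}) (y : ZFSet.{u}) : Prop extends IsStd κ y where
  inf : ℵ₀ ≤ kap κ y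

theorem IsGood.tag_mem (hy : IsGood κ y) (i : Fin 3) : tag i ∈ VK (kap κ y) y :=
  mem_VK_of_mem (toZFSet_mem_of_lt hy.toIsStd
    ((Ordinal.natCast_lt_omega0 _).trans_le (by
      rw [← ord_aleph0]; exact Cardinal.ord_le_ord.2 hy.inf)))

theorem IsGood.code_mem (hy : IsGood κ y) (h : StrongSub κ v y) :
    code v ∈ VK (kap κ y) y := by
  refine insert_mem_VK hy.inf ?_ (Or.inl h.1) h.2
  refine finite_mem_VK hy.inf {{∅}} (fun b hb => ?_) (fun b => by simp [mark])
  rw [Finset.mem_singleton.1 hb]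
  have h1 : tag.{u} 1 = {∅} := by
    rw [tag, show (((1 : Fin 3) : ℕ) : Ordinal.{u}) = 0 + 1 by simp, Ordinal.toZFSet_add_one,
      Ordinal.toZFSet_zero]
    rfl
  exact h1 ▸ hy.tag_mem 1

theorem IsGood.tagged_mem (hy : IsGood κ y) (i : Fin 3) (h : StrongSub κ v y) :
    tagged i v ∈ VK (kap κ y) y := by
  refine finite_mem_VK hy.inf (Finset.cons (tag i) {code v} ?_) (fun b hb => ?_) (fun b => ?_)
  · simpa using (code_ne_tag i).symm
  · simp only [Finset.mem_cons, Finset.mem_singleton] at hb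
    rcases hb with rfl | rfl
    exacts [hy.tag_mem i, hy.code_mem h]
  · simp [tagged]

theorem IsGood.triple_mem (hy : IsGood κ y) {t : Fin 3 → ZFSet.{u}}
    (h : ∀ i, StrongSub κ (t i) y) : triple t ∈ VK (kap κ y) y := by
  classical
  refine finite_mem_VK hy.inf (Finset.univ.image fun i => tagged i (t i)) (fun b hb => ?_)
    (fun b => ?_)
  · obtain ⟨i, -, rfl⟩ := Finset.mem_image.1 hb
    exact hy.tagged_mem i (h i)
  · rw [mem_triple]
    simp [eq_comm]

theorem IsStd.mem_of_mem_triple (hy : IsStd κ y) {t : Fin 3 → ZFSet.{u}}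
    (h : triple t ∈ VK (kap κ y) y) (i : Fin 3) :
    tagged i (t i) ∈ VK (kap κ y) y ∧ code (t i) ∈ VK (kap κ y) y := by
  have h1 : tagged i (t i) ∈ VK (kap κ y) y :=
    mem_VK_of_mem_VK h (fun h => not_isOrdinal_triple t (hy.ord _ h))
      ((mem_triple t).2 ⟨i, rfl⟩)
  exact ⟨h1, mem_VK_of_mem_VK h1 (fun h => not_isOrdinal_tagged i (hy.ord _ h))
    (by simp [tagged])⟩

/-- Decoding of the coordinates of a triple. -/
theorem IsStd.exists_coord_iff (hy : IsStd κ y) {t : Fin 3 → ZFSet.{u}}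
    (ht : ∀ i, ∀ a ∈ t i, a.IsOrdinal) (hv : ∀ a ∈ v, a.IsOrdinal)
    (h : triple t ∈ VK (kap κ y) y) (i : Fin 3) :
    (∃ q ∈ VK (kap κ y) y, q ∈ triple t ∧ tag i ∈ q ∧ code v ∈ q) ↔ v = t i := by
  constructor
  · rintro ⟨q, -, hq, hi, hvq⟩
    obtain ⟨j, rfl⟩ := (mem_triple t).1 hq
    simp only [tagged, ZFSet.mem_insert_iff, ZFSet.mem_singleton] at hi hvq
    -- Tags are ordinals and codes are not, so the two elements of a tagged pair cannot be confused.
    have hij : i = j := by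
      rcases hi with hi | hi
      · exact tag_injective hi
      · exact absurd hi.symm (code_ne_tag i)
    subst hij
    rcases hvq with hvq | hvq
    · exact absurd hvq (code_ne_tag i)
    · exact code_injOn hv (ht i) hvq
  · rintro rfl
    exact ⟨_, (hy.mem_of_mem_triple h i).1, (mem_triple t).2 ⟨i, rfl⟩, by simp [tagged],
      by simp [tagged]⟩

end Codes

open FirstOrder FirstOrder.Language

/-! ### First-order definability with named variables -/

section RawFO

variable {n : ℕ}

/-- A property of a structure with `n` predicates and an assignment of first-order variables. -/
abbrev RawProp (n : ℕ) : Type (v + 1) :=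
  ∀ M : Type v, (M → M → Prop) → (Fin n → Set M) → (ℕ → M) → Prop

/-- First-order definability. -/
def RawFO (P : RawProp.{v} n) : Prop :=
  ∃ φ : (setLang n).Formula ℕ, ∀ (M : Type v) (E : M → M → Prop) (R : Fin n → Set M) (a : ℕ → M),
    @Formula.Realize (setLang n) M (setStructure E R) ℕ φ a ↔ P M E R a

variable {P Q : RawProp.{v} n}

theorem RawFO.congr (h : RawFO P) (e : ∀ M E R a, P M E R a ↔ Q M E R a) : RawFO Q := by
  obtain ⟨φ, hφ⟩ := h
  exact ⟨φ, fun M E R a => (hφ M E R a).trans (e M E R a)⟩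

theorem RawFO.not (h : RawFO P) : RawFO fun M E R a => ¬ P M E R a := by
  obtain ⟨φ, hφ⟩ := h
  exact ⟨Formula.not φ, fun M E R a => not_congr (hφ M E R a)⟩

theorem RawFO.imp (h : RawFO P) (h' : RawFO Q) : RawFO fun M E R a => P M E R a → Q M E R a := by
  obtain ⟨φ, hφ⟩ := h
  obtain ⟨ψ, hψ⟩ := h'
  exact ⟨BoundedFormula.imp φ ψ, fun M E R a => imp_congr (hφ M E R a) (hψ M E R a)⟩

theorem RawFO.and (h : RawFO P) (h' : RawFO Q) : RawFO fun M E R a => P M E R a ∧ Q M E R a :=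
  ((h.imp h'.not).not).congr fun M E R a => by tauto

theorem RawFO.all (k : ℕ) (h : RawFO P) :
    RawFO fun M E R a => ∀ m, P M E R (Function.update a k m) := by
  obtain ⟨φ, hφ⟩ := h
  let g : ℕ → ℕ ⊕ Unit := fun i => if i = k then Sum.inr () else Sum.inl i
  refine ⟨(φ.relabel g).iAlls Unit, fun M E R a => ?_⟩
  let _ := setStructure E R
  have hg : ∀ i : Unit → M, (Sum.elim a i) ∘ g = Function.update a k (i ()) := by
    intro i
    funext j
    by_cases hj : j = k <;> simp [g, hj]
  rw [Formula.realize_iAlls]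
  simp only [Formula.realize_relabel]
  constructor
  · intro H m
    have := H fun _ => m
    rw [hg] at this
    exact (hφ M E R _).1 this
  · intro H i
    rw [hg]
    exact (hφ M E R _).2 (H _)

theorem RawFO.ex (k : ℕ) (h : RawFO P) :
    RawFO fun M E R a => ∃ m, P M E R (Function.update a k m) :=
  (h.not.all k).not.congr fun M E R a => by simp

theorem RawFO.mem (i j : ℕ) : RawFO fun (M : Type v) E (_ : Fin n → Set M) a => E (a i) (a j) :=
  ⟨Relations.formula₂ (SetRel.mem : (setLang n).Relations 2) (Term.var i) (Term.var j),
    fun _ _ _ _ => Iff.rfl⟩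

theorem RawFO.pred (r : Fin n) (i : ℕ) :
    RawFO fun (M : Type v) _ (R : Fin n → Set M) a => a i ∈ R r :=
  ⟨Relations.formula₁ (SetRel.pred r : (setLang n).Relations 1) (Term.var i),
    fun _ _ _ _ => Iff.rfl⟩

theorem RawFO.exists_sentence (h : RawFO P) (r : Fin n) :
    ∃ χ : (setLang n).Sentence, ∀ (M : Type v) (E : M → M → Prop) (R : Fin n → Set M),
      FOSat E R χ ↔ ∃ m ∈ R r, P M E R fun _ => m := by
  obtain ⟨φ, hφ⟩ := (RawFO.pred r 0).and h
  refine ⟨(φ.relabel (fun _ => Sum.inr () : ℕ → Empty ⊕ Unit)).iExs Unit, fun M E R => ?_⟩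
  let _ := setStructure E R
  change Formula.Realize (M := M) _ _ ↔ _
  rw [Formula.realize_iExs]
  simp only [Formula.realize_relabel]
  constructor
  · rintro ⟨i, hi⟩
    exact ⟨i (), (hφ M E R _).1 hi⟩
  · rintro ⟨m, hm⟩
    exact ⟨fun _ => m, (hφ M E R _).2 hm⟩

/-- The triple relation coded by the predicate `r`. -/
def RawTriple (n : ℕ) (r : Fin n) (t : Fin 3 → ℕ) (τ : Fin 3 → Fin n) : RawProp.{v} n :=
  fun _ E R a => ∃ p, p ∈ R r ∧
    (∃ q, E q p ∧ (∃ s, s ∈ R (τ 0) ∧ E s q) ∧ E (a (t 0)) q) ∧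
    (∃ q, E q p ∧ (∃ s, s ∈ R (τ 1) ∧ E s q) ∧ E (a (t 1)) q) ∧
    (∃ q, E q p ∧ (∃ s, s ∈ R (τ 2) ∧ E s q) ∧ E (a (t 2)) q)

/-- Variables 100, 101 and 102 are reserved for the bound p, q and s, hence the bound on the free
ones. -/
theorem RawFO.triple (r : Fin n) (t : Fin 3 → ℕ) (τ : Fin 3 → Fin n)
    (ht : ∀ i, t i < 100) : RawFO (RawTriple.{v} n r t τ) := by
  have h (i : Fin 3) : RawFO fun (_ : Type v) E (R : Fin n → Set _) a =>
      ∃ q, E q (a 100) ∧ (∃ s, s ∈ R (τ i) ∧ E s q) ∧ E (a (t i)) q := by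
    refine (((RawFO.mem 101 100).and ((((RawFO.pred (τ i) 102).and (RawFO.mem 102 101)).ex 102).and
      (RawFO.mem (t i) 101))).ex 101).congr fun M E R a => ?_
    have := ht i
    simp [show t i ≠ 101 by omega]
  refine (((RawFO.pred r 100).and ((h 0).and ((h 1).and (h 2)))).ex 100).congr fun M E R a => ?_
  simp [RawTriple, (ht _).ne]

end RawFO

/-! ### Definability over the structures `V_{κ_y}(κ_y, y)` -/

/-- The number of predicates in use. -/
abbrev NN : ℕ := 17 + 1

/-- The universe of the structure at `y`. -/
abbrev MM (κ : Cardinal.{u}) (y : ZFSet.{u}) : Type (u + 1) :=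
  {a : ZFSet.{u} // a ∈ VK (kap κ y) y}

/-- Membership. -/
def EE (κ : Cardinal.{u}) (y : ZFSet.{u}) : MM κ y → MM κ y → Prop := fun a b => a.1 ∈ b.1

/-- The individuals coded at `y`, that is `P_{κ_y} y`. -/
abbrev Ind (κ : Cardinal.{u}) (y : ZFSet.{u}) : Type (u + 1) := {v : ZFSet.{u} // StrongSub κ v y}

section Decode

variable {κ : Cardinal.{u}} {y : ZFSet.{u}}

/-- Membership of coded individuals. -/
def MemU (D : Set (MM κ y)) (v : ZFSet.{u}) : Prop := ∃ m ∈ D, m.1 = code v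

/-- `v` is the `i`-th coordinate of `p`. -/
def Coord (p : MM κ y) (i : Fin 3) (v : ZFSet.{u}) : Prop :=
  ∃ q : MM κ y, q.1 ∈ p.1 ∧ tag i ∈ q.1 ∧ code v ∈ q.1

/-- Membership of coded triples. -/
def MemT (D : Set (MM κ y)) (t : Fin 3 → ZFSet.{u}) : Prop := ∃ p ∈ D, ∀ i, Coord p i (t i)

theorem memT_iff (hy : IsGood κ y) {D : Set (MM κ y)} {s : Set (Fin 3 → ZFSet.{u})}
    (hs : ∀ t ∈ s, ∀ i, ∀ a ∈ t i, a.IsOrdinal) (hD : ∀ m : MM κ y, m ∈ D ↔ ∃ t ∈ s, m.1 = triple t)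
    {t : Fin 3 → ZFSet.{u}} (ht : ∀ i, StrongSub κ (t i) y) : MemT D t ↔ t ∈ s := by
  have hto : ∀ i, ∀ a ∈ t i, a.IsOrdinal := fun i a ha => hy.ord a ((ht i).1 ha)
  constructor
  · rintro ⟨p, hp, h⟩
    obtain ⟨t', ht', hpt⟩ := (hD p).1 hp
    have h' : t = t' := by
      funext i
      refine (hy.exists_coord_iff (hs t' ht') (hto i) (hpt ▸ p.2) i).1 ?_
      obtain ⟨q, hq⟩ := h i
      exact ⟨q.1, q.2, hpt ▸ hq⟩
    exact h' ▸ ht'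
  · intro h
    refine ⟨⟨triple t, hy.triple_mem ht⟩, (hD _).2 ⟨t, h, rfl⟩, fun i => ?_⟩
    obtain ⟨q, hq, h'⟩ := (hy.exists_coord_iff hto (hto i) (hy.triple_mem ht) i).2 rfl
    exact ⟨⟨q, hq⟩, h'⟩

theorem memU_iff (hy : IsGood κ y) {D : Set (MM κ y)} {s : Set ZFSet.{u}}
    (hs : ∀ v ∈ s, ∀ a ∈ v, a.IsOrdinal) (hD : ∀ m : MM κ y, m ∈ D ↔ ∃ v ∈ s, m.1 = code v)
    {v : ZFSet.{u}} (hv : StrongSub κ v y) : MemU D v ↔ v ∈ s := by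
  constructor
  · rintro ⟨m, hm, h⟩
    obtain ⟨w, hw, h'⟩ := (hD m).1 hm
    rwa [code_injOn (fun a ha => hy.ord a (hv.1 ha)) (hs w hw) (h.symm.trans h')]
  · exact fun h => ⟨⟨code v, hy.code_mem hv⟩, (hD _).2 ⟨v, h, rfl⟩, rfl⟩

end Decode

section Definability

variable {κ : Cardinal.{u}}

/-- A class of structures. -/
abbrev StrClass (κ : Cardinal.{u}) : Type (u + 1) :=
  ∀ y : ZFSet.{u}, (Fin NN → Set (MM κ y)) → Prop

/-- The predicates `0, 1, 2, 3` are the codes and the tags. -/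
structure IsCoded (κ : Cardinal.{u}) (y : ZFSet.{u}) (W : Fin NN → Set (MM κ y)) : Prop where
  good : IsGood κ y
  codes : ∀ m, m ∈ W 0 ↔ ∃ v, StrongSub κ v y ∧ m.1 = code v
  tags : ∀ (i : Fin 3) m, m ∈ W (![1, 2, 3] i) ↔ m.1 = tag i

theorem IsCoded.nonempty {y : ZFSet.{u}} {W : Fin NN → Set (MM κ y)} (h : IsCoded κ y W) :
    Nonempty (Ind κ y) :=
  ⟨⟨∅, strongSub_empty (aleph0_pos.trans_le h.good.inf).ne'⟩⟩

/-- A property of the structure at `y` and an assignment of individuals. -/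
abbrev IndProp (κ : Cardinal.{u}) : Type (u + 1) :=
  ∀ y : ZFSet.{u}, (Fin NN → Set (MM κ y)) → (ℕ → Ind κ y) → Prop

/-- First-order definability over the structures of the class `K`. -/
def FOExpr (K : StrClass κ) (Q : IndProp κ) : Prop :=
  ∃ P : RawProp.{u + 1} NN, RawFO P ∧ ∀ y W, K y W → ∀ (p : ℕ → Ind κ y) (a : ℕ → MM κ y),
    (∀ i, (a i).1 = code (p i).1) → (P (MM κ y) (EE κ y) W a ↔ Q y W p)

variable {K : StrClass κ} {P Q : IndProp κ}

namespace FOExpr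

theorem congr (h : FOExpr K P) (e : ∀ y W, K y W → ∀ p, P y W p ↔ Q y W p) : FOExpr K Q := by
  obtain ⟨R, hR, h⟩ := h
  exact ⟨R, hR, fun y W hK p a ha => (h y W hK p a ha).trans (e y W hK p)⟩

theorem not (h : FOExpr K P) : FOExpr K fun y W p => ¬ P y W p := by
  obtain ⟨R, hR, h⟩ := h
  exact ⟨_, hR.not, fun y W hK p a ha => not_congr (h y W hK p a ha)⟩

theorem imp (h : FOExpr K P) (h' : FOExpr K Q) : FOExpr K fun y W p => P y W p → Q y W p := by
  obtain ⟨R, hR, h⟩ := h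
  obtain ⟨R', hR', h'⟩ := h'
  exact ⟨_, hR.imp hR', fun y W hK p a ha => imp_congr (h y W hK p a ha) (h' y W hK p a ha)⟩

theorem and (h : FOExpr K P) (h' : FOExpr K Q) : FOExpr K fun y W p => P y W p ∧ Q y W p :=
  ((h.imp h'.not).not).congr fun y W _ p => by tauto

theorem iff (h : FOExpr K P) (h' : FOExpr K Q) : FOExpr K fun y W p => (P y W p ↔ Q y W p) :=
  ((h.imp h').and (h'.imp h)).congr fun y W _ p => by tauto

variable (hK : ∀ y W, K y W → IsCoded κ y W)
include hK

theorem all (k : ℕ) (h : FOExpr K P) :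
    FOExpr K fun y W p => ∀ v, P y W (Function.update p k v) := by
  obtain ⟨R, hR, h⟩ := h
  -- Quantification over individuals is relativised to predicate 0, which holds exactly of the
  -- codes.
  refine ⟨_, ((RawFO.pred 0 k).imp hR).all k, fun y W hW p a ha => ?_⟩
  have key : ∀ (v : Ind κ y) (m : MM κ y), m.1 = code v.1 →
      (R _ (EE κ y) W (Function.update a k m) ↔ P y W (Function.update p k v)) := by
    intro v m hm
    refine h y W hW _ _ fun i => ?_
    by_cases hi : i = k
    · subst hi; simpa using hm
    · simpa [hi] using ha i
  constructor
  · intro H v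
    have hv := (hK y W hW).good.code_mem v.2
    exact (key v ⟨_, hv⟩ rfl).1 (H _ (by
      rw [Function.update_self]
      exact ((hK y W hW).codes _).2 ⟨v.1, v.2, rfl⟩))
  · intro H m hm
    rw [Function.update_self] at hm
    obtain ⟨v, hv, hmv⟩ := ((hK y W hW).codes _).1 hm
    exact (key ⟨v, hv⟩ m hmv).2 (H _)

theorem ex (k : ℕ) (h : FOExpr K P) :
    FOExpr K fun y W p => ∃ v, P y W (Function.update p k v) :=
  (h.not.all hK k).not.congr fun y W _ p => by simp

omit hK in
theorem memU (r : Fin NN) (i : ℕ) : FOExpr K fun _ W p => MemU (W r) (p i).1 := by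
  refine ⟨_, RawFO.pred r i, fun y W hW p a ha => ?_⟩
  constructor
  · exact fun h => ⟨_, h, ha i⟩
  · rintro ⟨m, hm, h⟩
    rwa [show a i = m from Subtype.ext ((ha i).trans h.symm)]

theorem memT (r : Fin NN) (t : Fin 3 → ℕ) (ht : ∀ i, t i < 100) :
    FOExpr K fun _ W p => MemT (W r) fun i => (p (t i)).1 := by
  refine ⟨_, RawFO.triple r t ![1, 2, 3] ht, fun y W hW p a ha => ?_⟩
  have key : ∀ (m : MM κ y) (i : Fin 3),
      (∃ q, EE κ y q m ∧ (∃ s, s ∈ W (![1, 2, 3] i) ∧ EE κ y s q) ∧ EE κ y (a (t i)) q) ↔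
        Coord m i (p (t i)).1 := by
    intro m i
    refine exists_congr fun q => and_congr Iff.rfl (and_congr ?_ (by rw [EE, ha]))
    simp only [(hK y W hW).tags]
    constructor
    · rintro ⟨s, hs, h⟩
      exact hs ▸ h
    · exact fun h => ⟨⟨tag i, (hK y W hW).good.tag_mem i⟩, rfl, h⟩
  refine exists_congr fun m => and_congr Iff.rfl ?_
  rw [key m 0, key m 1, key m 2]
  simp [Fin.forall_fin_succ]

theorem exists_sentence {Q : ∀ y : ZFSet.{u}, (Fin NN → Set (MM κ y)) → Prop}
    (h : FOExpr K fun y W _ => Q y W) :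
    ∃ χ : (setLang NN).Sentence, ∀ y W, K y W → (FOSat (EE κ y) W χ ↔ Q y W) := by
  obtain ⟨R, hR, h⟩ := h
  obtain ⟨χ, hχ⟩ := hR.exists_sentence 0
  refine ⟨χ, fun y W hW => ?_⟩
  rw [hχ]
  constructor
  · rintro ⟨m, hm, H⟩
    obtain ⟨v, hv, hmv⟩ := ((hK y W hW).codes _).1 hm
    exact (h y W hW (fun _ => ⟨v, hv⟩) _ fun _ => hmv).1 H
  · intro H
    obtain ⟨v⟩ := (hK y W hW).nonempty
    refine ⟨⟨_, (hK y W hW).good.code_mem v.2⟩, ((hK y W hW).codes _).2 ⟨v.1, v.2, rfl⟩, ?_⟩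
    exact (h y W hW (fun _ => v) _ fun _ => rfl).2 H

end FOExpr

/-- A property of the structure at `y`. -/
abbrev StrProp (κ : Cardinal.{u}) : Type (u + 1) :=
  ∀ y : ZFSet.{u}, (Fin NN → Set (MM κ y)) → Prop

/-- Definability by a `Π¹_ξ` or `Σ¹_ξ` formula over the structures of the class `K`. -/
def Expr (K : StrClass κ) (s : Side) (ξ : Ordinal.{u}) (Q : StrProp κ) : Prop :=
  ∃ φ : SOFormula s ξ NN, ∀ y W, K y W → (φ.Sat (EE κ y) W ↔ Q y W)

namespace Expr

variable {s : Side} {ξ : Ordinal.{u}} {P Q : StrProp κ}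

theorem congr (h : Expr K s ξ P) (e : ∀ y W, K y W → (P y W ↔ Q y W)) : Expr K s ξ Q := by
  obtain ⟨φ, h⟩ := h
  exact ⟨φ, fun y W hK => (h y W hK).trans (e y W hK)⟩

theorem not_pi (h : Expr K .pi ξ P) : Expr K .sigma ξ fun y W => ¬ P y W := by
  obtain ⟨φ, h⟩ := h
  obtain ⟨ψ, hψ⟩ := SOFormula.exists_neg.{u, u + 1} φ
  exact ⟨ψ, fun y W hW => (hψ _ _).trans (not_congr (h y W hW))⟩

theorem not_sigma (h : Expr K .sigma ξ P) : Expr K .pi ξ fun y W => ¬ P y W := by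
  obtain ⟨φ, h⟩ := h
  obtain ⟨ψ, hψ⟩ := SOFormula.exists_neg.{u, u + 1} φ
  exact ⟨ψ, fun y W hW => (hψ _ _).trans (not_congr (h y W hW))⟩

theorem sigma_of_pi (h : Expr K .pi ξ P) : Expr K .sigma (ξ + 1) P := by
  obtain ⟨φ, h⟩ := h
  obtain ⟨ψ, hψ⟩ := SOFormula.exists_pad_swap.{u, u + 1} φ
  exact ⟨ψ, fun y W hW => (hψ _ _).trans (h y W hW)⟩

theorem pi_of_sigma (h : Expr K .sigma ξ P) : Expr K .pi (ξ + 1) P := by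
  obtain ⟨φ, h⟩ := h
  obtain ⟨ψ, hψ⟩ := SOFormula.exists_pad_swap.{u, u + 1} φ
  exact ⟨ψ, fun y W hW => (hψ _ _).trans (h y W hW)⟩

theorem top : Expr K s ξ fun _ _ => True := by
  obtain ⟨φ, h⟩ := SOFormula.exists_top.{u, u + 1} s ξ NN
  exact ⟨φ, fun y W _ => iff_true_intro (h _ _)⟩

theorem bot : Expr K s ξ fun _ _ => False := by
  obtain ⟨φ, h⟩ := SOFormula.exists_bot.{u, u + 1} s ξ NN
  exact ⟨φ, fun y W _ => iff_false_intro (h _ _)⟩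

variable (hK : ∀ y W, K y W → IsCoded κ y W)

include hK in
theorem and (h : Expr K .pi ξ P) (h' : Expr K .pi ξ Q) : Expr K .pi ξ fun y W => P y W ∧ Q y W := by
  obtain ⟨φ, h⟩ := h
  obtain ⟨ψ, h'⟩ := h'
  obtain ⟨θ, hθ⟩ := SOFormula.exists_and.{u, u + 1} φ ψ
  refine ⟨θ, fun y W hW => ?_⟩
  obtain ⟨v⟩ := (hK y W hW).nonempty
  have : Nonempty (MM κ y) := ⟨⟨_, (hK y W hW).good.code_mem v.2⟩⟩
  rw [hθ, h y W hW, h' y W hW]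

include hK in
theorem or (h : Expr K .sigma ξ P) (h' : Expr K .sigma ξ Q) :
    Expr K .sigma ξ fun y W => P y W ∨ Q y W :=
  (and hK h.not_sigma h'.not_sigma).not_pi.congr fun y W _ => by tauto

include hK in
theorem ite {C : StrProp κ} (hC : FOExpr K fun y W _ => C y W)
    (h : Expr K s ξ P) (h' : Expr K s ξ Q) :
    Expr K s ξ fun y W => (C y W → P y W) ∧ (¬ C y W → Q y W) := by
  obtain ⟨φ, h⟩ := h
  obtain ⟨ψ, h'⟩ := h'
  obtain ⟨χ, hχ⟩ := hC.exists_sentence hK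
  obtain ⟨θ, hθ⟩ := SOFormula.exists_ite.{u, u + 1} χ φ ψ
  exact ⟨θ, fun y W hW => by rw [hθ, h y W hW, h' y W hW, hχ y W hW]⟩

include hK in
theorem fo_imp {C : StrProp κ} (hC : FOExpr K fun y W _ => C y W) (h : Expr K s ξ P) :
    Expr K s ξ fun y W => C y W → P y W :=
  (ite hK hC h top).congr fun y W _ => by tauto

include hK in
theorem fo_and {C : StrProp κ} (hC : FOExpr K fun y W _ => C y W) (h : Expr K s ξ P) :
    Expr K s ξ fun y W => C y W ∧ P y W :=
  (ite hK hC h bot).congr fun y W _ => by tauto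

include hK in
theorem fo (hC : FOExpr K fun y W _ => P y W) : Expr K s ξ P :=
  (fo_and hK hC top).congr fun y W _ => by tauto

theorem rename (ρ : Fin NN → Fin NN) (hρ : ∀ y W, K y W → K y (W ∘ ρ)) (h : Expr K s ξ P) :
    Expr K s ξ fun y W => P y (W ∘ ρ) := by
  obtain ⟨φ, h⟩ := h
  obtain ⟨ψ, hψ⟩ := SOFormula.exists_rename.{u, u + 1} φ ρ
  exact ⟨ψ, fun y W hW => (hψ _ _).trans (h y _ (hρ y W hW))⟩

/-- Quantification over the predicates in `S`. -/
theorem all (S : Finset (Fin NN)) (hS : ∀ y W Y, K y W → K y (S.piecewise Y W))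
    (h : Expr K .sigma ξ P) : Expr K .pi (ξ + 1) fun y W => ∀ Y, P y (S.piecewise Y W) := by
  obtain ⟨φ, h⟩ := h
  -- A full block of `NN` new predicates is quantified, but only those with index in S are read.
  -- This returns to the same fixed number of predicates after every quantifier.
  let σ : Fin NN → Fin (NN + (17 + 1)) :=
    fun j => if j ∈ S then Fin.natAdd NN j else Fin.castAdd (17 + 1) j
  obtain ⟨ψ, hψ⟩ := SOFormula.exists_rename.{u, u + 1} φ σ
  refine ⟨.all 17 ψ, fun y W hW => ?_⟩
  have hσ : ∀ Y : Fin NN → Set (MM κ y), Fin.append W Y ∘ σ = S.piecewise Y W := by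
    intro Y
    funext j
    by_cases hj : j ∈ S
    · simp [σ, hj, -Fin.natAdd_eq_addNat]
    · simp [σ, hj]
  rw [SOFormula.sat_all]
  refine forall_congr' fun Y => ?_
  rw [hψ, hσ, h y _ (hS y W Y hW)]

theorem ex (S : Finset (Fin NN)) (hS : ∀ y W Y, K y W → K y (S.piecewise Y W))
    (h : Expr K .pi ξ P) : Expr K .sigma (ξ + 1) fun y W => ∃ Y, P y (S.piecewise Y W) :=
  (h.not_pi.all S hS).not_pi.congr fun y W _ => by simp

theorem conj (hξ : Order.IsSuccLimit ξ) {P : Ordinal.{u} → StrProp κ}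
    (h : ∀ ζ < ξ, Expr K .pi ζ (P ζ)) : Expr K .pi ξ fun y W => ∀ ζ < ξ, P ζ y W := by
  choose φ hφ using h
  exact ⟨.conj hξ φ, fun y W hW => forall₂_congr fun ζ hζ => hφ ζ hζ y W hW⟩

theorem disj (hξ : Order.IsSuccLimit ξ) {P : Ordinal.{u} → StrProp κ}
    (h : ∀ ζ < ξ, Expr K .sigma ζ (P ζ)) : Expr K .sigma ξ fun y W => ∃ ζ < ξ, P ζ y W := by
  choose φ hφ using h
  refine ⟨.disj hξ φ, fun y W hW => ?_⟩
  simp only [SOFormula.sat_disj]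
  exact exists_congr fun ζ => ⟨fun ⟨hζ, h⟩ => ⟨hζ, (hφ ζ hζ y W hW).1 h⟩,
    fun ⟨hζ, h⟩ => ⟨hζ, (hφ ζ hζ y W hW).2 h⟩⟩

end Expr

end Definability

/-! ### Defining iterated stationarity -/

variable {κ : Cardinal.{u}} {X : ZFSet.{u}} {d : ZFSet.{u} → ZFSet.{u} → Set ZFSet.{u}}

/-- The structures over which iterated stationarity is definable: the predicates `4`, …, `8` code
the relations `v ≺ w`, `α < β`, `α ≤ β + 2`, `v ∈ d w i` and "`d w i` is `ζ`-stationary at `w`",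
and every set of individuals agrees below `w ≺ y` with some `d w i`, `i ≺ y`. -/
structure IsModel (κ : Cardinal.{u}) (X : ZFSet.{u}) (d : ZFSet.{u} → ZFSet.{u} → Set ZFSet.{u})
    (y : ZFSet.{u}) (W : Fin NN → Set (MM κ y)) : Prop where
  coded : IsCoded κ y W
  mem_Pk : y ∈ Pk κ X
  lim : Order.IsSuccLimit (kap κ y)
  prec : ∀ t : Fin 3 → ZFSet.{u}, (∀ i, StrongSub κ (t i) y) →
    (MemT (W 4) t ↔ StrongSub κ (t 0) (t 1) ∧ t 2 = t 1)
  lt : ∀ t : Fin 3 → ZFSet.{u}, (∀ i, StrongSub κ (t i) y) →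
    (MemT (W 5) t ↔ (∃ α β : Ordinal.{u}, α < β ∧ t 0 = α.toZFSet ∧ t 1 = β.toZFSet) ∧ t 2 = t 1)
  le : ∀ t : Fin 3 → ZFSet.{u}, (∀ i, StrongSub κ (t i) y) →
    (MemT (W 6) t ↔
      (∃ α β : Ordinal.{u}, α ≤ β + 2 ∧ t 0 = α.toZFSet ∧ t 1 = β.toZFSet) ∧ t 2 = t 1)
  mem : ∀ t : Fin 3 → ZFSet.{u}, (∀ i, StrongSub κ (t i) y) →
    (MemT (W 7) t ↔ t 2 ∈ d (t 0) (t 1))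
  stat : ∀ t : Fin 3 → ZFSet.{u}, (∀ i, StrongSub κ (t i) y) →
    (MemT (W 8) t ↔ ∃ ζ : Ordinal.{u}, t 2 = ζ.toZFSet ∧ IsSStat κ X ζ (d (t 0) (t 1)) (t 0))
  index : ∀ w, StrongSub κ w y → ∀ U : Set ZFSet.{u},
    ∃ i, StrongSub κ i y ∧ ∀ v, StrongSub κ v w → (v ∈ d w i ↔ v ∈ U)

theorem IsModel.isCoded : ∀ y W, IsModel κ X d y W → IsCoded κ y W := fun _ _ h => h.coded

theorem IsModel.of_eq {y : ZFSet.{u}} {W W' : Fin NN → Set (MM κ y)} (h : IsModel κ X d y W)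
    (e : ∀ j : Fin NN, j < 9 → W' j = W j) : IsModel κ X d y W' where
  coded := ⟨h.coded.good, by rw [e 0 (by decide)]; exact h.coded.codes, fun i => by
    rw [e _ (by revert i; decide)]; exact h.coded.tags i⟩
  mem_Pk := h.mem_Pk
  lim := h.lim
  prec := by rw [e 4 (by decide)]; exact h.prec
  lt := by rw [e 5 (by decide)]; exact h.lt
  le := by rw [e 6 (by decide)]; exact h.le
  mem := by rw [e 7 (by decide)]; exact h.mem
  stat := by rw [e 8 (by decide)]; exact h.stat
  index := h.index

theorem IsModel.piecewise {y : ZFSet.{u}} {W : Fin NN → Set (MM κ y)} (h : IsModel κ X d y W)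
    (S : Finset (Fin NN)) (hS : ∀ j < 9, j ∉ S) (Y : Fin NN → Set (MM κ y)) :
    IsModel κ X d y (S.piecewise Y W) :=
  h.of_eq fun j hj => Finset.piecewise_eq_of_notMem _ _ _ (hS j hj)

theorem IsModel.comp {y : ZFSet.{u}} {W : Fin NN → Set (MM κ y)} (h : IsModel κ X d y W)
    (ρ : Fin NN → Fin NN) (hρ : ∀ j < 9, ρ j = j) : IsModel κ X d y (W ∘ ρ) :=
  h.of_eq fun j hj => by rw [Function.comp_apply, hρ j hj]

section FO

theorem IsModel.fo_memU (r : Fin NN) (i : ℕ) :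
    FOExpr (IsModel κ X d) fun _ W p => MemU (W r) (p i).1 :=
  FOExpr.memU r i

theorem IsModel.fo_memT (r : Fin NN) (i j k : ℕ) (h : max (max i j) k < 100) :
    FOExpr (IsModel κ X d) fun _ W p => MemT (W r) ![(p i).1, (p j).1, (p k).1] := by
  refine (FOExpr.memT IsModel.isCoded r ![i, j, k] ?_).congr fun y W _ p => ?_
  · simp only [max_lt_iff] at h
    simp [Fin.forall_fin_succ, h]
  · rw [show (fun l => (p (![i, j, k] l)).1) = ![(p i).1, (p j).1, (p k).1] by
      funext l; fin_cases l <;> rfl]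

theorem strongSub_vec {y a b c : ZFSet.{u}} (ha : StrongSub κ a y) (hb : StrongSub κ b y)
    (hc : StrongSub κ c y) : ∀ l, StrongSub κ (![a, b, c] l) y := by
  intro l
  fin_cases l
  exacts [ha, hb, hc]

theorem IsModel.fo_prec (i j : ℕ) (h : max i j < 100) :
    FOExpr (IsModel κ X d) fun _ _ p => StrongSub κ (p i).1 (p j).1 :=
  (IsModel.fo_memT 4 i j j (by simpa using h)).congr fun y W hW p => by
    rw [hW.prec _ (strongSub_vec (p i).2 (p j).2 (p j).2)]
    simp

theorem IsModel.fo_lt (i j : ℕ) (h : max i j < 100) :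
    FOExpr (IsModel κ X d) fun _ _ p =>
      ∃ α β : Ordinal.{u}, α < β ∧ (p i).1 = α.toZFSet ∧ (p j).1 = β.toZFSet :=
  (IsModel.fo_memT 5 i j j (by simpa using h)).congr fun y W hW p => by
    rw [hW.lt _ (strongSub_vec (p i).2 (p j).2 (p j).2)]
    simp

theorem IsModel.fo_le (i j : ℕ) (h : max i j < 100) :
    FOExpr (IsModel κ X d) fun _ _ p =>
      ∃ α β : Ordinal.{u}, α ≤ β + 2 ∧ (p i).1 = α.toZFSet ∧ (p j).1 = β.toZFSet :=
  (IsModel.fo_memT 6 i j j (by simpa using h)).congr fun y W hW p => by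
    rw [hW.le _ (strongSub_vec (p i).2 (p j).2 (p j).2)]
    simp

theorem IsModel.fo_ord (i : ℕ) (h : i < 100) :
    FOExpr (IsModel κ X d) fun _ _ p => ∃ α : Ordinal.{u}, (p i).1 = α.toZFSet :=
  (IsModel.fo_le i i (by simpa using h)).congr fun y W _ p =>
    ⟨fun ⟨α, _, _, h, _⟩ => ⟨α, h⟩, fun ⟨α, h⟩ => ⟨α, α, le_self_add, h, h⟩⟩

end FO

/-! ### Coded sets of ordinals and the complexity of bounding them -/

/-- The ordinals coded in a second-order object. -/
def ordOf {y : ZFSet.{u}} (D : Set (MM κ y)) : Set Ordinal.{u} := {α | MemU D α.toZFSet}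

/-- The sections of the binary relation coded in a second-order object. -/
def fam {y : ZFSet.{u}} (D : Set (MM κ y)) (z : ZFSet.{u}) : Set ZFSet.{u} :=
  {w | MemT D ![z, w, w]}

theorem strongSub_of_mem_ordOf {y : ZFSet.{u}} (hy : IsStd κ y) {D : Set (MM κ y)}
    {α : Ordinal.{u}} (h : α ∈ ordOf D) : StrongSub κ α.toZFSet y := by
  obtain ⟨m, -, hm⟩ := h
  refine hy.strongSub_of_code_mem (fun a ha => (ZFSet.isOrdinal_toZFSet α).mem ha) (hm ▸ m.2)

theorem strongSub_toZFSet_of_le {y : ZFSet.{u}} {α β : Ordinal.{u}} (h : α ≤ β)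
    (hβ : StrongSub κ β.toZFSet y) : StrongSub κ α.toZFSet y :=
  hβ.mono (Ordinal.toZFSet_subset_toZFSet_iff.2 h)

/-- The second-order object coding a set of ordinals. -/
def ordCode (κ : Cardinal.{u}) (y : ZFSet.{u}) (s : Set Ordinal.{u}) : Set (MM κ y) :=
  {m | ∃ α ∈ s, m.1 = code α.toZFSet}

theorem mem_ordOf_ordCode {y : ZFSet.{u}} (hy : IsGood κ y) {s : Set Ordinal.{u}}
    {α : Ordinal.{u}} : α ∈ ordOf (ordCode κ y s) ↔ α ∈ s ∧ StrongSub κ α.toZFSet y := by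
  have ho : ∀ β : Ordinal.{u}, ∀ a ∈ β.toZFSet, a.IsOrdinal :=
    fun β a ha => (ZFSet.isOrdinal_toZFSet β).mem ha
  constructor
  · intro h
    refine ⟨?_, strongSub_of_mem_ordOf hy.toIsStd h⟩
    obtain ⟨m, ⟨β, hβ, hm⟩, hm'⟩ := h
    rwa [Ordinal.toZFSet_injective (code_injOn (ho α) (ho β) (hm'.symm.trans hm))]
  · exact fun h => ⟨⟨_, hy.code_mem h.2⟩, ⟨α, h.1, rfl⟩, rfl⟩

/-- The ordinals coded in predicate `12` are at most `η`. -/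
def OrdLE (κ : Cardinal.{u}) (η : Ordinal.{u}) : StrProp κ := fun _ W => ∀ α ∈ ordOf (W 12), α ≤ η

/-- Replacing predicate `12` by predicate `14`. -/
def ren : Fin NN → Fin NN := fun j => if j = 12 then 14 else j

/-- Replacing the predicates `12, 13` by the predicates `14, 15`. -/
def ren₂ : Fin NN → Fin NN := fun j => if j = 12 then 14 else if j = 13 then 15 else j

theorem Expr.comp_ren {s : Side} {ξ : Ordinal.{u}} {Q : StrProp κ} (h : Expr (IsModel κ X d) s ξ Q) :
    Expr (IsModel κ X d) s ξ fun y W => Q y (W ∘ ren) :=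
  h.rename ren fun _ _ hW => hW.comp _ (by decide)

theorem Expr.all₁ {ξ : Ordinal.{u}} {Q : StrProp κ} (h : Expr (IsModel κ X d) .sigma ξ Q) :
    Expr (IsModel κ X d) .pi (ξ + 1) fun y W => ∀ Y, Q y (({14} : Finset (Fin NN)).piecewise Y W) :=
  h.all {14} fun _ _ Y hW => hW.piecewise _ (by decide) Y

theorem Expr.ex₁ {ξ : Ordinal.{u}} {Q : StrProp κ} (h : Expr (IsModel κ X d) .pi ξ Q) :
    Expr (IsModel κ X d) .sigma (ξ + 1) fun y W =>
      ∃ Y, Q y (({14} : Finset (Fin NN)).piecewise Y W) :=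
  h.ex {14} fun _ _ Y hW => hW.piecewise _ (by decide) Y

theorem expr_ordLE_zero : Expr (IsModel κ X d) .pi (0 + 1) (OrdLE κ 0) := by
  refine Expr.fo IsModel.isCoded ((((IsModel.fo_memU 12 0).imp
    ((IsModel.fo_lt 1 0 (by decide)).not.all IsModel.isCoded 1)).all IsModel.isCoded 0).congr
      fun y W hW p => ?_)
  simp only [Function.update_self, ne_eq, not_false_eq_true, Function.update_of_ne,
    zero_ne_one]
  constructor
  · intro H α hα
    by_contra h0
    have h0 : 0 < α := not_le.1 h0
    have hs := strongSub_of_mem_ordOf hW.coded.good.toIsStd hα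
    exact H ⟨_, hs⟩ hα ⟨_, strongSub_toZFSet_of_le (zero_le (a := α)) hs⟩ ⟨0, α, h0, rfl, rfl⟩
  · rintro H a ha b ⟨α, β, hαβ, -, hb⟩
    exact absurd ((H β (show MemU _ _ from hb ▸ ha)).trans_lt' hαβ) not_lt_zero

/-- A set Z is bounded by η + 2 iff some Y bounded by η has, for each α ∈ Z, a member β with α ≤ β +
2. The existential quantifier gives Σ¹_{η+2}, and a dummy universal one gives Π¹_{η+3}; this is why
the bound moves in steps of two. -/
theorem expr_ordLE_add_two {η : Ordinal.{u}} (h : Expr (IsModel κ X d) .pi (η + 1) (OrdLE κ η)) :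
    Expr (IsModel κ X d) .pi (η + 1 + 1 + 1) (OrdLE κ (η + 1 + 1)) := by
  have hg : FOExpr (IsModel κ X d) fun y W _ =>
      ∀ α ∈ ordOf (W 12), ∃ β ∈ ordOf (W 14), α ≤ β + 2 := by
    refine (((IsModel.fo_memU 12 0).imp ((IsModel.fo_ord 0 (by decide)).imp
      (((IsModel.fo_memU 14 1).and (IsModel.fo_le 0 1 (by decide))).ex
        IsModel.isCoded 1))).all IsModel.isCoded 0).congr fun y W hW p => ?_
    simp only [Function.update_self, ne_eq, not_false_eq_true, Function.update_of_ne,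
      zero_ne_one]
    constructor
    · intro H α hα
      obtain ⟨b, hb, α', β, hle, hα', hβ⟩ :=
        H ⟨_, strongSub_of_mem_ordOf hW.coded.good.toIsStd hα⟩ hα ⟨α, rfl⟩
      obtain rfl := Ordinal.toZFSet_injective hα'
      exact ⟨β, show MemU _ _ from hβ ▸ hb, hle⟩
    · rintro H ⟨a, has⟩ ha ⟨α, rfl⟩
      obtain ⟨β, hβ, hle⟩ := H α ha
      exact ⟨⟨_, strongSub_of_mem_ordOf hW.coded.good.toIsStd hβ⟩, hβ, α, β, hle, rfl, rfl⟩
  refine ((Expr.fo_and IsModel.isCoded hg h.comp_ren).ex₁.pi_of_sigma).congr fun y W hW => ?_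
  have e14 : ∀ Y : Fin NN → Set (MM κ y),
      (({14} : Finset (Fin NN)).piecewise Y W ∘ ren) 12 = Y 14 := fun Y => by simp [ren]
  have e14' : ∀ Y : Fin NN → Set (MM κ y),
      ({14} : Finset (Fin NN)).piecewise Y W 14 = Y 14 := fun Y => by simp
  have e12 : ∀ Y : Fin NN → Set (MM κ y),
      ({14} : Finset (Fin NN)).piecewise Y W 12 = W 12 := fun Y => by simp
  have h2 : ∀ β : Ordinal.{u}, β + 2 = β + 1 + 1 := fun β => by
    rw [add_assoc, one_add_one_eq_two]
  simp only [OrdLE, e14, e14', e12]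
  constructor
  · rintro ⟨Y, hY, hYη⟩ α hα
    obtain ⟨β, hβ, hle⟩ := hY α hα
    refine hle.trans ?_
    rw [h2]
    gcongr
    exact hYη β hβ
  · intro H
    refine ⟨fun _ => ordCode κ y (Set.Iic η), fun α hα => ?_, fun β hβ =>
      ((mem_ordOf_ordCode hW.coded.good).1 hβ).1⟩
    have hs := strongSub_of_mem_ordOf hW.coded.good.toIsStd hα
    -- The minimum stays below α, so it is coded in the structure at y even when η is not.
    refine ⟨min α η, (mem_ordOf_ordCode hW.coded.good).2
      ⟨Set.mem_Iic.2 (min_le_right _ _), strongSub_toZFSet_of_le (min_le_left _ _) hs⟩, ?_⟩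
    rcases le_total α η with h | h
    · rw [min_eq_left h]
      exact le_self_add
    · rw [min_eq_right h, h2]
      exact H α hα

/-- Z is bounded by the limit ξ iff every Y bounded by some β smaller than an element of Z is
bounded by some η < ξ. The conclusion is an infinitary Σ¹_ξ disjunction, and quantifying over Y
gives Π¹_{ξ+1}. -/
theorem expr_ordLE_limit {ξ : Ordinal.{u}} (hξ : Order.IsSuccLimit ξ)
    (h : ∀ ζ < ξ, ∃ η < ξ, ζ ≤ η ∧ Expr (IsModel κ X d) .pi (η + 1) (OrdLE κ η)) :
    Expr (IsModel κ X d) .pi (ξ + 1) (OrdLE κ ξ) := by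
  -- The bound η is placed at index η + 2, leaving room for a padded Π¹_{η+1} formula; at indices
  -- not of this form the disjunct is false.
  let P : Ordinal.{u} → StrProp κ := fun ζ y W => ∃ η,
    (η + 1 + 1 = ζ ∧ Expr (IsModel κ X d) .pi (η + 1) (OrdLE κ η)) ∧ OrdLE κ η y (W ∘ ren)
  have hP : ∀ ζ < ξ, Expr (IsModel κ X d) .sigma ζ (P ζ) := by
    intro ζ _
    by_cases hζ : ∃ η, η + 1 + 1 = ζ ∧ Expr (IsModel κ X d) .pi (η + 1) (OrdLE κ η)
    · obtain ⟨η, rfl, hη⟩ := hζ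
      refine hη.comp_ren.sigma_of_pi.congr fun y W _ => ⟨fun H => ⟨η, ⟨rfl, hη⟩, H⟩, ?_⟩
      rintro ⟨η', ⟨h', -⟩, H⟩
      obtain rfl := Order.succ_injective (Order.succ_injective h')
      exact H
    · refine Expr.bot.congr fun y W _ => ⟨False.elim, ?_⟩
      rintro ⟨η, h', -⟩
      exact hζ ⟨η, h'⟩
  have hg : FOExpr (IsModel κ X d) fun y W _ =>
      ∃ α ∈ ordOf (W 12), ∃ β < α, ∀ γ ∈ ordOf (W 14), γ ≤ β := by
    refine (((IsModel.fo_memU 12 0).and (((IsModel.fo_lt 1 0 (by decide)).and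
      (((IsModel.fo_memU 14 2).imp ((IsModel.fo_ord 2 (by decide)).imp
        (IsModel.fo_lt 1 2 (by decide)).not)).all IsModel.isCoded 2)).ex IsModel.isCoded 1)).ex
          IsModel.isCoded 0).congr fun y W hW p => ?_
    simp only [Function.update_self, ne_eq, not_false_eq_true, Function.update_of_ne, zero_ne_one,
      OfNat.one_ne_ofNat]
    constructor
    · rintro ⟨a, ha, b, ⟨β, α, hβα, hb, haα⟩, H⟩
      refine ⟨α, show MemU _ _ from haα ▸ ha, β, hβα, fun γ hγ => ?_⟩
      by_contra hlt
      exact H ⟨_, strongSub_of_mem_ordOf hW.coded.good.toIsStd hγ⟩ hγ ⟨γ, rfl⟩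
        ⟨β, γ, not_le.1 hlt, hb, rfl⟩
    · rintro ⟨α, hα, β, hβα, H⟩
      have hs := strongSub_of_mem_ordOf hW.coded.good.toIsStd hα
      refine ⟨⟨_, hs⟩, hα, ⟨_, strongSub_toZFSet_of_le hβα.le hs⟩, ⟨β, α, hβα, rfl, rfl⟩, ?_⟩
      rintro ⟨c, hcs⟩ hc - ⟨β', γ, hlt, hβ', rfl⟩
      obtain rfl := Ordinal.toZFSet_injective hβ'
      exact absurd (H γ hc) (not_le.2 hlt)
  refine (Expr.fo_imp IsModel.isCoded hg (Expr.disj hξ hP)).all₁.congr fun y W hW => ?_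
  have e14 : ∀ Y : Fin NN → Set (MM κ y),
      (({14} : Finset (Fin NN)).piecewise Y W ∘ ren) 12 = Y 14 := fun Y => by simp [ren]
  have e14' : ∀ Y : Fin NN → Set (MM κ y),
      ({14} : Finset (Fin NN)).piecewise Y W 14 = Y 14 := fun Y => by simp
  have e12 : ∀ Y : Fin NN → Set (MM κ y),
      ({14} : Finset (Fin NN)).piecewise Y W 12 = W 12 := fun Y => by simp
  simp only [P, OrdLE, e14, e14', e12]
  constructor
  · intro H α hα
    by_contra hlt
    have hlt := not_le.1 hlt
    have hs := strongSub_of_mem_ordOf hW.coded.good.toIsStd hα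
    -- If some α ∈ Z exceeds ξ, then Y = {ξ} is bounded below α but by no η < ξ.
    obtain ⟨ζ, hζ, η, ⟨rfl, -⟩, hη⟩ := H (fun _ => ordCode κ y {ξ}) ⟨α, hα, ξ, hlt, fun γ hγ =>
      (((mem_ordOf_ordCode hW.coded.good).1 hγ).1 : γ = ξ).le⟩
    have := hη ξ ((mem_ordOf_ordCode hW.coded.good).2 ⟨rfl, strongSub_toZFSet_of_le hlt.le hs⟩)
    exact absurd (((Order.lt_succ η).trans (Order.lt_succ _)).trans hζ) (not_lt.2 this)
  · rintro H Y ⟨α, hα, β, hβα, hY⟩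
    obtain ⟨η, hη, hβη, hE⟩ := h β (hβα.trans_le (H α hα))
    exact ⟨η + 1 + 1, hξ.succ_lt (hξ.succ_lt hη), η, ⟨rfl, hE⟩, fun γ hγ => (hY γ hγ).trans hβη⟩

/-- The alternative absorbs the steps of two; it still provides definable bounds cofinally in every
limit ordinal, which is all that limit stages use. -/
theorem expr_ordLE (ξ : Ordinal.{u}) : Expr (IsModel κ X d) .pi (ξ + 1) (OrdLE κ ξ) ∨
    Expr (IsModel κ X d) .pi (ξ + 1 + 1) (OrdLE κ (ξ + 1)) := by
  induction ξ using Ordinal.limitRecOn with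
  | zero => exact Or.inl expr_ordLE_zero
  | add_one ξ ih => exact ih.symm.imp id expr_ordLE_add_two
  | limit ξ hξ ih =>
    refine Or.inl (expr_ordLE_limit hξ fun ζ hζ => ?_)
    rcases ih ζ hζ with h | h
    · exact ⟨ζ, hζ, le_rfl, h⟩
    · exact ⟨ζ + 1, hξ.succ_lt hζ, Order.le_succ ζ, h⟩

/-! ### Coded families of sets and the complexity of their stationarity -/

variable {κ : Cardinal.{u}} {X : ZFSet.{u}} {d : ZFSet.{u} → ZFSet.{u} → Set ZFSet.{u}}

/-- The codes of a ternary relation on `P_{κ_x} x`. -/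
def tripleSet (κ : Cardinal.{u}) (x : ZFSet.{u}) (P : (Fin 3 → ZFSet.{u}) → Prop) :
    Set ZFSet.{u} :=
  {m | ∃ t, (∀ i, StrongSub κ (t i) x) ∧ P t ∧ m = triple t}

theorem StrongSub.of_subset {v x y : ZFSet.{u}} (h : StrongSub κ v y) (hyx : y ⊆ x) :
    StrongSub κ v x :=
  ⟨fun _ ha => hyx (h.1 ha), h.2.trans_le (kap_mono hyx)⟩

theorem memT_tripleSet {x y : ZFSet.{u}} (hx : ∀ a ∈ x, a.IsOrdinal) (hy : IsGood κ y)
    (hyx : y ⊆ x) {P : (Fin 3 → ZFSet.{u}) → Prop} {t : Fin 3 → ZFSet.{u}}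
    (ht : ∀ i, StrongSub κ (t i) y) : MemT {m : MM κ y | m.1 ∈ tripleSet κ x P} t ↔ P t := by
  rw [memT_iff hy (s := {t | (∀ i, StrongSub κ (t i) x) ∧ P t})
    (fun t ht i a ha => hx a ((ht.1 i).1 ha)) (fun m => ?_) ht]
  · exact ⟨fun h => h.2, fun h => ⟨fun i => (ht i).of_subset hyx, h⟩⟩
  · exact ⟨fun ⟨t, h, hP, e⟩ => ⟨t, ⟨h, hP⟩, e⟩, fun ⟨t, ⟨h, hP⟩, e⟩ => ⟨t, h, hP, e⟩⟩

/-- The codes of a binary relation on `P_{κ_x} x`. -/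
def famSet (κ : Cardinal.{u}) (x : ZFSet.{u}) (G : ZFSet.{u} → Set ZFSet.{u}) : Set ZFSet.{u} :=
  tripleSet κ x fun t => t 1 ∈ G (t 0) ∧ t 2 = t 1

theorem mem_fam_famSet {x y : ZFSet.{u}} (hx : ∀ a ∈ x, a.IsOrdinal) (hy : IsGood κ y) (hyx : y ⊆ x)
    {G : ZFSet.{u} → Set ZFSet.{u}} {z w : ZFSet.{u}} (hz : StrongSub κ z y)
    (hw : StrongSub κ w y) : w ∈ fam {m : MM κ y | m.1 ∈ famSet κ x G} z ↔ w ∈ G z :=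
  (memT_tripleSet hx hy hyx (strongSub_vec hz hw hw)).trans (by simp)

/-- All sections of the relation `13` are `0`-stationary. -/
def SSZero (κ : Cardinal.{u}) (X : ZFSet.{u}) : StrProp κ := fun y W =>
  ∀ z, StrongSub κ z y → IsSStat κ X 0 (fam (W 13) z) y

/-- All sections of the relation `13` are `0`-stationary, and `α`-stationary for all ordinals `α`
in the set `12`. -/
def SS (κ : Cardinal.{u}) (X : ZFSet.{u}) : StrProp κ := fun y W =>
  ∀ z, StrongSub κ z y → IsSStat κ X 0 (fam (W 13) z) y ∧
    ∀ α ∈ ordOf (W 12), IsSStat κ X α (fam (W 13) z) y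

section FO

theorem IsModel.fo_fam (r : Fin NN) (i j : ℕ) (h : max i j < 100) :
    FOExpr (IsModel κ X d) fun _ W p => (p j).1 ∈ fam (W r) (p i).1 :=
  IsModel.fo_memT r i j j (by simpa using h)

theorem IsModel.fo_mem (i j k : ℕ) (h : max (max i j) k < 100) :
    FOExpr (IsModel κ X d) fun _ _ p => (p k).1 ∈ d (p i).1 (p j).1 :=
  (IsModel.fo_memT 7 i j k h).congr fun y W hW p => by
    rw [hW.mem _ (strongSub_vec (p i).2 (p j).2 (p k).2)]
    simp

theorem IsModel.fo_stat (i j k : ℕ) (h : max (max i j) k < 100) :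
    FOExpr (IsModel κ X d) fun _ _ p =>
      ∃ ζ : Ordinal.{u}, (p k).1 = ζ.toZFSet ∧ IsSStat κ X ζ (d (p i).1 (p j).1) (p i).1 :=
  (IsModel.fo_memT 8 i j k h).congr fun y W hW p => by
    rw [hW.stat _ (strongSub_vec (p i).2 (p j).2 (p k).2)]
    simp

/-- Stationarity at a point below y depends only on the part of the set below that point. This part
is d w a for some index a in the structure, and predicate 8 records its degrees; no set quantifier
is needed. Variables 10 and 11 are reserved for the index and the test point. -/
theorem IsModel.fo_isSStat (r : Fin NN) (i j k : ℕ) (h : max (max i j) k < 10) :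
    FOExpr (IsModel κ X d) fun _ W p =>
      ∃ ζ : Ordinal.{u}, (p k).1 = ζ.toZFSet ∧ IsSStat κ X ζ (fam (W r) (p i).1) (p j).1 := by
  have hi : i < 10 := by omega
  have hj : j < 10 := by omega
  have hk : k < 10 := by omega
  refine (((IsModel.fo_stat j 10 k (by omega)).and (((IsModel.fo_prec 11 j (by omega)).imp
    ((IsModel.fo_mem j 10 11 (by omega)).iff (IsModel.fo_fam r i 11 (by omega)))).all
      IsModel.isCoded 11)).ex IsModel.isCoded 10).congr fun y W hW p => ?_
  simp only [Function.update_self, Function.update_of_ne, ne_eq, hi.ne, hj.ne, hk.ne,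
    show i ≠ 11 by omega, show j ≠ 11 by omega, show (10 : ℕ) ≠ 11 by omega, not_false_eq_true]
  constructor
  · rintro ⟨a, ⟨ζ, hζ, hs⟩, ha⟩
    exact ⟨ζ, hζ, hs.mono_set fun v hv hvj => (ha ⟨v, hvj.trans (p j).2⟩ hvj).1 hv⟩
  · rintro ⟨ζ, hζ, hs⟩
    obtain ⟨a, hay, ha⟩ := hW.index _ (p j).2 (fam (W r) (p i).1)
    exact ⟨⟨a, hay⟩, ⟨ζ, hζ, hs.mono_set fun v hv hvj => (ha v hvj).2 hv⟩, fun v hv => ha v hv⟩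

theorem IsModel.fo_ssZero : FOExpr (IsModel κ X d) fun y W _ => SSZero κ X y W := by
  refine (((((IsModel.fo_fam 13 0 2 (by decide)).and (IsModel.fo_prec 1 2 (by decide))).ex
    IsModel.isCoded 2).all IsModel.isCoded 1).all IsModel.isCoded 0).congr fun y W hW p => ?_
  simp only [Function.update_self, ne_eq, not_false_eq_true, Function.update_of_ne, zero_ne_one,
    OfNat.one_ne_ofNat, OfNat.zero_ne_ofNat]
  constructor
  · intro H z hz
    refine isSStat_zero.2 ⟨hW.lim.bot_lt.ne', fun v hv => ?_⟩
    obtain ⟨w, hw⟩ := H ⟨z, hz⟩ ⟨v, hv⟩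
    exact ⟨w.1, hw.1, w.2, hw.2⟩
  · intro H z v
    obtain ⟨w, hw, hwy, hvw⟩ := (isSStat_zero.1 (H z.1 z.2)).2 v.1 v.2
    exact ⟨⟨w, hwy⟩, hw, hvw⟩

/-- Every section of the relation `13` reflects the sections of the relation `15`. -/
def Reflects (κ : Cardinal.{u}) (X : ZFSet.{u}) : StrProp κ := fun y W =>
  ∀ z z₁ z₂ : ZFSet.{u}, StrongSub κ z y → StrongSub κ z₁ y → StrongSub κ z₂ y →
    ∀ β ∈ ordOf (W 14), ∃ w, StrongSub κ w y ∧ w ∈ fam (W 13) z ∧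
      IsSStat κ X β (fam (W 15) z₁) w ∧ IsSStat κ X β (fam (W 15) z₂) w

theorem IsModel.fo_reflects : FOExpr (IsModel κ X d) fun y W _ => Reflects κ X y W := by
  refine ((((((IsModel.fo_memU 14 3).imp ((IsModel.fo_ord 3 (by decide)).imp
    (((IsModel.fo_fam 13 0 4 (by decide)).and ((IsModel.fo_isSStat 15 1 4 3 (by decide)).and
      (IsModel.fo_isSStat 15 2 4 3 (by decide)))).ex IsModel.isCoded 4))).all IsModel.isCoded 3).all
        IsModel.isCoded 2).all IsModel.isCoded 1).all IsModel.isCoded 0).congr fun y W hW p => ?_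
  simp only [Function.update_self, ne_eq, not_false_eq_true, Function.update_of_ne,
    Nat.reduceEqDiff, zero_ne_one, OfNat.one_ne_ofNat, OfNat.zero_ne_ofNat]
  constructor
  · intro H z z₁ z₂ hz hz₁ hz₂ β hβ
    obtain ⟨w, hw, ⟨β₁, h₁, hs₁⟩, ⟨β₂, h₂, hs₂⟩⟩ := H ⟨z, hz⟩ ⟨z₁, hz₁⟩ ⟨z₂, hz₂⟩
      ⟨_, strongSub_of_mem_ordOf hW.coded.good.toIsStd hβ⟩ hβ ⟨β, rfl⟩
    obtain rfl := Ordinal.toZFSet_injective h₁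
    obtain rfl := Ordinal.toZFSet_injective h₂
    exact ⟨w.1, w.2, hw, hs₁, hs₂⟩
  · rintro H z z₁ z₂ ⟨b, hb⟩ hb' ⟨β, rfl⟩
    obtain ⟨w, hwy, hw, h⟩ := H z.1 z₁.1 z₂.1 z.2 z₁.2 z₂.2 β hb'
    exact ⟨⟨w, hwy⟩, hw, ⟨β, rfl, h.1⟩, ⟨β, rfl, h.2⟩⟩

theorem IsModel.fo_forall_lt : FOExpr (IsModel κ X d) fun _ W _ =>
    ∀ β ∈ ordOf (W 14), ∃ α ∈ ordOf (W 12), β < α := by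
  refine (((IsModel.fo_memU 14 0).imp ((IsModel.fo_ord 0 (by decide)).imp
    (((IsModel.fo_memU 12 1).and (IsModel.fo_lt 0 1 (by decide))).ex
      IsModel.isCoded 1))).all IsModel.isCoded 0).congr fun y W hW p => ?_
  simp only [Function.update_self, ne_eq, not_false_eq_true, Function.update_of_ne, zero_ne_one]
  constructor
  · intro H β hβ
    obtain ⟨a, ha, β', α, hlt, hβ', hα⟩ :=
      H ⟨_, strongSub_of_mem_ordOf hW.coded.good.toIsStd hβ⟩ hβ ⟨β, rfl⟩
    obtain rfl := Ordinal.toZFSet_injective hβ'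
    exact ⟨α, show MemU _ _ from hα ▸ ha, hlt⟩
  · rintro H ⟨b, hbs⟩ hb ⟨β, rfl⟩
    obtain ⟨α, hα, hlt⟩ := H β hb
    exact ⟨⟨_, strongSub_of_mem_ordOf hW.coded.good.toIsStd hα⟩, hα, β, α, hlt, rfl, rfl⟩

theorem IsModel.fo_forall_le : FOExpr (IsModel κ X d) fun _ W _ =>
    ∀ β ∈ ordOf (W 14), ∃ α ∈ ordOf (W 12), β ≤ α := by
  refine (((IsModel.fo_memU 14 0).imp ((IsModel.fo_ord 0 (by decide)).imp
    (((IsModel.fo_memU 12 1).and ((IsModel.fo_ord 1 (by decide)).and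
      (IsModel.fo_lt 1 0 (by decide)).not)).ex
        IsModel.isCoded 1))).all IsModel.isCoded 0).congr fun y W hW p => ?_
  simp only [Function.update_self, ne_eq, not_false_eq_true, Function.update_of_ne, zero_ne_one]
  constructor
  · intro H β hβ
    obtain ⟨a, ha, ⟨α, hα⟩, hle⟩ :=
      H ⟨_, strongSub_of_mem_ordOf hW.coded.good.toIsStd hβ⟩ hβ ⟨β, rfl⟩
    exact ⟨α, show MemU _ _ from hα ▸ ha, not_lt.1 fun hlt => hle ⟨α, β, hlt, hα, rfl⟩⟩
  · rintro H ⟨b, hbs⟩ hb ⟨β, rfl⟩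
    obtain ⟨α, hα, hle⟩ := H β hb
    refine ⟨⟨_, strongSub_of_mem_ordOf hW.coded.good.toIsStd hα⟩, hα, ⟨α, rfl⟩, ?_⟩
    rintro ⟨α', β', hlt, hα', hβ'⟩
    obtain rfl := Ordinal.toZFSet_injective hα'
    obtain rfl := Ordinal.toZFSet_injective hβ'
    exact absurd hle (not_le.2 hlt)

end FO

/-- Among structures with all ordinals of the set `12` at most `ξ`, the property `SS` is defined by
a `Π¹_ξ` formula expressing `Q`. -/
def IsSSDef (κ : Cardinal.{u}) (X : ZFSet.{u}) (d : ZFSet.{u} → ZFSet.{u} → Set ZFSet.{u})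
    (ξ : Ordinal.{u}) (Q : StrProp κ) : Prop :=
  Expr (IsModel κ X d) .pi ξ Q ∧
    ∀ y W, IsModel κ X d y W → OrdLE κ ξ y W → (Q y W ↔ SS κ X y W)

theorem isSSDef_zero : IsSSDef κ X d 0 (SSZero κ X) := by
  refine ⟨Expr.fo IsModel.isCoded IsModel.fo_ssZero, fun y W hW h0 => ?_⟩
  refine ⟨fun H z hz => ⟨H z hz, fun α hα => ?_⟩, fun H z hz => (H z hz).1⟩
  obtain rfl := le_antisymm (h0 α hα) zero_le
  exact H z hz

/-- The formula says: for all coded Y of degrees, each below some degree in predicate 12, and all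
families G, if the sections of G are stationary in the degrees in Y then they reflect to every
section of predicate 13. As Y is bounded by ξ, the hypothesis is the Π¹_ξ formula `Q`. The
implication is written contrapositively, so that the first-order `Reflects` guards the Σ¹_ξ formula
¬Q. -/
theorem IsSSDef.add_one {ξ : Ordinal.{u}} {Q : StrProp κ} (hQ : IsSSDef κ X d ξ Q) :
    ∃ Q', IsSSDef κ X d (ξ + 1) Q' := by
  have hr := hQ.1.rename ren₂ fun _ _ hW => hW.comp _ (by decide)
  refine ⟨_, Expr.fo_and IsModel.isCoded IsModel.fo_ssZero ((Expr.fo_imp IsModel.isCoded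
    IsModel.fo_forall_lt (Expr.fo_imp IsModel.isCoded IsModel.fo_reflects.not hr.not_pi)).all
      {14, 15} fun _ _ Y hW => hW.piecewise _ (by decide) Y), fun y W hW hle => ?_⟩
  have e : ∀ Y : Fin NN → Set (MM κ y), ∀ W' : Fin NN → Set (MM κ y),
      W' = ({14, 15} : Finset (Fin NN)).piecewise Y W →
      W' 12 = W 12 ∧ W' 13 = W 13 ∧ W' 14 = Y 14 ∧ W' 15 = Y 15 ∧
        (W' ∘ ren₂) 12 = Y 14 ∧ (W' ∘ ren₂) 13 = Y 15 := by
    rintro Y W' rfl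
    simp [ren₂]
  have hQ' : ∀ Y : Fin NN → Set (MM κ y), ∀ W' : Fin NN → Set (MM κ y),
      W' = ({14, 15} : Finset (Fin NN)).piecewise Y W →
      (∀ β ∈ ordOf (W' 14), ∃ α ∈ ordOf (W' 12), β < α) →
      (Q y (W' ∘ ren₂) ↔ ∀ z, StrongSub κ z y → IsSStat κ X 0 (fam (Y 15) z) y ∧
        ∀ α ∈ ordOf (Y 14), IsSStat κ X α (fam (Y 15) z) y) := by
    intro Y W' hW' hlt
    obtain ⟨e1, e2, e3, e4, e5, e6⟩ := e Y W' hW'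
    rw [hQ.2 y _ ((hW' ▸ hW.piecewise _ (by decide) Y : IsModel κ X d y W').comp _ (by decide)), SS,
      e5, e6]
    intro β hβ
    rw [e5, ← e3] at hβ
    obtain ⟨α, hα, hβα⟩ := hlt β hβ
    rw [e1] at hα
    exact Order.lt_succ_iff.1 (hβα.trans_le (hle α hα))
  constructor
  · rintro ⟨h0, H⟩ z hz
    refine ⟨h0 z hz, fun α hα => ?_⟩
    rcases eq_or_ne α 0 with rfl | hα0
    · exact h0 z hz
    refine (isSStat_of_ne hα0).2 ⟨hW.lim, fun ζ hζ S T hS hT hSy hTy => ?_⟩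
    have hy := hW.coded.good
    classical
    let G : ZFSet.{u} → Set ZFSet.{u} := fun z => if z = ∅ then S else T
    let Y : Fin NN → Set (MM κ y) := fun j =>
      if j = 14 then ordCode κ y {ζ} else {m | m.1 ∈ famSet κ y G}
    obtain ⟨e1, e2, e3, e4, -, -⟩ := e Y _ rfl
    have e14 : Y 14 = ordCode κ y {ζ} := rfl
    have e15 : Y 15 = {m | m.1 ∈ famSet κ y G} := rfl
    have hαs := strongSub_of_mem_ordOf hy.toIsStd hα
    have hζs : StrongSub κ ζ.toZFSet y := strongSub_toZFSet_of_le hζ.le hαs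
    have hg : ∀ β ∈ ordOf (({14, 15} : Finset (Fin NN)).piecewise Y W 14),
        ∃ α ∈ ordOf (({14, 15} : Finset (Fin NN)).piecewise Y W 12), β < α := by
      intro β hβ
      rw [e3, e14, mem_ordOf_ordCode hy] at hβ
      obtain rfl : β = ζ := hβ.1
      exact ⟨α, by rwa [e1], hζ⟩
    have hG : ∀ z, StrongSub κ z y → ∀ w, StrongSub κ w y →
        (w ∈ fam (Y 15) z ↔ w ∈ G z) := fun z hz w hw =>
      mem_fam_famSet hy.ord hy subset_rfl hz hw
    have hGs : ∀ z, IsSStat κ X ζ (G z) y := fun z => by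
      simp only [G]
      split_ifs <;> assumption
    have hR : Reflects κ X y (({14, 15} : Finset (Fin NN)).piecewise Y W) := by
      by_contra hR
      refine H Y hg hR ((hQ' Y _ rfl hg).2 fun z hz => ?_)
      have h1 : IsSStat κ X ζ (fam (Y 15) z) y :=
        (hGs z).mono_set fun a ha hay => (hG z hz a hay).2 ha
      refine ⟨h1.zero hW.mem_Pk, fun β hβ => ?_⟩
      rw [e14, mem_ordOf_ordCode hy] at hβ
      obtain rfl : β = ζ := hβ.1
      exact h1
    obtain ⟨v, hv0, hv⟩ := exists_nonempty_strongSub hW.lim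
    have h0y : StrongSub κ ∅ y := strongSub_empty hW.lim.bot_lt.ne'
    obtain ⟨w, hwy, hwz, hw1, hw2⟩ := hR z ∅ v hz h0y hv ζ (by
      rw [e3, e14]
      exact (mem_ordOf_ordCode hy).2 ⟨rfl, hζs⟩)
    rw [e2] at hwz
    rw [e4] at hw1 hw2
    refine ⟨w, hwz, hwy, hw1.mono_set fun a ha haw => ?_, hw2.mono_set fun a ha haw => ?_⟩
    · simpa [G] using (hG ∅ h0y a (haw.trans hwy)).1 ha
    · simpa [G, hv0] using (hG v hv a (haw.trans hwy)).1 ha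
  · intro H
    refine ⟨fun z hz => (H z hz).1, fun Y hg hR hQY => hR ?_⟩
    rw [hQ' Y _ rfl hg] at hQY
    obtain ⟨e1, e2, e3, e4, -, -⟩ := e Y _ rfl
    intro z z₁ z₂ hz hz₁ hz₂ β hβ
    obtain ⟨α, hα, hβα⟩ := hg β hβ
    rw [e1] at hα
    rw [e3] at hβ
    rw [e2, e4]
    -- Stationarity tests only subsets of P_κ X, so the sections are cut down to it; nothing below y
    -- is lost.
    have hs : ∀ z, StrongSub κ z y → IsSStat κ X β {a ∈ fam (Y 15) z | a ∈ Pk κ X} y :=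
      fun z hz => ((hQY z hz).2 β hβ).mono_set fun a ha hay => ⟨ha, hay.mem_Pk hW.mem_Pk⟩
    obtain ⟨w, hw, hwy, h1, h2⟩ := ((isSStat_of_ne (zero_le.trans_lt hβα).ne').1
      ((H z hz).2 α hα)).2 β hβα _ _ (fun a ha => ha.2) (fun a ha => ha.2) (hs z₁ hz₁) (hs z₂ hz₂)
    exact ⟨w, hwy, hw, h1.mono_set fun a ha _ => ha.1, h2.mono_set fun a ha _ => ha.1⟩

/-- For cofinally many η < ξ the conjunct of index η + 2 says: every Y of degrees dominated by
predicate 12 either is not bounded by η or satisfies `Q η`. Both alternatives can be written as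
Σ¹_{η+1}, so the quantifier over Y gives Π¹_{η+2}. A degree equal to ξ is recovered from the smaller
ones by `isSStat_of_isSuccLimit`. -/
theorem exists_isSSDef_limit {ξ : Ordinal.{u}} (hξ : Order.IsSuccLimit ξ)
    (h : ∀ ζ < ξ, ∃ Q, IsSSDef κ X d ζ Q) : ∃ Q, IsSSDef κ X d ξ Q := by
  have h' : ∀ ζ < ξ, ∃ η < ξ, ζ ≤ η ∧ Expr (IsModel κ X d) .pi (η + 1) (OrdLE κ η) := by
    intro ζ hζ
    rcases expr_ordLE (κ := κ) (X := X) (d := d) ζ with h | h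
    · exact ⟨ζ, hζ, le_rfl, h⟩
    · exact ⟨ζ + 1, hξ.succ_lt hζ, Order.le_succ ζ, h⟩
  choose! Q hQ using h
  let P : Ordinal.{u} → StrProp κ := fun ζ y W => ∀ η,
    η + 1 + 1 = ζ ∧ Expr (IsModel κ X d) .pi (η + 1) (OrdLE κ η) →
      ∀ Y : Fin NN → Set (MM κ y), ∀ W', W' = ({14} : Finset (Fin NN)).piecewise Y W →
        (∀ β ∈ ordOf (W' 14), ∃ α ∈ ordOf (W' 12), β ≤ α) →
          ¬ OrdLE κ η y (W' ∘ ren) ∨ Q η y (W' ∘ ren)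
  have hP : ∀ ζ < ξ, Expr (IsModel κ X d) .pi ζ (P ζ) := by
    intro ζ hζξ
    by_cases hζ : ∃ η, η + 1 + 1 = ζ ∧ Expr (IsModel κ X d) .pi (η + 1) (OrdLE κ η)
    · obtain ⟨η, rfl, hη⟩ := hζ
      have hηξ : η < ξ := ((Order.lt_succ η).trans (Order.lt_succ _)).trans hζξ
      refine (Expr.fo_imp IsModel.isCoded IsModel.fo_forall_le (Expr.or IsModel.isCoded
        hη.comp_ren.not_pi (hQ η hηξ).1.comp_ren.sigma_of_pi)).all₁.congr fun y W _ => ?_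
      constructor
      · rintro H η' ⟨h', -⟩ Y _ rfl
        obtain rfl := Order.succ_injective (Order.succ_injective h')
        exact H Y
      · exact fun H Y => H η ⟨rfl, hη⟩ Y _ rfl
    · exact Expr.top.congr fun y W _ => ⟨fun _ η h' => absurd ⟨η, h'⟩ hζ, fun _ => trivial⟩
  refine ⟨_, Expr.conj hξ hP, fun y W hW hle => ?_⟩
  have e : ∀ Y : Fin NN → Set (MM κ y), ∀ W' : Fin NN → Set (MM κ y),
      W' = ({14} : Finset (Fin NN)).piecewise Y W →
      W' 12 = W 12 ∧ W' 14 = Y 14 ∧ (W' ∘ ren) 12 = Y 14 ∧ (W' ∘ ren) 13 = W 13 := by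
    rintro Y W' rfl
    simp [ren]
  have hQ' : ∀ η < ξ, ∀ Y : Fin NN → Set (MM κ y), ∀ W' : Fin NN → Set (MM κ y),
      W' = ({14} : Finset (Fin NN)).piecewise Y W → OrdLE κ η y (W' ∘ ren) →
      (Q η y (W' ∘ ren) ↔ ∀ z, StrongSub κ z y → IsSStat κ X 0 (fam (W 13) z) y ∧
        ∀ α ∈ ordOf (Y 14), IsSStat κ X α (fam (W 13) z) y) := by
    intro η hη Y W' hW' hle
    obtain ⟨-, -, e5, e6⟩ := e Y W' hW'
    rw [(hQ η hη).2 y _ ((hW' ▸ hW.piecewise _ (by decide) Y : IsModel κ X d y W').comp _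
      (by decide)) hle, SS, e5, e6]
  constructor
  · intro H
    have key : ∀ ζ < ξ, ∀ s : Set Ordinal.{u}, (∀ β ∈ s, β ≤ ζ ∧ ∃ α ∈ ordOf (W 12), β ≤ α) →
        ∀ z, StrongSub κ z y → IsSStat κ X 0 (fam (W 13) z) y ∧
          ∀ α ∈ s, IsSStat κ X α (fam (W 13) z) y := by
      intro ζ hζ s hs z hz
      obtain ⟨η, hη, hζη, hE⟩ := h' ζ hζ
      let Y : Fin NN → Set (MM κ y) := fun _ => ordCode κ y s
      obtain ⟨e1, e2, e3, -⟩ := e Y _ rfl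
      have hY : ∀ β, β ∈ ordOf (Y 14) → β ∈ s := fun β hβ =>
        ((mem_ordOf_ordCode hW.coded.good).1 hβ).1
      have hO : OrdLE κ η y (({14} : Finset (Fin NN)).piecewise Y W ∘ ren) := by
        intro β hβ
        rw [e3] at hβ
        exact (hs β (hY β hβ)).1.trans hζη
      have hq := (H (η + 1 + 1) (hξ.succ_lt (hξ.succ_lt hη)) η ⟨rfl, hE⟩ Y _ rfl (fun β hβ => by
        rw [e2] at hβ
        rw [e1]
        exact (hs β (hY β hβ)).2)).resolve_left (not_not.2 hO)
      rw [hQ' η hη Y _ rfl hO] at hq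
      refine ⟨(hq z hz).1, fun β hβ => (hq z hz).2 β ((mem_ordOf_ordCode hW.coded.good).2
        ⟨hβ, ?_⟩)⟩
      obtain ⟨α, hα, hβα⟩ := (hs β hβ).2
      exact strongSub_toZFSet_of_le hβα (strongSub_of_mem_ordOf hW.coded.good.toIsStd hα)
    intro z hz
    refine ⟨(key 0 hξ.bot_lt ∅ (fun _ h => h.elim) z hz).1, fun α hα => ?_⟩
    -- Singletons Y = {ζ} suffice to extract each individual degree.
    have key' : ∀ ζ < ξ, ζ ≤ α → IsSStat κ X ζ (fam (W 13) z) y := fun ζ hζ hζα =>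
      (key ζ hζ {ζ} (by rintro _ rfl; exact ⟨le_rfl, α, hα, hζα⟩) z hz).2 ζ rfl
    rcases (hle α hα).lt_or_eq with h | rfl
    · exact key' α h le_rfl
    · exact isSStat_of_isSuccLimit hξ fun ζ hζ => key' ζ hζ hζ.le
  · rintro H ζ hζ η ⟨rfl, -⟩ Y W' hW' hg
    by_cases hO : OrdLE κ η y (W' ∘ ren)
    · refine Or.inr ((hQ' η (((Order.lt_succ η).trans (Order.lt_succ _)).trans hζ) Y W' hW' hO).2
        fun z hz => ⟨(H z hz).1, fun β hβ => ?_⟩)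
      obtain ⟨e1, e2, -, -⟩ := e Y W' hW'
      obtain ⟨α, hα, hβα⟩ := hg β (by rwa [e2])
      rw [e1] at hα
      exact ((H z hz).2 α hα).mono hW.mem_Pk hβα
    · exact Or.inl hO

theorem exists_isSSDef (ξ : Ordinal.{u}) : ∃ Q, IsSSDef κ X d ξ Q := by
  induction ξ using Ordinal.limitRecOn with
  | zero => exact ⟨_, isSSDef_zero⟩
  | add_one ξ ih => exact ih.elim fun _ hQ => hQ.add_one
  | limit ξ hξ ih => exact exists_isSSDef_limit hξ ih

/-! ### Reflection -/

variable {κ : Cardinal.{u}} {X x y : ZFSet.{u}} {d : ZFSet.{u} → ZFSet.{u} → Set ZFSet.{u}}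

/-- The predicates induced at `y`. -/
def trace (κ : Cardinal.{u}) (y : ZFSet.{u}) (R : Fin NN → Set ZFSet.{u}) :
    Fin NN → Set (MM κ y) :=
  fun i => {a | a.1 ∈ R i}

theorem kap_kap (hx : IsStd κ x) (hyx : y ⊆ x) : y ∩ cardSet (kap κ x) = y ∩ cardSet κ := by
  rw [← hx.inter]
  ext a
  simp only [ZFSet.mem_inter]
  exact ⟨fun h => ⟨h.1, h.2.2⟩, fun h => ⟨h.1, hyx h.1, h.2⟩⟩

theorem kap_kap_eq (hx : IsStd κ x) (hyx : y ⊆ x) : kap (kap κ x) y = kap κ y := by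
  rw [kap, kap_kap hx hyx, kap]

theorem trace_inter_VK (hyx : y ⊆ x) (R : Fin NN → Set ZFSet.{u}) :
    trace κ y (fun i => R i ∩ VK (kap κ x) x) = trace κ y R :=
  funext fun _ => Set.ext fun a =>
    ⟨fun h => h.1, fun h => ⟨h, VK_subset_VK hyx (kap_mono hyx) a.2⟩⟩

/-- Indescribability speaks of κ_y computed from κ_x; for y ⊆ x this is the κ_y computed from κ. -/
theorem exists_reflect {ξ : Ordinal.{u}} (hind : IsIndescribable (kap κ x) x ξ (Pk (kap κ x) x))
    (hx : IsStd κ x) (R : Fin NN → Set ZFSet.{u}) (φ : SOFormula.{u} .pi ξ NN)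
    (hφ : φ.Sat (EE κ x) (trace κ x R)) :
    ∃ y, StrongSub κ y x ∧ IsStd κ y ∧ φ.Sat (EE κ y) (trace κ y R) := by
  obtain ⟨y, hy, hyκ, h⟩ := hind NN (fun i => R i ∩ VK (kap κ x) x)
    (fun i => Set.inter_subset_right) φ
      (show φ.Sat (EE κ x) (trace κ x fun i => R i ∩ VK (kap κ x) x) by
        rwa [trace_inter_VK subset_rfl])
  have e := kap_kap_eq hx hy.1
  rw [kap_kap hx hy.1, e] at hyκ
  rw [e] at h
  refine ⟨y, hy, ⟨fun a ha => hx.ord a (hy.1 ha), hyκ⟩, ?_⟩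
  rw [← trace_inter_VK hy.1]
  exact h

/-- The side condition is absorbed by the formula "if χ then φ, else false". -/
theorem exists_reflect_fo {ξ : Ordinal.{u}}
    (hind : IsIndescribable (kap κ x) x ξ (Pk (kap κ x) x)) (hx : IsStd κ x)
    (R : Fin NN → Set ZFSet.{u}) (χ : (setLang NN).Sentence)
    (hχ : FOSat (EE κ x) (trace κ x R) χ) (φ : SOFormula.{u} .pi ξ NN)
    (hφ : φ.Sat (EE κ x) (trace κ x R)) :
    ∃ y, StrongSub κ y x ∧ IsStd κ y ∧ FOSat (EE κ y) (trace κ y R) χ ∧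
      φ.Sat (EE κ y) (trace κ y R) := by
  obtain ⟨ψ, hψ⟩ := SOFormula.exists_bot.{u, u + 1} .pi ξ NN
  obtain ⟨θ, hθ⟩ := SOFormula.exists_ite.{u, u + 1} χ φ ψ
  obtain ⟨y, hyx, hy, h⟩ := exists_reflect hind hx R θ
    ((hθ _ _).2 ⟨fun _ => hφ, fun h => absurd hχ h⟩)
  rw [hθ] at h
  have : FOSat (EE κ y) (trace κ y R) χ := by
    by_contra hn
    exact hψ _ _ (h.2 hn)
  exact ⟨y, hyx, hy, this, h.1 this⟩

theorem IsStd.isSuccLimit_kap (hy : IsStd κ y) (h0 : kap κ y ≠ 0)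
    (h : ∀ α : Ordinal.{u}, StrongSub κ α.toZFSet y →
      ∃ w, StrongSub κ w y ∧ StrongSub κ α.toZFSet w) : Order.IsSuccLimit (kap κ y) := by
  refine Cardinal.isSuccLimit_iff.2 ⟨h0, Order.isSuccPrelimit_of_succ_lt fun c hc => ?_⟩
  obtain ⟨w, hw, hcw⟩ := h c.ord ((strongSub_toZFSet_iff hy).2 (Cardinal.ord_lt_ord.2 hc))
  have := hcw.2
  rw [Ordinal.card_toZFSet, card_ord] at this
  exact (Order.succ_le_of_lt (this.trans_le kap_le_card)).trans_lt hw.2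

theorem mem_VK_toZFSet_iff (hy : IsStd κ y) {α : Ordinal.{u}} :
    α.toZFSet ∈ VK (kap κ y) y ↔ α.toZFSet ∈ y :=
  ⟨hy.mem_of_isOrdinal (ZFSet.isOrdinal_toZFSet α), mem_VK_of_mem⟩

theorem lt_ord_of_mem (hx : IsStd κ x) (hy : IsStd κ y) (hyx : y ⊆ x) {α : Ordinal.{u}}
    (hα : α < (kap κ x).ord) (h : α.toZFSet ∈ y) : α < (kap κ y).ord := by
  have : α.toZFSet ∈ y ∩ cardSet κ := by
    rw [← kap_kap hx hyx]
    exact ZFSet.mem_inter.2 ⟨h, Ordinal.toZFSet_mem_toZFSet_iff.2 hα⟩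
  rw [hy.inter] at this
  exact Ordinal.toZFSet_mem_toZFSet_iff.1 this

/-- For α < κ_x, a point y ≺ x reflecting the nonemptiness of the predicate {α} contains α, so α <
κ_y while |y| < κ_x. Hence κ_x is not a successor. -/
theorem isSuccLimit_kap_of_isIndescribable {ξ : Ordinal.{u}}
    (hind : IsIndescribable (kap κ x) x ξ (Pk (kap κ x) x)) (hx : IsStd κ x)
    (h0 : kap κ x ≠ 0) : Order.IsSuccLimit (kap κ x) := by
  refine hx.isSuccLimit_kap h0 fun α hα => ?_
  rw [strongSub_toZFSet_iff hx] at hα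
  -- The matrix is a tautology; the sentence only says that predicate 0 is nonempty.
  obtain ⟨χ, hχ⟩ := RawFO.exists_sentence (n := NN) ((RawFO.mem.{u + 1} 0 0).imp (RawFO.mem 0 0)) 0
  obtain ⟨φ, hφ⟩ := SOFormula.exists_top.{u, u + 1} .pi ξ NN
  obtain ⟨y, hyx, hy, h, -⟩ := exists_reflect_fo hind hx (fun _ => {α.toZFSet}) χ
    ((hχ _ _ _).2 ⟨⟨_, mem_VK_of_mem (toZFSet_mem_of_lt hx hα)⟩, rfl, id⟩) φ (hφ _ _)
  obtain ⟨⟨_, hm⟩, rfl, -⟩ := (hχ _ _ _).1 h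
  exact ⟨y, hyx, (strongSub_toZFSet_iff hy).2
    (lt_ord_of_mem hx hy hyx.1 hα ((mem_VK_toZFSet_iff hy).1 hm))⟩

/-! ### Reflection to points with infinite κ_y that are closed under a function -/

/-- The ordinals below `κ_x`. -/
def ordsBelow (κ : Cardinal.{u}) (x : ZFSet.{u}) : Set ZFSet.{u} := {a | a ∈ cardSet (kap κ x)}

theorem exists_infinite_sentence (r : Fin NN) :
    ∃ χ : (setLang NN).Sentence, ∀ (M : Type v) (E : M → M → Prop) (R : Fin NN → Set M),
      FOSat E R χ ↔ ∃ m ∈ R r, ∀ a ∈ R r, ∃ b ∈ R r, E a b := by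
  obtain ⟨χ, hχ⟩ := RawFO.exists_sentence (n := NN) (((RawFO.pred.{v} r 0).imp
    (((RawFO.pred r 1).and (RawFO.mem 0 1)).ex 1)).all 0) r
  refine ⟨χ, fun M E R => (hχ M E R).trans ?_⟩
  simp

/-- The ordinals below κ_x form a nonempty set without last element, and this is first-order. Their
trace at y is κ_y, which therefore cannot be finite. -/
theorem exists_reflect_isGood {ξ : Ordinal.{u}}
    (hind : IsIndescribable (kap κ x) x ξ (Pk (kap κ x) x)) (hx : IsGood κ x)
    (R : Fin NN → Set ZFSet.{u}) (hR : R 11 = ordsBelow κ x) (χ : (setLang NN).Sentence)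
    (hχ : FOSat (EE κ x) (trace κ x R) χ) (φ : SOFormula.{u} .pi ξ NN)
    (hφ : φ.Sat (EE κ x) (trace κ x R)) :
    ∃ y, StrongSub κ y x ∧ IsGood κ y ∧ FOSat (EE κ y) (trace κ y R) χ ∧
      φ.Sat (EE κ y) (trace κ y R) := by
  obtain ⟨χ₀, hχ₀⟩ := exists_infinite_sentence.{u + 1} 11
  have key : ∀ {y}, IsStd κ y → y ⊆ x → ∀ a : MM κ y, a ∈ trace κ y R 11 ↔
      ∃ α < (kap κ y).ord, α.toZFSet = a.1 := by
    intro y hy hyx a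
    rw [trace, hR]
    change a.1 ∈ cardSet (kap κ x) ↔ _
    rw [cardSet, Ordinal.mem_toZFSet_iff]
    refine exists_congr fun α => ⟨fun ⟨h, e⟩ => ⟨?_, e⟩,
      fun ⟨h, e⟩ => ⟨h.trans_le (Cardinal.ord_le_ord.2 (kap_mono hyx)), e⟩⟩
    exact lt_ord_of_mem hx.toIsStd hy hyx h ((mem_VK_toZFSet_iff hy).1 (e ▸ a.2))
  have hlim := isSuccLimit_ord hx.inf
  obtain ⟨y, hyx, hy, h, hφy⟩ := exists_reflect_fo hind hx.toIsStd R (χ₀ ⊓ χ) (by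
    rw [FOSat_inf, hχ₀]
    refine ⟨⟨⟨Ordinal.toZFSet 0, mem_VK_of_mem (toZFSet_mem_of_lt hx.toIsStd hlim.bot_lt)⟩,
      (key hx.toIsStd subset_rfl _).2 ⟨0, hlim.bot_lt, rfl⟩, ?_⟩, hχ⟩
    intro a ha
    obtain ⟨α, hα, hαa⟩ := (key hx.toIsStd subset_rfl _).1 ha
    refine ⟨⟨_, mem_VK_of_mem (toZFSet_mem_of_lt hx.toIsStd (hlim.succ_lt hα))⟩,
      (key hx.toIsStd subset_rfl _).2 ⟨_, hlim.succ_lt hα, rfl⟩, ?_⟩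
    change a.1 ∈ (Order.succ α).toZFSet
    rw [← hαa]
    exact Ordinal.toZFSet_mem_toZFSet_iff.2 (Order.lt_succ α)) φ hφ
  rw [FOSat_inf, hχ₀] at h
  obtain ⟨⟨m, hm, H⟩, h⟩ := h
  refine ⟨y, hyx, ⟨hy, ?_⟩, h, hφy⟩
  by_contra hfin
  obtain ⟨n, hn⟩ := lt_aleph0.1 (not_le.1 hfin)
  have hn' : (kap κ y).ord = n := by rw [hn, ord_natCast]
  obtain ⟨α, hα, -⟩ := (key hy hyx.1 m).1 hm
  rw [hn'] at hα
  rcases n with - | n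
  · exact absurd hα (by simp)
  · have hlt : (n : Ordinal.{u}) < (kap κ y).ord := by
      rw [hn']
      exact_mod_cast n.lt_succ_self
    obtain ⟨b, hb, hab⟩ := H ⟨_, mem_VK_of_mem (toZFSet_mem_of_lt hy hlt)⟩
      ((key hy hyx.1 _).2 ⟨_, hlt, rfl⟩)
    obtain ⟨β, hβ, hβb⟩ := (key hy hyx.1 _).1 hb
    change (n : Ordinal.{u}).toZFSet ∈ b.1 at hab
    rw [← hβb, Ordinal.toZFSet_mem_toZFSet_iff] at hab
    rw [hn', Nat.cast_succ] at hβ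
    exact absurd (Order.lt_succ_iff.1 hβ) (not_le.2 hab)

/-- The predicates used for reflecting iterated stationarity to points above `v₀` closed
under `F`. -/
noncomputable def basePred (κ : Cardinal.{u}) (X x : ZFSet.{u})
    (d : ZFSet.{u} → ZFSet.{u} → Set ZFSet.{u}) (F : ZFSet.{u} → ZFSet.{u}) (v₀ : ZFSet.{u})
    (Z₁ F₁ Z₂ F₂ : Set ZFSet.{u}) : Fin NN → Set ZFSet.{u} :=
  ![{m | ∃ v, StrongSub κ v x ∧ m = code v}, {tag 0}, {tag 1}, {tag 2},
    tripleSet κ x fun t => StrongSub κ (t 0) (t 1) ∧ t 2 = t 1,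
    tripleSet κ x fun t =>
      (∃ α β : Ordinal.{u}, α < β ∧ t 0 = α.toZFSet ∧ t 1 = β.toZFSet) ∧ t 2 = t 1,
    tripleSet κ x fun t =>
      (∃ α β : Ordinal.{u}, α ≤ β + 2 ∧ t 0 = α.toZFSet ∧ t 1 = β.toZFSet) ∧ t 2 = t 1,
    tripleSet κ x fun t => t 2 ∈ d (t 0) (t 1),
    tripleSet κ x fun t =>
      ∃ ζ : Ordinal.{u}, t 2 = ζ.toZFSet ∧ IsSStat κ X ζ (d (t 0) (t 1)) (t 0),
    -- Predicates 14 and 15 are placeholders for quantified sets; 12, 13 and 16, 17 hold the degrees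
    -- and families of the two sides.
    famSet κ x fun v => {F v}, {code v₀}, ordsBelow κ x, Z₁, F₁, ∅, ∅, Z₂, F₂]

section Base

variable {F : ZFSet.{u} → ZFSet.{u}} {v₀ : ZFSet.{u}} {Z₁ F₁ Z₂ F₂ : Set ZFSet.{u}}

theorem isCoded_trace (hx : IsGood κ x) (hy : IsGood κ y) (hyx : y ⊆ x) :
    IsCoded κ y (trace κ y (basePred κ X x d F v₀ Z₁ F₁ Z₂ F₂)) where
  good := hy
  codes m := by
    refine exists_congr fun v => ⟨fun ⟨hv, e⟩ => ⟨hy.strongSub_of_code_mem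
      (fun a ha => hx.ord a (hv.1 ha)) (e ▸ m.2), e⟩, fun ⟨hv, e⟩ => ⟨hv.of_subset hyx, e⟩⟩
  tags i m := by
    fin_cases i <;> rfl

theorem isModel_trace (hx : IsGood κ x) (hy : IsGood κ y) (hyx : y ⊆ x) (hyX : y ∈ Pk κ X)
    (hlim : Order.IsSuccLimit (kap κ y))
    (hd : ∀ w, StrongSub κ w y → ∀ U : Set ZFSet.{u},
      ∃ i, StrongSub κ i y ∧ ∀ v, StrongSub κ v w → (v ∈ d w i ↔ v ∈ U)) :
    IsModel κ X d y (trace κ y (basePred κ X x d F v₀ Z₁ F₁ Z₂ F₂)) where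
  coded := isCoded_trace hx hy hyx
  mem_Pk := hyX
  lim := hlim
  prec _ ht := memT_tripleSet hx.ord hy hyx ht
  lt _ ht := memT_tripleSet hx.ord hy hyx ht
  le _ ht := memT_tripleSet hx.ord hy hyx ht
  mem _ ht := memT_tripleSet hx.ord hy hyx ht
  stat _ ht := memT_tripleSet hx.ord hy hyx ht
  index := hd

/-- With the graph of F as a predicate, closure says that every individual has an image in the
structure, and a singleton predicate keeps v₀ present; both are first-order. -/
theorem exists_reflect_closed {ξ : Ordinal.{u}}
    (hind : IsIndescribable (kap κ x) x ξ (Pk (kap κ x) x)) (hx : IsGood κ x)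
    (hF : ∀ v, StrongSub κ v x → StrongSub κ (F v) x) (hv₀ : StrongSub κ v₀ x)
    (φ : SOFormula.{u} .pi ξ NN)
    (hφ : φ.Sat (EE κ x) (trace κ x (basePred κ X x d F v₀ Z₁ F₁ Z₂ F₂))) :
    ∃ y, StrongSub κ y x ∧ IsGood κ y ∧ (∀ v, StrongSub κ v y → StrongSub κ (F v) y) ∧
      StrongSub κ v₀ y ∧ φ.Sat (EE κ y) (trace κ y (basePred κ X x d F v₀ Z₁ F₁ Z₂ F₂)) := by
  have hK : ∀ y W, IsCoded κ y W → IsCoded κ y W := fun _ _ h => h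
  obtain ⟨χ, hχ⟩ := FOExpr.exists_sentence hK
    (Q := fun y W => (∀ v : Ind κ y, ∃ w : Ind κ y, w.1 ∈ fam (W 9) v.1) ∧
      ∃ v : Ind κ y, MemU (W 10) v.1)
    ((((((FOExpr.memT hK 9 ![0, 1, 1] (by decide)).ex hK 1).all hK 0).and
      ((FOExpr.memU 10 0).ex hK 0))).congr fun y W _ p => by
        simp only [fam, Set.mem_ofPred_eq, Function.update_self]
        refine and_congr (forall_congr' fun v => exists_congr fun w => ?_) Iff.rfl
        rw [show (fun i => (Function.update (Function.update p 0 v) 1 w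
          ((![0, 1, 1] : Fin 3 → ℕ) i)).1) = ![v.1, w.1, w.1] by
            funext l; fin_cases l <;> simp])
  have h9 : ∀ {y}, IsGood κ y → y ⊆ x → ∀ v w : Ind κ y,
      w.1 ∈ fam (trace κ y (basePred κ X x d F v₀ Z₁ F₁ Z₂ F₂) 9) v.1 ↔ w.1 = F v.1 :=
    fun hy hyx v w => mem_fam_famSet (G := fun v => {F v}) hx.ord hy hyx v.2 w.2
  have h10 : ∀ {y}, IsGood κ y → y ⊆ x → ∀ v : Ind κ y,
      MemU (trace κ y (basePred κ X x d F v₀ Z₁ F₁ Z₂ F₂) 10) v.1 ↔ v.1 = v₀ := fun hy hyx v =>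
    memU_iff hy (s := {v₀}) (fun v hv a ha => hx.ord a (hv₀.1 ((hv : v = v₀) ▸ ha)))
      (fun m => by simp [trace, basePred]) v.2
  obtain ⟨y, hyx, hy, h, hφy⟩ := exists_reflect_isGood hind hx _ rfl χ
    ((hχ _ _ (isCoded_trace hx hx subset_rfl)).2
      ⟨fun v => ⟨⟨F v.1, hF _ v.2⟩, (h9 hx subset_rfl _ _).2 rfl⟩, ⟨v₀, hv₀⟩,
        (h10 hx subset_rfl _).2 rfl⟩) φ hφ
  obtain ⟨h1, v, h2⟩ := (hχ _ _ (isCoded_trace hx hy hyx.1)).1 h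
  refine ⟨y, hyx, hy, fun v hv => ?_, (h10 hy hyx.1 v).1 h2 ▸ v.2, hφy⟩
  obtain ⟨w, hw⟩ := h1 ⟨v, hv⟩
  exact (h9 hy hyx.1 _ _).1 hw ▸ w.2

end Base

/-! ### Reflection of families of stationary sets -/

theorem exists_injOn_of_card_le {a b : ZFSet.{u}} (h : a.card ≤ b.card) :
    ∃ e : ZFSet.{u} → ZFSet.{u}, (∀ c ∈ a, e c ∈ b) ∧ ∀ c ∈ a, ∀ c' ∈ a, e c = e c' → c = c' := by
  have h' : #a ≤ #b := by
    rw [ZFSet.cardinalMk_coe_sort, ZFSet.cardinalMk_coe_sort]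
    exact lift_le.2 h
  obtain ⟨f⟩ := h'
  classical
  refine ⟨fun c => if hc : c ∈ a then (f ⟨c, hc⟩).1 else ∅, fun c hc => ?_,
    fun c hc c' hc' h => ?_⟩
  · simp only [hc, dif_pos]
    exact (f ⟨c, hc⟩).2
  · simp only [hc, hc', dif_pos] at h
    exact congrArg Subtype.val (f.injective (Subtype.ext h))

/-- Otherwise κ_x injects into the power set of some c < κ_x. Let F send the subset assigned to a to
{a}. A reflecting y ≺ x above c and closed under F sees every subset of c as an individual, so it
contains all of κ_x, contradicting |y| < κ_x. -/
theorem two_power_lt_kap {ξ : Ordinal.{u}} (hind : IsIndescribable (kap κ x) x ξ (Pk (kap κ x) x))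
    (hx : IsGood κ x) {c : Cardinal.{u}} (hc : c < kap κ x) : 2 ^ c < kap κ x := by
  by_contra hle
  have hle : (cardSet (kap κ x)).card ≤ (c.ord.toZFSet).powerset.card := by
    rw [ZFSet.card_powerset, Ordinal.card_toZFSet, card_ord, cardSet, Ordinal.card_toZFSet,
      card_ord]
    exact not_lt.1 hle
  obtain ⟨e, he, hinj⟩ := exists_injOn_of_card_le hle
  obtain ⟨φ, hφ⟩ := SOFormula.exists_top.{u, u + 1} .pi ξ NN
  have hsing : ∀ a ∈ cardSet (kap κ x), StrongSub κ {a} x := fun a ha =>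
    ⟨fun b hb => by
      rw [ZFSet.mem_singleton.1 hb]
      exact (ZFSet.mem_inter.1 (hx.inter ▸ ha)).1, by
      rw [ZFSet.card_singleton]
      exact one_lt_aleph0.trans_le hx.inf⟩
  have hF : ∀ v : ZFSet.{u}, ∃ w, StrongSub κ w x ∧ ∀ a ∈ cardSet (kap κ x), e a = v → a ∈ w := by
    intro v
    by_cases hv : ∃ a ∈ cardSet (kap κ x), e a = v
    · obtain ⟨a, ha, rfl⟩ := hv
      exact ⟨{a}, hsing a ha, fun b hb h => ZFSet.mem_singleton.2 (hinj b hb a ha h)⟩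
    · exact ⟨∅, strongSub_empty (aleph0_pos.trans_le hx.inf).ne', fun a ha h => (hv ⟨a, ha, h⟩).elim⟩
  choose F hF hFe using hF
  obtain ⟨y, hyx, hy, hyF, hcy, -⟩ := exists_reflect_closed (X := ∅) (d := fun _ _ => ∅) (Z₁ := ∅)
    (F₁ := ∅) (Z₂ := ∅) (F₂ := ∅) hind hx (fun v _ => hF v)
      ((strongSub_toZFSet_iff hx.toIsStd).2 (Cardinal.ord_lt_ord.2 hc)) φ (hφ _ _)
  have hsub : cardSet (kap κ x) ⊆ y := fun a ha =>
    (hyF _ (hcy.mono (ZFSet.mem_powerset.1 (he a ha)))).1 (hFe _ a ha rfl)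
  have := (ZFSet.card_mono hsub).trans_lt hyx.2
  rw [cardSet, Ordinal.card_toZFSet, card_ord] at this
  exact lt_irrefl _ this

/-- An ordinal indexing the subsets of `P_{κ_w} w`. -/
noncomputable def indexSet (w : ZFSet.{u}) : ZFSet.{u} := cardSet ((2 : Cardinal.{u}) ^ (2 : Cardinal.{u}) ^ w.card)

theorem exists_index (w : ZFSet.{u}) : ∃ D : ZFSet.{u} → Set ZFSet.{u}, ∀ U : Set ZFSet.{u},
    ∃ i ∈ indexSet w, ∀ v, v ⊆ w → (v ∈ D i ↔ v ∈ U) := by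
  obtain ⟨e, he, hinj⟩ := exists_injOn_of_card_le (a := w.powerset.powerset) (b := indexSet w) (by
    rw [ZFSet.card_powerset, ZFSet.card_powerset, indexSet, cardSet, Ordinal.card_toZFSet, card_ord])
  refine ⟨fun i => {v | ∃ s ∈ w.powerset.powerset, e s = i ∧ v ∈ s}, fun U => ?_⟩
  have hs : ZFSet.sep (· ∈ U) w.powerset ∈ w.powerset.powerset :=
    ZFSet.mem_powerset.2 fun a ha => (ZFSet.mem_sep.1 ha).1
  refine ⟨_, he _ hs, fun v hv => ⟨?_, fun h =>
    ⟨_, hs, rfl, ZFSet.mem_sep.2 ⟨ZFSet.mem_powerset.2 hv, h⟩⟩⟩⟩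
  rintro ⟨s, hs', h, hvs⟩
  rw [hinj _ hs' _ hs h] at hvs
  exact (ZFSet.mem_sep.1 hvs).2

/-- The Π¹_ξ formula stating the stationarity of both families holds at x and is reflected to a y
that is again an `IsModel`, where it can be decoded. -/
theorem reflectsFamilies_of_isIndescribable {ξ : Ordinal.{u}} (hx : IsStd κ x) (hxX : x ∈ Pk κ X)
    (hξ : ξ < (kap κ x).ord) (hind : IsIndescribable (kap κ x) x ξ (Pk (kap κ x) x)) :
    Order.IsSuccLimit (kap κ x) ∧ ReflectsFamilies κ X x ξ := by
  have h0 : kap κ x ≠ 0 := by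
    intro h
    rw [h, ord_zero] at hξ
    exact not_lt_zero hξ
  have hlim := isSuccLimit_kap_of_isIndescribable hind hx h0
  have hg : IsGood κ x := ⟨hx, aleph0_le_of_isSuccLimit hlim⟩
  refine ⟨hlim, fun ζ₁ hζ₁ ζ₂ hζ₂ A B hAB v hv => ?_⟩
  -- Points closed under this F have limit κ_y, and they contain indices for all subsets of P(w)
  -- whenever w ≺ y.
  have hF : ∀ v, StrongSub κ v x →
      ∃ w, StrongSub κ w x ∧ StrongSub κ v w ∧ StrongSub κ (indexSet v) w := by
    refine fun v hv => exists_strongSub_of_isSuccLimit hlim hv ?_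
    exact (strongSub_toZFSet_iff hx).2 (Cardinal.ord_lt_ord.2
      (two_power_lt_kap hind hg (two_power_lt_kap hind hg hv.2)))
  choose! F hFx hF hFi using hF
  choose d hd using exists_index.{u}
  have hmodel : ∀ {y v₀ Z₁ F₁ Z₂ F₂}, IsGood κ y → y ⊆ x →
      (∀ v, StrongSub κ v y → StrongSub κ (F v) y) →
      IsModel κ X d y (trace κ y (basePred κ X x d F v₀ Z₁ F₁ Z₂ F₂)) := by
    intro y v₀ Z₁ F₁ Z₂ F₂ hy hyx hyF
    refine isModel_trace hg hy hyx ⟨fun a ha => hxX.1 (hyx ha), (ZFSet.card_mono hyx).trans_lt hxX.2⟩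
      (hy.isSuccLimit_kap (aleph0_pos.trans_le hy.inf).ne' fun α hα =>
        ⟨_, hyF _ hα, hF _ (hα.of_subset hyx)⟩) fun w hw U => ?_
    obtain ⟨i, hi, h⟩ := hd w U
    refine ⟨i, ?_, fun v hv => h v hv.1⟩
    have := (hFi w (hw.of_subset hyx)).trans (hyF w hw)
    refine this.mono fun a ha => (ZFSet.isOrdinal_toZFSet _).mem_trans ha hi
  obtain ⟨Q, hQ, hQs⟩ := exists_isSSDef (κ := κ) (X := X) (d := d) ξ
  -- The second family uses the same formula, read off predicates 16 and 17.
  let ρ : Fin NN → Fin NN := fun j => if j = 12 then 16 else if j = 13 then 17 else j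
  have hρ : ∀ y W, IsModel κ X d y W → IsModel κ X d y (W ∘ ρ) := fun _ _ h =>
    h.comp _ (by decide)
  obtain ⟨φ, hφ⟩ := Expr.and IsModel.isCoded hQ (hQ.rename ρ hρ)
  have hs : ∀ {ζ}, ζ ≤ ξ → StrongSub κ ζ.toZFSet x := fun h =>
    (strongSub_toZFSet_iff hx).2 (h.trans_lt hξ)
  -- Besides v, the reflecting point must lie above ζ₁ and ζ₂; otherwise the coded degrees would
  -- vanish at y and the reflected formula would say nothing about them.
  obtain ⟨v₁, hv₁x, hζ₁v₁, hζ₂v₁⟩ := exists_strongSub_of_isSuccLimit hlim (hs hζ₁) (hs hζ₂)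
  obtain ⟨v₀, hv₀x, hv₁, hvv₀⟩ := exists_strongSub_of_isSuccLimit hlim hv₁x hv
  let C : Ordinal.{u} → Set ZFSet.{u} := fun ζ => {m | ∃ α ∈ ({ζ} : Set Ordinal.{u}), m = code α.toZFSet}
  have hC : ∀ {y}, IsGood κ y → ∀ ζ α, α ∈ ordOf {m : MM κ y | m.1 ∈ C ζ} ↔
      α = ζ ∧ StrongSub κ α.toZFSet y := fun hy ζ α => mem_ordOf_ordCode hy
  have hfam : ∀ {y} {G : ZFSet.{u} → Set ZFSet.{u}}, IsGood κ y → y ⊆ x → ∀ z, StrongSub κ z y →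
      ∀ ζ, IsSStat κ X ζ (fam {m : MM κ y | m.1 ∈ famSet κ x G} z) y ↔ IsSStat κ X ζ (G z) y :=
    fun hy hyx z hz ζ =>
      ⟨fun h => h.mono_set fun a ha hay => (mem_fam_famSet hx.ord hy hyx hz hay).1 ha,
        fun h => h.mono_set fun a ha hay => (mem_fam_famSet hx.ord hy hyx hz hay).2 ha⟩
  have hle : ∀ {y W ζ}, IsGood κ y → ζ ≤ ξ → W 12 = {m : MM κ y | m.1 ∈ C ζ} → OrdLE κ ξ y W := by
    intro y W ζ hy hζ hW α hα
    rw [hW, hC hy] at hα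
    exact hα.1 ▸ hζ
  obtain ⟨y, hyx, hy, hyF, hv₀y, h⟩ := exists_reflect_closed (X := X) (d := d) (Z₁ := C ζ₁)
    (F₁ := famSet κ x A) (Z₂ := C ζ₂) (F₂ := famSet κ x B) hind hg hFx hv₀x φ (by
      have hM := hmodel (v₀ := v₀) (Z₁ := C ζ₁) (F₁ := famSet κ x A) (Z₂ := C ζ₂)
        (F₂ := famSet κ x B) hg subset_rfl hFx
      have key : ∀ {W : Fin NN → Set (MM κ x)} {ζ G}, IsModel κ X d x W → ζ ≤ ξ →
          W 12 = {m : MM κ x | m.1 ∈ C ζ} → W 13 = {m : MM κ x | m.1 ∈ famSet κ x G} →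
          (∀ z, StrongSub κ z x → IsSStat κ X ζ (G z) x) → Q x W := by
        intro W ζ G hW hζ h12 h13 hG
        refine (hQs x W hW (hle hg hζ h12)).2 fun z hz => ?_
        rw [h12, h13, hfam hg subset_rfl z hz]
        refine ⟨(hG z hz).zero hxX, fun α hα => ?_⟩
        rw [hC hg] at hα
        rw [hfam hg subset_rfl z hz, hα.1]
        exact hG z hz
      exact (hφ _ _ hM).2 ⟨key hM hζ₁ rfl rfl fun z hz => (hAB z hz).1,
        key (hρ _ _ hM) hζ₂ rfl rfl fun z hz => (hAB z hz).2⟩)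
  have hM := hmodel (v₀ := v₀) (Z₁ := C ζ₁) (F₁ := famSet κ x A) (Z₂ := C ζ₂)
    (F₂ := famSet κ x B) hy hyx.1 hyF
  obtain ⟨hQ₁, hQ₂⟩ := (hφ _ _ hM).1 h
  have key : ∀ {W : Fin NN → Set (MM κ y)} {ζ G}, IsModel κ X d y W → ζ ≤ ξ →
      W 12 = {m : MM κ y | m.1 ∈ C ζ} → W 13 = {m : MM κ y | m.1 ∈ famSet κ x G} →
      StrongSub κ ζ.toZFSet y → Q y W → ∀ z, StrongSub κ z y → IsSStat κ X ζ (G z) y := by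
    intro W ζ G hW hζ h12 h13 hζy hQW z hz
    have := ((hQs y W hW (hle hy hζ h12)).1 hQW z hz).2 ζ (by rw [h12, hC hy]; exact ⟨rfl, hζy⟩)
    rwa [h13, hfam hy hyx.1 z hz] at this
  exact ⟨y, hyx, hvv₀.trans hv₀y, fun z hz =>
    ⟨key hM hζ₁ rfl rfl (hζ₁v₁.trans (hv₁.trans hv₀y)) hQ₁ z hz,
      key (hρ _ _ hM) hζ₂ rfl rfl (hζ₂v₁.trans (hv₁.trans hv₀y)) hQ₂ z hz⟩⟩

end TwoCardinal

theorem mainTheorem10 (κ : Cardinal.{u}) (hκ : κ.IsRegular) (hκ' : Cardinal.aleph0 < κ)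
    (X : ZFSet.{u}) (hX : ∀ a ∈ X, a.IsOrdinal) (hκX : TwoCardinal.cardSet κ ⊆ X)
    (x : ZFSet.{u}) (hx : x ∈ TwoCardinal.Pk κ X)
    (hxκ : x ∩ TwoCardinal.cardSet κ = TwoCardinal.cardSet (TwoCardinal.kap κ x))
    (ξ : Ordinal.{u}) (hξ : ξ < (TwoCardinal.kap κ x).ord)
    (hind : TwoCardinal.IsIndescribable (TwoCardinal.kap κ x) x ξ
      (TwoCardinal.Pk (TwoCardinal.kap κ x) x)) :
    (TwoCardinal.IsIdealOn (TwoCardinal.Pk κ X) (TwoCardinal.NS κ X x (ξ + 1)) ∧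
      TwoCardinal.IsStronglyNormal κ X (TwoCardinal.NS κ X x (ξ + 1)) ∧
      TwoCardinal.IsDiagClosed κ X (TwoCardinal.NS κ X x (ξ + 1))) ∧
    (TwoCardinal.IsIdealOn (TwoCardinal.Pk (TwoCardinal.kap κ x) x)
        {A ∈ TwoCardinal.NS κ X x (ξ + 1) | A ⊆ TwoCardinal.Pk (TwoCardinal.kap κ x) x} ∧
      TwoCardinal.IsStronglyNormal (TwoCardinal.kap κ x) x
        {A ∈ TwoCardinal.NS κ X x (ξ + 1) | A ⊆ TwoCardinal.Pk (TwoCardinal.kap κ x) x} ∧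
      TwoCardinal.IsDiagClosed (TwoCardinal.kap κ x) x
        {A ∈ TwoCardinal.NS κ X x (ξ + 1) | A ⊆ TwoCardinal.Pk (TwoCardinal.kap κ x) x}) := by
  have hstd : TwoCardinal.IsStd κ x := ⟨fun a ha => hX a (hx.1 ha), hxκ⟩
  obtain ⟨hlim, H⟩ := TwoCardinal.reflectsFamilies_of_isIndescribable hstd hx hξ hind
  have hsub : TwoCardinal.Pk (TwoCardinal.kap κ x) x ⊆ TwoCardinal.Pk κ X := fun y hy =>
    TwoCardinal.StrongSub.mem_Pk hy hx
  constructor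
  · have h := H.isIdealOn hlim hx hsub subset_rfl fun _ _ _ => Iff.rfl
    rwa [show {A ∈ TwoCardinal.NS κ X x (ξ + 1) | A ⊆ TwoCardinal.Pk κ X} =
      TwoCardinal.NS κ X x (ξ + 1) from Set.ext fun A => ⟨fun h => h.1, fun h => ⟨h, h.1⟩⟩] at h
  -- Below x the relation ≺ computed from κ_x agrees with the one computed from κ, because x ∩ κ =
  -- κ_x.
  · refine H.isIdealOn hlim hx subset_rfl hsub fun y hy z => ?_
    rw [TwoCardinal.StrongSub, TwoCardinal.StrongSub, TwoCardinal.kap_kap_eq hstd hy.1]
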